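/- **Setting.** Let $W=(W^1,\dots,W^N)$ be a standard $N$-dimensional Brownian motion on a probability space $(\Omega,\mathcal F,\mathbb P)$, $\mathcal F_s=\sigma(W_v:0\le v\le s)$, let $T\ge 0$, $\mu\in\mathbb R^N$, $r>0$, let $\sigma\in\mathbb R^{N\times N}$ be invertible and $\lambda=(\sigma^{T})^{-1}(\mu-r\mathbf 1)$. For $x>0$ and $t\in[0,T]$ an admissible strategy is an $(\mathcal F_s)$-progressively measurable $\mathbb R^N$-valued process $\pi$ with $E\int_t^T|\pi_s|^2ds<\infty$ whose wealth process $$X^\pi_s=x+\int_t^s\sigma\pi_v\cdot\lambda\,dv+\int_t^s\sigma\pi_v\cdot dW_v,\qquad s\in[t,T],$$ satisfies $X^\pi_s\ge 0$ on $[t,T]$. Let $U:(0,\infty)\to\mathbb R$ be $C^\infty$, strictly increasing and strictly concave with $U'(0+)=\infty$, $U'(\infty)=0$, extended by $U(0)=U(0+)\in[-\infty,\infty)$, and put $$u(x,t)=\sup_\pi E\big[U(X^\pi_T)\mid X_t=x\big].$$ Let $I=(U')^{-1}:(0,\infty)\to(0,\infty)$ and assume that $I(y)\le C(1+y^{-\delta})$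 for all $y>0$, for some $C,\delta>0$. Assume that $R(x)=-U'(x)/U''(x)$ is strictly increasing on $(0,\infty)$ with $R(0+)=0$. The relative risk tolerance coefficient and the relative risk tolerance function are $$\tilde R(x)=-\frac{U'(x)}{x\,U''(x)},\qquad \tilde r(x,t)=-\frac{u_x(x,t)}{x\,u_{xx}(x,t)} .$$ Let $H(z,T)=I(e^{-z})$, $z\in\mathbb R$ (the terminal value of the function $H$ given by $u_x(H(z,t),t)=e^{-z-\frac12|\lambda|^2(T-t)}$, which solves $H_t+\frac12|\lambda|^2H_{zz}=0$). **Proposition.** Suppose that, for all $z\in\mathbb R$, $$(\log H(z,T))_{zz}<0\quad\text{and}\quad(\log H(z,T))_{zzz}>0$$ (resp. $(\log H(z,T))_{zz}>0$ and $(\log H(z,T))_{zzz}<0$). Then $\tilde R''(x)>0$ (resp. $\tilde R''(x)<0$) for all $x>0$, and, for every $t\in[0,T)$, the function $\tilde r(\cdot,t)$ is well defined on $(0,\infty)$ ($u(\cdot,t)$ is finite and $C^2$ with $u_{xx}<0$) and is convex (resp. concave) on $(0,\infty)$. -/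

import Mathlib

open MeasureTheory ProbabilityTheory Set Filter Topology Matrix
open scoped NNReal ENNReal

namespace Merton

noncomputable section

/-! ### Utility functions and the associated terminal quantities -/

/-- Utility functions: only the values on `(0, ∞)` are relevant. Strictly increasing, strictly
concave, smooth, with the Inada conditions. -/
structure IsUtility (U : ℝ → ℝ) : Prop where
  contDiffOn : ContDiffOn ℝ (⊤ : ℕ∞) U (Ioi 0)
  strictMonoOn : StrictMonoOn U (Ioi 0)
  strictConcaveOn : StrictConcaveOn ℝ (Ioi 0) U
  inada_zero : Tendsto (deriv U) (𝓝[>] 0) atTop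
  inada_top : Tendsto (deriv U) atTop (𝓝 0)

/-- The inverse marginal utility `I = (U')⁻¹ : (0, ∞) → (0, ∞)`. -/
def inverseMarginal (U : ℝ → ℝ) : ℝ → ℝ :=
  Function.invFunOn (deriv U) (Ioi 0)

/-- The growth condition `I(y) ≤ C (1 + y^{-δ})`, `y > 0`, for some `C, δ > 0`. -/
def InverseMarginalGrowth (U : ℝ → ℝ) : Prop :=
  ∃ C δ : ℝ, 0 < C ∧ 0 < δ ∧ ∀ y : ℝ, 0 < y → inverseMarginal U y ≤ C * (1 + y ^ (-δ))

/-- The (absolute) risk tolerance coefficient `R(x) = - U'(x) / U''(x)`. -/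
def riskTol (U : ℝ → ℝ) (x : ℝ) : ℝ :=
  -(deriv U x) / deriv (deriv U) x

/-- `R(0) = 0` (as the limit at `0+`) and `R` is strictly increasing. -/
structure RiskTolStanding (U : ℝ → ℝ) : Prop where
  tendsto_zero : Tendsto (riskTol U) (𝓝[>] 0) (𝓝 0)
  strictMonoOn : StrictMonoOn (riskTol U) (Ioi 0)

/-- The relative risk tolerance coefficient `R̃(x) = - U'(x) / (x U''(x))`. -/
def relRiskTolCoeff (U : ℝ → ℝ) (x : ℝ) : ℝ :=
  -(deriv U x) / (x * deriv (deriv U) x)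

/-- The function `z ↦ log H(z, T)`, where `H(z, T) = I(e^{-z})`. -/
def logTerminalH (U : ℝ → ℝ) (z : ℝ) : ℝ :=
  Real.log (inverseMarginal U (Real.exp (-z)))

/-! ### Brownian motion and its filtration -/

variable {Ω : Type*} [mΩ : MeasurableSpace Ω] {N : ℕ}

/-- `W = (W¹, …, W^N)` is a standard `N`-dimensional Brownian motion under `P`: the coordinates
are independent real standard Brownian motions (time is indexed by `[0, ∞)`). -/
structure IsStandardBrownianMotion (W : Fin N → ℝ≥0 → Ω → ℝ) (P : Measure Ω) : Prop where
  measurable : ∀ i s, Measurable (W i s)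
  brownian : ∀ i, IsBrownianReal (W i) P
  indep : iIndepFun (fun i ω (s : ℝ≥0) => W i s ω) P

/-- The filtration `ℱ_s = σ(W_v : 0 ≤ v ≤ s)`. -/
def brownianFiltration (W : Fin N → ℝ≥0 → Ω → ℝ) (hW : ∀ i s, Measurable (W i s)) :
    Filtration ℝ≥0 mΩ :=
  Filtration.natural (β := fun _ => Fin N → ℝ) (fun s ω i => W i s ω)
    (fun s => (measurable_pi_lambda _ (fun i => hW i s)).stronglyMeasurable)

/-! ### The Itô integral of square integrable progressive integrands -/

/-- Simple integrands `∑_{k < n} ξ_k 1_{(τ_k, τ_{k+1}]}` with deterministic times `τ_k` and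
bounded, `ℱ_{τ_k}`-measurable, `ℝ^N`-valued coefficients `ξ_k`. -/
structure SimpleProcess (ℱ : Filtration ℝ≥0 mΩ) (N : ℕ) where
  n : ℕ
  time : ℕ → ℝ≥0
  mono : Monotone time
  coef : ℕ → Ω → Fin N → ℝ
  measurable : ∀ k, Measurable[ℱ (time k)] (coef k)
  bounded : ∃ C : ℝ, ∀ k ω j, |coef k ω j| ≤ C

/-- The process represented by a simple integrand. -/
def SimpleProcess.eval {ℱ : Filtration ℝ≥0 mΩ} (S : SimpleProcess ℱ N)
    (v : ℝ≥0) (ω : Ω) : Fin N → ℝ :=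
  ∑ k ∈ Finset.range S.n, if S.time k < v ∧ v ≤ S.time (k + 1) then S.coef k ω else 0

/-- The elementary stochastic integral `∫_t^s S · dW`; the times are clamped to `[t, s]`. -/
def SimpleProcess.integral {ℱ : Filtration ℝ≥0 mΩ} (S : SimpleProcess ℱ N)
    (W : Fin N → ℝ≥0 → Ω → ℝ) (t s : ℝ≥0) (ω : Ω) : ℝ :=
  ∑ k ∈ Finset.range S.n, ∑ j : Fin N,
    S.coef k ω j *
      (W j (max t (min (S.time (k + 1)) s)) ω - W j (max t (min (S.time k) s)) ω)

/-- `E ∫_t^T |φ_v|² dv`, with the Euclidean norm. -/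
def sqIntegral (P : Measure Ω) (φ : ℝ≥0 → Ω → Fin N → ℝ) (t T : ℝ≥0) : ℝ≥0∞ :=
  ∫⁻ ω, (∫⁻ v in Icc (t : ℝ) (T : ℝ),
    ENNReal.ofReal (∑ j, (φ v.toNNReal ω j) ^ 2)) ∂P

/-- `M_s = ∫_t^s φ_v · dW_v` for all `s ∈ [t, T]`: the Itô integral, i.e. the `L²(P)` limit of the
integrals of simple integrands that approximate `φ` in `L²(P ⊗ dv)`. -/
def IsItoIntegral (P : Measure Ω) (ℱ : Filtration ℝ≥0 mΩ) (W : Fin N → ℝ≥0 → Ω → ℝ)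
    (t T : ℝ≥0) (φ : ℝ≥0 → Ω → Fin N → ℝ) (M : ℝ≥0 → Ω → ℝ) : Prop :=
  (∀ s ∈ Icc t T, AEMeasurable (M s) P) ∧
  ∃ S : ℕ → SimpleProcess ℱ N,
    Tendsto (fun n => sqIntegral P (fun v ω => (S n).eval v ω - φ v ω) t T) atTop (𝓝 0) ∧
    ∀ s ∈ Icc t T, Tendsto
      (fun n => ∫⁻ ω, ENNReal.ofReal (((S n).integral W t s ω - M s ω) ^ 2) ∂P) atTop (𝓝 0)

/-! ### The investment problem -/

/-- The market price of risk `λ = (σᵀ)⁻¹ (μ - r 1)`. Column `i` of `σ` is the volatility vector of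
the `i`-th stock. -/
def marketPriceOfRisk (σ : Matrix (Fin N) (Fin N) ℝ) (μ : Fin N → ℝ) (r : ℝ) : Fin N → ℝ :=
  (σᵀ)⁻¹ *ᵥ (fun i => μ i - r)

/-- `π` (discounted amounts held in the stocks) is an admissible strategy on `[t, T]` and `X` is
the associated (discounted) wealth process started at `X_t = x`:
`dX_s = σ π_s · (λ ds + dW_s)`, `E ∫_t^T |π_s|² ds < ∞`, and `X ≥ 0` on `[t, T]`. -/
structure IsAdmissible (P : Measure Ω) (ℱ : Filtration ℝ≥0 mΩ) (W : Fin N → ℝ≥0 → Ω → ℝ)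
    (σ : Matrix (Fin N) (Fin N) ℝ) (lam : Fin N → ℝ) (t T : ℝ≥0) (x : ℝ)
    (π : ℝ≥0 → Ω → Fin N → ℝ) (X : ℝ≥0 → Ω → ℝ) : Prop where
  progressive : IsProgressive ℱ π
  sq_integrable : sqIntegral P π t T < ∞
  continuous : ∀ᵐ ω ∂P, ContinuousOn (fun s => X s ω) (Icc t T)
  wealth : ∃ M : ℝ≥0 → Ω → ℝ, IsItoIntegral P ℱ W t T (fun v ω => σ *ᵥ π v ω) M ∧
    ∀ s ∈ Icc t T, ∀ᵐ ω ∂P,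
      X s ω = x + (∫ v in (t : ℝ)..(s : ℝ), (σ *ᵥ π v.toNNReal ω) ⬝ᵥ lam) + M s ω
  nonneg : ∀ᵐ ω ∂P, ∀ s ∈ Icc t T, 0 ≤ X s ω

/-- The utility extended to wealth `0` by `U(0) = lim_{x ↓ 0} U(x) = inf_{x > 0} U(x)`, which may
be `-∞`. (Negative wealth does not occur.) -/
def extUtility (U : ℝ → ℝ) (x : ℝ) : EReal :=
  if 0 < x then (U x : EReal) else ⨅ y : Ioi (0 : ℝ), (U y : EReal)

/-- The expected utility `E[U(X)] = E[U(X)⁺] - E[U(X)⁻] ∈ [-∞, ∞]`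
(with `∞ - ∞ = -∞`). -/
def expectedUtility (P : Measure Ω) (U : ℝ → ℝ) (X : Ω → ℝ) : EReal :=
  ((∫⁻ ω, (extUtility U (X ω)).toENNReal ∂P : ℝ≥0∞) : EReal) -
    ((∫⁻ ω, (-extUtility U (X ω)).toENNReal ∂P : ℝ≥0∞) : EReal)

/-- The value function `u(x, t) = sup_π E[U(X_T^π) | X_t = x]`, as an extended real. -/
def valueE (P : Measure Ω) (ℱ : Filtration ℝ≥0 mΩ) (W : Fin N → ℝ≥0 → Ω → ℝ)
    (σ : Matrix (Fin N) (Fin N) ℝ) (lam : Fin N → ℝ) (T : ℝ≥0) (U : ℝ → ℝ)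
    (x : ℝ) (t : ℝ≥0) : EReal :=
  ⨆ (π : ℝ≥0 → Ω → Fin N → ℝ) (X : ℝ≥0 → Ω → ℝ)
    (_ : IsAdmissible P ℱ W σ lam t T x π X), expectedUtility P U (X T)

/-- The relative risk tolerance function of a real valued function `u(x, t)`:
`r̃(x, t) = - u_x(x, t) / (x u_xx(x, t))`. -/
def relRiskTolFn (u : ℝ → ℝ≥0 → ℝ) (x : ℝ) (t : ℝ≥0) : ℝ :=
  -(deriv (fun y => u y t) x) / (x * deriv (deriv (fun y => u y t)) x)

/-- The quotient defining `r̃(·, t)` makes sense for the value function `v`: on `(0, ∞)`, `v(·, t)`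
is finite, twice continuously differentiable, and its second derivative is negative. -/
def RelRiskTolWellDefined (v : ℝ → ℝ≥0 → EReal) (t : ℝ≥0) : Prop :=
  (∀ x : ℝ, 0 < x → v x t ≠ ⊤ ∧ v x t ≠ ⊥) ∧
  ContDiffOn ℝ 2 (fun x => (v x t).toReal) (Ioi 0) ∧
  ∀ x : ℝ, 0 < x → deriv (deriv (fun y => (v y t).toReal)) x < 0

end

end Merton

namespace Merton

noncomputable section

/-! ### Elementary properties of utility functions -/

section Utility

variable {U : ℝ → ℝ}

/-! Write `v = |λ|²(T-t)`, `H = H(·,T)`, `g = H'/H = (log H)'`, and let `heat H v` be the Gaussian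
average of `H`. Differentiating `-log U'(H z) = z` gives `H' = R∘H`, so the monotonicity of `R` says
exactly that `H` is convex. The relation `R̃(H z) = g z` then gives `R̃'' = (g'' - g' R')/R²`, whose
sign can be read off.

For `t < T` everything rests on the dual description of the value function: `u_x = e^{-z-v/2}` at `x
= heat H v z`. Then `u_xx = -u_x / heat H' v z`, and `r̃(·,t)` is `k = heat H' v / heat H v`
composed with the inverse of `heat H v`. Averaging keeps `heat H v` convex and increasing, so its
inverse is concave; if `k` is convex and decreasing, the composite is convex. Hence the task is to
carry the two shape conditions on `g` through the heat flow.

Completing the square turns `z` into the parameter of the exponential family with densities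
proportional to `e^{zy/v} H(y) p_v(y)`. Monotonicity holds because `k(z)` is the mean of `g` under
that family, and raising the tilt lowers the mean of a decreasing function
(`integral_exp_mul_mul_le`). Convexity holds because `k` is an affine function plus a multiple of
the mean of the family, so `k''` is a positive multiple of a third central moment. The tilted
log-density `V` has `V' = g + affine`, which is convex, and a centred density `e^V` with `V'` convex
has nonnegative third moment: the difference of the density at `s` and `-s` changes sign at most
once for `s > 0`, and multiplying by `s² - s0²` aligns the signs
(`integral_pow_three_mul_exp_nonneg`). The concave case follows by reflection.

The value function is identified by two bounds. From above, the budget equation `E[ξ X_T] = x` for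
the state price density `ξ`, with the tangent inequality for `U` at the candidate `H(z + v + λ·(W_T
- W_t))`, gives `valueE_le`. From below, martingale representation is avoided. Exponentials of `λ·W`
are replicated by explicit strategies, with the Itô integral verified by Riemann sums and Gaussian
moments; squares of exponential sums are nonnegative payoffs of this kind, and they approximate the
candidate simultaneously under `P` and under the pricing measure. A little spare cash keeps wealth
above some `ε`, where `U` is Lipschitz (`dualValue_le_valueE`). Continuity in `x` closes the gap,
and the supergradient inequality supplies differentiability of the value. -/

lemma IsUtility.contDiffOn_deriv (hU : IsUtility U) :
    ContDiffOn ℝ (⊤ : ℕ∞) (deriv U) (Ioi 0) :=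
  ((contDiffOn_infty_iff_deriv_of_isOpen isOpen_Ioi).1 hU.contDiffOn).2

lemma IsUtility.contDiffOn_deriv2 (hU : IsUtility U) :
    ContDiffOn ℝ (⊤ : ℕ∞) (deriv (deriv U)) (Ioi 0) :=
  ((contDiffOn_infty_iff_deriv_of_isOpen isOpen_Ioi).1 hU.contDiffOn_deriv).2

lemma differentiableAt_of_contDiffOn_Ioi {f : ℝ → ℝ} (hf : ContDiffOn ℝ (⊤ : ℕ∞) f (Ioi 0))
    {x : ℝ} (hx : 0 < x) : DifferentiableAt ℝ f x :=
  (hf.contDiffAt (Ioi_mem_nhds hx)).differentiableAt (by simp)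

lemma IsUtility.hasDerivAt (hU : IsUtility U) {x : ℝ} (hx : 0 < x) :
    HasDerivAt U (deriv U x) x :=
  (differentiableAt_of_contDiffOn_Ioi hU.contDiffOn hx).hasDerivAt

lemma IsUtility.hasDerivAt_deriv (hU : IsUtility U) {x : ℝ} (hx : 0 < x) :
    HasDerivAt (deriv U) (deriv (deriv U) x) x :=
  (differentiableAt_of_contDiffOn_Ioi hU.contDiffOn_deriv hx).hasDerivAt

lemma IsUtility.strictAntiOn_deriv (hU : IsUtility U) : StrictAntiOn (deriv U) (Ioi 0) :=
  hU.strictConcaveOn.strictAntiOn_deriv fun _ hx => (hU.hasDerivAt hx).differentiableAt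

lemma IsUtility.deriv_pos (hU : IsUtility U) {x : ℝ} (hx : 0 < x) : 0 < deriv U x := by
  have h1 : deriv U (x + 1) < deriv U x :=
    hU.strictAntiOn_deriv (mem_Ioi.2 hx) (mem_Ioi.2 (by linarith)) (by linarith)
  refine lt_of_le_of_lt (le_of_tendsto hU.inada_top ?_) h1
  filter_upwards [eventually_ge_atTop (x + 1)] with y hy
  exact hU.strictAntiOn_deriv.antitoneOn (mem_Ioi.2 (by linarith)) (mem_Ioi.2 (by linarith)) hy

lemma IsUtility.deriv2_nonpos (hU : IsUtility U) {x : ℝ} (hx : 0 < x) :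
    deriv (deriv U) x ≤ 0 := by
  rw [← derivWithin_of_isOpen isOpen_Ioi (mem_Ioi.2 hx)]
  exact hU.strictAntiOn_deriv.antitoneOn.derivWithin_nonpos

/-- Strict concavity alone yields only `R ≥ 0`; strict positivity at `x` comes from comparison with
`x / 2`, since `R` is strictly increasing. -/
lemma IsUtility.riskTol_pos (hU : IsUtility U) (hR : RiskTolStanding U) {x : ℝ} (hx : 0 < x) :
    0 < riskTol U x := by
  have h2 : 0 < x / 2 := by linarith
  have h0 : 0 ≤ riskTol U (x / 2) :=
    div_nonneg_of_nonpos (by linarith [hU.deriv_pos h2]) (hU.deriv2_nonpos h2)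
  exact h0.trans_lt (hR.strictMonoOn (mem_Ioi.2 h2) (mem_Ioi.2 hx) (by linarith))

/-- If `U''` vanished, division by zero would make `riskTol` equal to `0`, against its positivity.
-/
lemma IsUtility.deriv2_neg (hU : IsUtility U) (hR : RiskTolStanding U) {x : ℝ} (hx : 0 < x) :
    deriv (deriv U) x < 0 := by
  refine lt_of_le_of_ne (hU.deriv2_nonpos hx) fun h => ?_
  have := hU.riskTol_pos hR hx
  simp [riskTol, h] at this

/-- The tangent inequality for the concave function `U`. -/
lemma IsUtility.le_tangent (hU : IsUtility U) {a b : ℝ} (ha : 0 < a) (hb : 0 < b) :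
    U b ≤ U a + deriv U a * (b - a) := by
  rcases lt_trichotomy a b with h | rfl | h
  · have := hU.strictConcaveOn.concaveOn.slope_le_of_hasDerivAt (mem_Ioi.2 ha) (mem_Ioi.2 hb) h
      (hU.hasDerivAt ha)
    rw [slope_def_field, div_le_iff₀ (by linarith)] at this
    linarith
  · simp
  · have := hU.strictConcaveOn.concaveOn.le_slope_of_hasDerivAt (mem_Ioi.2 hb) (mem_Ioi.2 ha) h
      (hU.hasDerivAt ha)
    rw [slope_def_field, le_div_iff₀ (by linarith)] at this
    linarith

lemma IsUtility.exists_deriv_eq (hU : IsUtility U) {y : ℝ} (hy : 0 < y) :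
    ∃ x, 0 < x ∧ deriv U x = y := by
  obtain ⟨a, ha, ha0⟩ := ((hU.inada_zero.eventually_ge_atTop y).and self_mem_nhdsWithin).exists
  obtain ⟨b, hb, hb0⟩ := ((hU.inada_top.eventually (gt_mem_nhds hy)).and
    (eventually_gt_atTop (0 : ℝ))).exists
  have hc : ContinuousOn (deriv U) (Ioi 0) := hU.contDiffOn_deriv.continuousOn
  obtain ⟨x, hx, hxy⟩ := isPreconnected_Ioi.intermediate_value (mem_Ioi.2 hb0) ha0 hc
    (show y ∈ Icc (deriv U b) (deriv U a) from ⟨hb.le, ha⟩)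
  exact ⟨x, hx, hxy⟩

lemma IsUtility.inverseMarginal_pos (hU : IsUtility U) {y : ℝ} (hy : 0 < y) :
    0 < inverseMarginal U y := by
  obtain ⟨x, hx, hxy⟩ := hU.exists_deriv_eq hy
  exact Function.invFunOn_mem (f := deriv U) (s := Ioi 0) ⟨x, hx, hxy⟩

lemma IsUtility.deriv_inverseMarginal (hU : IsUtility U) {y : ℝ} (hy : 0 < y) :
    deriv U (inverseMarginal U y) = y := by
  obtain ⟨x, hx, hxy⟩ := hU.exists_deriv_eq hy
  exact Function.invFunOn_eq (f := deriv U) (s := Ioi 0) ⟨x, hx, hxy⟩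

lemma IsUtility.inverseMarginal_deriv (hU : IsUtility U) {x : ℝ} (hx : 0 < x) :
    inverseMarginal U (deriv U x) = x :=
  hU.strictAntiOn_deriv.injOn (hU.inverseMarginal_pos (hU.deriv_pos hx)) hx
    (hU.deriv_inverseMarginal (hU.deriv_pos hx))

end Utility

/-! ### Terminal profiles -/

/-- The properties of `H = H(·, T)` (with derivative `H'`) used in the sequel. -/
structure IsTerminalProfile (H H' : ℝ → ℝ) : Prop where
  pos : ∀ z, 0 < H z
  hasDerivAt : ∀ z, HasDerivAt H (H' z) z
  deriv_pos : ∀ z, 0 < H' z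
  deriv_mono : Monotone H'
  deriv_cont : Continuous H'
  growth : ∃ C δ : ℝ, 0 < C ∧ 0 < δ ∧ ∀ z, H z ≤ C * (1 + Real.exp (δ * z))
  surj : ∀ x, 0 < x → ∃ z, H z = x

/-- `H(z, T) = I(e^{-z})`. -/
def terminalH (U : ℝ → ℝ) (z : ℝ) : ℝ := inverseMarginal U (Real.exp (-z))

section TerminalH

variable {U : ℝ → ℝ}

lemma terminalH_pos (hU : IsUtility U) (z : ℝ) : 0 < terminalH U z :=
  hU.inverseMarginal_pos (Real.exp_pos _)

lemma deriv_terminalH (hU : IsUtility U) (z : ℝ) : deriv U (terminalH U z) = Real.exp (-z) :=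
  hU.deriv_inverseMarginal (Real.exp_pos _)

lemma terminalH_neg_log_deriv (hU : IsUtility U) {x : ℝ} (hx : 0 < x) :
    terminalH U (-Real.log (deriv U x)) = x := by
  rw [terminalH, neg_neg, Real.exp_log (hU.deriv_pos hx), hU.inverseMarginal_deriv hx]

lemma hasDerivAt_neg_log_deriv (hU : IsUtility U) {x : ℝ} (hx : 0 < x) :
    HasDerivAt (fun x => -Real.log (deriv U x)) (riskTol U x)⁻¹ x := by
  refine ((hU.hasDerivAt_deriv hx).log (hU.deriv_pos hx).ne').neg.congr_deriv ?_
  rw [show riskTol U x = -(deriv U x) / deriv (deriv U) x from rfl, inv_div, div_neg]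

lemma terminalH_strictMono (hU : IsUtility U) : StrictMono (terminalH U) := by
  intro a b hab
  rw [← hU.strictAntiOn_deriv.lt_iff_gt (terminalH_pos hU b) (terminalH_pos hU a),
    deriv_terminalH hU, deriv_terminalH hU]
  exact Real.exp_lt_exp.2 (by linarith)

/-- A monotone function cannot jump at a point if its range is a neighbourhood of the value there;
here the range contains `(0, ∞)`. -/
lemma terminalH_continuous (hU : IsUtility U) : Continuous (terminalH U) := by
  refine continuous_iff_continuousAt.2 fun z => ?_
  refine continuousAt_of_monotoneOn_of_image_mem_nhds
    ((terminalH_strictMono hU).monotone.monotoneOn univ) univ_mem ?_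
  refine mem_of_superset (Ioi_mem_nhds (terminalH_pos hU z)) fun x hx => ?_
  exact ⟨_, mem_univ _, terminalH_neg_log_deriv hU hx⟩

/-- The identity `H' = R∘H`, from differentiating the left inverse `x ↦ -log U'(x)`, whose
derivative is `1/R`. -/
lemma hasDerivAt_terminalH (hU : IsUtility U) (hR : RiskTolStanding U) (z : ℝ) :
    HasDerivAt (terminalH U) (riskTol U (terminalH U z)) z := by
  have h := hasDerivAt_neg_log_deriv hU (terminalH_pos hU z)
  rw [← inv_inv (riskTol U (terminalH U z))]
  refine HasDerivAt.of_local_left_inverse (terminalH_continuous hU).continuousAt h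
    (inv_ne_zero (hU.riskTol_pos hR (terminalH_pos hU z)).ne') ?_
  refine Eventually.of_forall fun y => ?_
  simp only [deriv_terminalH hU, Real.log_exp, neg_neg]

lemma differentiableAt_riskTol (hU : IsUtility U) (hR : RiskTolStanding U) {x : ℝ} (hx : 0 < x) :
    DifferentiableAt ℝ (riskTol U) x :=
  (hU.hasDerivAt_deriv hx).differentiableAt.neg.div
    (differentiableAt_of_contDiffOn_Ioi hU.contDiffOn_deriv2 hx) (hU.deriv2_neg hR hx).ne

/-- `deriv_mono` is where the monotonicity of `R` yields convexity: `H' = R∘H` is a composite of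
increasing maps. -/
lemma isTerminalProfile_terminalH (hU : IsUtility U) (hI : InverseMarginalGrowth U)
    (hR : RiskTolStanding U) :
    IsTerminalProfile (terminalH U) (fun z => riskTol U (terminalH U z)) where
  pos := terminalH_pos hU
  hasDerivAt := hasDerivAt_terminalH hU hR
  deriv_pos z := hU.riskTol_pos hR (terminalH_pos hU z)
  deriv_mono _ _ h := hR.strictMonoOn.monotoneOn (terminalH_pos hU _) (terminalH_pos hU _)
    ((terminalH_strictMono hU).monotone h)
  deriv_cont := continuous_iff_continuousAt.2 fun z =>
    (differentiableAt_riskTol hU hR (terminalH_pos hU z)).continuousAt.comp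
      (terminalH_continuous hU).continuousAt
  growth := by
    obtain ⟨C, δ, hC, hδ, h⟩ := hI
    refine ⟨C, δ, hC, hδ, fun z => ?_⟩
    have := h (Real.exp (-z)) (Real.exp_pos _)
    rwa [← Real.exp_mul, neg_mul_neg, mul_comm z] at this
  surj _ hx := ⟨_, terminalH_neg_log_deriv hU hx⟩

/-- The logarithmic derivative of `H(·, T)`. -/
def logSlope (U : ℝ → ℝ) (z : ℝ) : ℝ := riskTol U (terminalH U z) / terminalH U z

lemma deriv_logTerminalH (hU : IsUtility U) (hR : RiskTolStanding U) :
    deriv (logTerminalH U) = logSlope U := by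
  ext z
  exact ((hasDerivAt_terminalH hU hR z).log (terminalH_pos hU z).ne').deriv

lemma iteratedDeriv_two_logTerminalH (hU : IsUtility U) (hR : RiskTolStanding U) :
    iteratedDeriv 2 (logTerminalH U) = deriv (logSlope U) := by
  rw [iteratedDeriv_succ, iteratedDeriv_one, deriv_logTerminalH hU hR]

lemma iteratedDeriv_three_logTerminalH (hU : IsUtility U) (hR : RiskTolStanding U) :
    iteratedDeriv 3 (logTerminalH U) = deriv (deriv (logSlope U)) := by
  rw [iteratedDeriv_succ, iteratedDeriv_two_logTerminalH hU hR]

lemma relRiskTolCoeff_eq (hU : IsUtility U) {x : ℝ} (hx : 0 < x) :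
    relRiskTolCoeff U x = logSlope U (-Real.log (deriv U x)) := by
  rw [logSlope, terminalH_neg_log_deriv hU hx, relRiskTolCoeff, riskTol, div_div, mul_comm x]

lemma deriv_riskTol_nonneg (hR : RiskTolStanding U) {x : ℝ} (hx : 0 < x) :
    0 ≤ deriv (riskTol U) x := by
  rw [← derivWithin_of_isOpen isOpen_Ioi (mem_Ioi.2 hx)]
  exact hR.strictMonoOn.monotoneOn.derivWithin_nonneg

/-- `R̃'' = (g'' - g' R') / R²`, evaluated along `z = -log U'(x)`, where `g = (log H)_z`. -/
lemma iteratedDeriv_two_relRiskTolCoeff (hU : IsUtility U) (hR : RiskTolStanding U)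
    (hg : Differentiable ℝ (logSlope U)) (hg' : Differentiable ℝ (deriv (logSlope U)))
    {x : ℝ} (hx : 0 < x) :
    iteratedDeriv 2 (relRiskTolCoeff U) x =
      (deriv (deriv (logSlope U)) (-Real.log (deriv U x))
        - deriv (logSlope U) (-Real.log (deriv U x)) * deriv (riskTol U) x) / riskTol U x ^ 2 := by
  have h1 : ∀ y, 0 < y → deriv (relRiskTolCoeff U) y =
      deriv (logSlope U) (-Real.log (deriv U y)) * (riskTol U y)⁻¹ := by
    intro y hy
    have he : relRiskTolCoeff U =ᶠ[𝓝 y] fun x => logSlope U (-Real.log (deriv U x)) := by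
      filter_upwards [Ioi_mem_nhds hy] with w hw using relRiskTolCoeff_eq hU hw
    rw [he.deriv_eq]
    exact ((hg _).hasDerivAt.comp y (hasDerivAt_neg_log_deriv hU hy)).deriv
  have he : deriv (relRiskTolCoeff U) =ᶠ[𝓝 x]
      fun y => deriv (logSlope U) (-Real.log (deriv U y)) * (riskTol U y)⁻¹ := by
    filter_upwards [Ioi_mem_nhds hx] with w hw using h1 w hw
  have hr := hU.riskTol_pos hR hx
  rw [iteratedDeriv_succ, iteratedDeriv_one, he.deriv_eq]
  have h2 := ((hg' (-Real.log (deriv U x))).hasDerivAt.comp x (hasDerivAt_neg_log_deriv hU hx)).mul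
    ((differentiableAt_riskTol hU hR hx).hasDerivAt.inv hr.ne')
  refine (h2.deriv).trans ?_
  simp only [Function.comp, Pi.inv_apply]
  field_simp
  ring

end TerminalH

/-! ### The sign of the third central moment -/

section Skewness

/-- The derivative `V'(s) + V'(-s)` is even and convex, hence increasing on `s > 0`. -/
lemma convexOn_sub_comp_neg {V V' : ℝ → ℝ} (hV : ∀ y, HasDerivAt V (V' y) y)
    (hc : ConvexOn ℝ univ V') : ConvexOn ℝ (Ici 0) (fun s => V s - V (-s)) := by
  have hd : ∀ s, HasDerivAt (fun s => V s - V (-s)) (V' s + V' (-s)) s := fun s => by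
    have h2 := (hV (-s)).comp s (hasDerivAt_neg s)
    exact ((hV s).sub h2).congr_deriv (by ring)
  refine MonotoneOn.convexOn_of_deriv (convex_Ici 0)
    (fun s _ => (hd s).continuousAt.continuousWithinAt)
    (fun s _ => (hd s).differentiableAt.differentiableWithinAt) ?_
  intro a ha b hb hab
  rw [interior_Ici, mem_Ioi] at ha hb
  rw [(hd a).deriv, (hd b).deriv]
  -- These are the weights that express `a`, and after exchange `-a`, as convex combinations of `b`
  -- and `-b`.
  have hw0 : 0 ≤ (b + a) / (2 * b) := by positivity
  have hw1 : 0 ≤ (b - a) / (2 * b) := div_nonneg (by linarith) (by linarith)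
  have hw : (b + a) / (2 * b) + (b - a) / (2 * b) = 1 := by field_simp; ring
  have e1 := hc.2 (mem_univ b) (mem_univ (-b)) hw0 hw1 hw
  have e2 := hc.2 (mem_univ (-b)) (mem_univ b) hw0 hw1 hw
  simp only [smul_eq_mul] at e1 e2
  rw [show (b + a) / (2 * b) * b + (b - a) / (2 * b) * -b = a by field_simp; ring] at e1
  rw [show (b + a) / (2 * b) * -b + (b - a) / (2 * b) * b = -a by field_simp; ring] at e2
  calc V' a + V' (-a) ≤ ((b + a) / (2 * b) + (b - a) / (2 * b)) * (V' b + V' (-b)) := by linarith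
    _ = V' b + V' (-b) := by rw [hw, one_mul]

/-- A density `e^V` on the line with `V'` convex and mean zero has nonnegative third moment. -/
lemma integral_pow_three_mul_exp_nonneg {V V' : ℝ → ℝ} (hV : ∀ y, HasDerivAt V (V' y) y)
    (hc : ConvexOn ℝ univ V') (hi1 : Integrable fun s => s * Real.exp (V s))
    (hi3 : Integrable fun s => s ^ 3 * Real.exp (V s))
    (h0 : ∫ s, s * Real.exp (V s) = 0) : 0 ≤ ∫ s, s ^ 3 * Real.exp (V s) := by
  set w : ℝ → ℝ := fun s => V s - V (-s) with hw
  have hwc : ConvexOn ℝ (Ici 0) w := convexOn_sub_comp_neg hV hc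
  have hw0 : w 0 = 0 := by simp [hw]
  -- Since `w` is convex with `w 0 = 0`, the quotient `w s / s` increases; so once `w` is positive
  -- it stays positive.
  have hscale : ∀ a b, 0 ≤ a → a ≤ b → 0 < b → w a ≤ a / b * w b := by
    intro a b ha hab hb
    have := hwc.2 (mem_Ici.2 hb.le) (mem_Ici.2 le_rfl) (show 0 ≤ a / b by positivity)
      (show 0 ≤ 1 - a / b by rw [sub_nonneg, div_le_one hb]; exact hab) (by ring)
    simp only [smul_eq_mul, mul_zero, add_zero, hw0] at this
    rwa [div_mul_cancel₀ _ hb.ne'] at this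
  -- The symmetrised integrand: `F` has integral twice the first moment, `s² F` twice the third, and
  -- for `s > 0` the sign of `F` is that of `w`.
  set F : ℝ → ℝ := fun s => s * (Real.exp (V s) - Real.exp (V (-s))) with hF
  have heven : ∀ s, F (-s) = F s := fun s => by simp only [hF, neg_neg]; ring
  have hi1n : Integrable fun s => -(s * Real.exp (V (-s))) := by
    simpa using hi1.comp_neg
  have hi3n : Integrable fun s => -(s ^ 3 * Real.exp (V (-s))) := by
    have := hi3.comp_neg
    refine this.congr (Eventually.of_forall fun s => ?_)
    simp only; ring
  have e1 : ∫ s, -(s * Real.exp (V (-s))) = ∫ s, s * Real.exp (V s) := by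
    rw [← integral_neg_eq_self (fun s => s * Real.exp (V s))]
    simp
  have e3 : ∫ s, -(s ^ 3 * Real.exp (V (-s))) = ∫ s, s ^ 3 * Real.exp (V s) := by
    rw [← integral_neg_eq_self (fun s => s ^ 3 * Real.exp (V s))]
    congr 1; ext s; ring
  have hF1 : F = fun s => s * Real.exp (V s) + -(s * Real.exp (V (-s))) := by
    ext s; simp only [hF]; ring
  have hF3 : (fun s => s ^ 2 * F s) =
      fun s => s ^ 3 * Real.exp (V s) + -(s ^ 3 * Real.exp (V (-s))) := by
    ext s; simp only [hF]; ring
  have iF : Integrable F := hF1 ▸ hi1.add hi1n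
  have iF3 : Integrable fun s => s ^ 2 * F s := hF3 ▸ hi3.add hi3n
  have I1 : ∫ s, F s = 0 := by
    rw [hF1, integral_add hi1 hi1n, e1, h0, add_zero]
  have I3 : ∫ s, s ^ 2 * F s = 2 * ∫ s, s ^ 3 * Real.exp (V s) := by
    rw [hF3, integral_add hi3 hi3n, e3, two_mul]
  have hFw : ∀ s, 0 ≤ s → w s ≤ 0 → F s ≤ 0 := fun s hs h =>
    mul_nonpos_of_nonneg_of_nonpos hs (sub_nonpos.2 (Real.exp_le_exp.2 (sub_nonpos.1 h)))
  have hFw' : ∀ s, 0 ≤ s → 0 ≤ w s → 0 ≤ F s := fun s hs h =>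
    mul_nonneg hs (sub_nonneg.2 (Real.exp_le_exp.2 (sub_nonneg.1 h)))
  suffices h : 0 ≤ ∫ s, s ^ 2 * F s by linarith
  -- Without a sign change, `F ≤ 0` has integral zero, so it vanishes almost everywhere and so does
  -- the third moment.
  by_cases hcase : ∀ s, 0 ≤ s → w s ≤ 0
  · have hneg : ∀ s, F s ≤ 0 := fun s => by
      rcases le_total 0 s with hs | hs
      · exact hFw s hs (hcase s hs)
      · rw [← heven]
        exact hFw (-s) (by linarith) (hcase _ (by linarith))
    have hz : (fun s => -F s) =ᵐ[volume] 0 := by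
      refine (integral_eq_zero_iff_of_nonneg (fun s => ?_) iF.neg).1 ?_
      · simpa using hneg s
      · rw [integral_neg', I1, neg_zero]
    rw [integral_congr_ae (g := fun _ => (0 : ℝ))]
    · simp
    · filter_upwards [hz] with s hs
      have : F s = 0 := by simpa using hs
      simp [this]
  · push Not at hcase
    obtain ⟨s1, hs1, hws1⟩ := hcase
    set A : Set ℝ := {s | 0 ≤ s ∧ w s ≤ 0} with hA
    have hA0 : (0 : ℝ) ∈ A := ⟨le_rfl, hw0.le⟩
    have hAb : BddAbove A := by
      refine ⟨s1, fun s hs => ?_⟩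
      by_contra hlt
      push Not at hlt
      have h1 := hscale s1 s hs1 hlt.le (by linarith)
      have h2 : s1 / s * w s ≤ 0 :=
        mul_nonpos_of_nonneg_of_nonpos (div_nonneg hs1 hs.1) hs.2
      linarith
    -- The point of sign change. Then `s² - s0²` and `F s` agree in sign, and the term `s0² F`
    -- integrates to zero.
    set s0 := sSup A with hs0
    have hs00 : 0 ≤ s0 := le_csSup hAb hA0
    have key : ∀ s, 0 ≤ s → 0 ≤ (s ^ 2 - s0 ^ 2) * F s := by
      intro s hs
      rcases lt_trichotomy s s0 with h | h | h
      · obtain ⟨s', hs', hlt⟩ := exists_lt_of_lt_csSup ⟨0, hA0⟩ h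
        have h1 := hscale s s' hs hlt.le (by linarith)
        have h2 : s / s' * w s' ≤ 0 :=
          mul_nonpos_of_nonneg_of_nonpos (div_nonneg hs hs'.1) hs'.2
        exact mul_nonneg_of_nonpos_of_nonpos (by nlinarith) (hFw s hs (by linarith))
      · simp [h]
      · refine mul_nonneg (by nlinarith) (hFw' s hs ?_)
        by_contra hneg
        exact absurd (le_csSup hAb (show s ∈ A from ⟨hs, by linarith⟩)) (not_le.2 h)
    have key' : ∀ s, 0 ≤ (s ^ 2 - s0 ^ 2) * F s := fun s => by
      rcases le_total 0 s with hs | hs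
      · exact key s hs
      · have := key (-s) (by linarith)
        rwa [heven, neg_sq] at this
    have hI := integral_nonneg (μ := volume) (Pi.le_def.2 key')
    have e : (fun s => (s ^ 2 - s0 ^ 2) * F s) = fun s => s ^ 2 * F s - s0 ^ 2 * F s := by
      ext s; ring
    rw [e, integral_sub iF3 (iF.const_mul _), integral_const_mul, I1] at hI
    linarith

/-- Reflection `s ↦ -s` replaces `V'` by `-V'(-s)`, which is convex, and changes the sign of odd
moments. -/
lemma integral_pow_three_mul_exp_nonpos {V V' : ℝ → ℝ} (hV : ∀ y, HasDerivAt V (V' y) y)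
    (hc : ConcaveOn ℝ univ V') (hi1 : Integrable fun s => s * Real.exp (V s))
    (hi3 : Integrable fun s => s ^ 3 * Real.exp (V s))
    (h0 : ∫ s, s * Real.exp (V s) = 0) : ∫ s, s ^ 3 * Real.exp (V s) ≤ 0 := by
  have hV' : ∀ y, HasDerivAt (fun s => V (-s)) ((fun s => -V' (-s)) y) y := fun y =>
    ((hV (-y)).comp y (hasDerivAt_neg y)).congr_deriv (by simp)
  have hc' : ConvexOn ℝ univ fun s => -V' (-s) := by
    refine ⟨convex_univ, fun x _ y _ a b ha hb hab => ?_⟩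
    have := hc.2 (mem_univ (-x)) (mem_univ (-y)) ha hb hab
    simp only [smul_eq_mul] at this ⊢
    rw [show a * -x + b * -y = -(a * x + b * y) by ring] at this
    linarith
  have e1 : ∫ s, s * Real.exp (V (-s)) = -∫ s, s * Real.exp (V s) := by
    rw [← integral_neg_eq_self (fun s => s * Real.exp (V s)), ← integral_neg]
    simp
  have e3 : ∫ s, s ^ 3 * Real.exp (V (-s)) = -∫ s, s ^ 3 * Real.exp (V s) := by
    rw [← integral_neg_eq_self (fun s => s ^ 3 * Real.exp (V s)), ← integral_neg]
    congr 1; ext s; ring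
  have := integral_pow_three_mul_exp_nonneg hV' hc'
    (by simpa using hi1.comp_neg.neg)
    (hi3.comp_neg.neg.congr (Eventually.of_forall fun s => by simp only [Pi.neg_apply]; ring))
    (by rw [e1, h0, neg_zero])
  rw [e3] at this
  linarith

end Skewness

/-! ### The heat semigroup acting on terminal profiles -/

/-- The heat semigroup `E[F(z + √v N)]`. -/
def heat (F : ℝ → ℝ) (v : ℝ≥0) (z : ℝ) : ℝ := ∫ y, F (z + y) ∂gaussianReal 0 v

lemma integrable_comp_add_gaussianReal {F : ℝ → ℝ} (hF : Measurable F) {C δ : ℝ}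
    (hb : ∀ z, |F z| ≤ C * (1 + Real.exp (δ * z))) (m : ℝ) (v : ℝ≥0) (c : ℝ) :
    Integrable (fun y => F (c + y)) (gaussianReal m v) := by
  have h1 : Integrable (fun y => C * (1 + Real.exp (δ * c) * Real.exp (δ * y)))
      (gaussianReal m v) :=
    ((integrable_const _).add ((integrable_exp_mul_gaussianReal δ).const_mul _)).const_mul _
  refine h1.mono' (hF.comp (measurable_const_add c)).aestronglyMeasurable
    (Eventually.of_forall fun y => ?_)
  rw [Real.norm_eq_abs, ← Real.exp_add, ← mul_add]
  exact hb _

lemma gaussianPDFReal_shift {v : ℝ≥0} (hv : v ≠ 0) (z y : ℝ) :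
    gaussianPDFReal z v y =
      Real.exp (-z ^ 2 / (2 * v)) * (Real.exp (z / v * y) * gaussianPDFReal 0 v y) := by
  have hv' : (v : ℝ) ≠ 0 := by exact_mod_cast hv
  simp only [gaussianPDFReal]
  rw [show -(y - z) ^ 2 / (2 * (v : ℝ)) =
    -z ^ 2 / (2 * v) + (z / v * y + -(y - 0) ^ 2 / (2 * v)) by field_simp; ring,
    Real.exp_add, Real.exp_add]
  ring

/-- Completing the square moves `z` out of the argument of `F` into an exponential tilt of a fixed
Gaussian. No regularity of `F` is needed to vary `z`, and the tilts form an exponential family. -/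
lemma heat_eq_integral_exp (F : ℝ → ℝ) {v : ℝ≥0} (hv : v ≠ 0) (z : ℝ) :
    heat F v z =
      Real.exp (-z ^ 2 / (2 * v)) * ∫ y, Real.exp (z / v * y) * F y ∂gaussianReal 0 v := by
  have h1 : heat F v z = ∫ y, F y ∂gaussianReal z v := by
    have : (gaussianReal 0 v).map (fun y => z + y) = gaussianReal z v := by
      rw [gaussianReal_map_const_add, zero_add]
    rw [← this]
    exact ((MeasurableEquiv.addLeft z).measurableEmbedding.integral_map _).symm
  rw [h1, integral_gaussianReal_eq_integral_smul hv, integral_gaussianReal_eq_integral_smul hv,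
    ← integral_const_mul]
  congr 1
  ext y
  rw [gaussianPDFReal_shift hv]
  simp only [smul_eq_mul]
  ring

lemma heat_zero_var (F : ℝ → ℝ) (z : ℝ) : heat F 0 z = F z := by
  simp [heat, gaussianReal_zero_var]

/-- The Cameron-Martin formula for `N(0, v)` and the shift `v`. -/
lemma integral_exp_mul_comp_add (F : ℝ → ℝ) (v : ℝ≥0) :
    ∫ b, Real.exp (-b - v / 2) * F (v + b) ∂gaussianReal 0 v = ∫ b, F b ∂gaussianReal 0 v := by
  rcases eq_or_ne v 0 with rfl | hv
  · simp [gaussianReal_zero_var]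
  have hv' : (v : ℝ) ≠ 0 := by exact_mod_cast hv
  -- At `z = v` the tilt is `e^{y - v/2}`, which cancels the inserted factor.
  have h := heat_eq_integral_exp (fun y => Real.exp (-y + v / 2) * F y) hv v
  rw [heat, ← integral_const_mul] at h
  calc _ = ∫ y, Real.exp (-(v + y) + v / 2) * F (v + y) ∂gaussianReal 0 v := by
        congr 1; ext y; congr 2; ring
    _ = _ := h
    _ = _ := by
        congr 1; ext y
        rw [← mul_assoc, ← mul_assoc, ← Real.exp_add, ← Real.exp_add]
        rw [show -(v : ℝ) ^ 2 / (2 * v) + v / v * y + (-y + v / 2) = 0 by field_simp; ring]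
        simp

namespace IsTerminalProfile

variable {H H' : ℝ → ℝ}

lemma continuous (hH : IsTerminalProfile H H') : Continuous H :=
  continuous_iff_continuousAt.2 fun z => (hH.hasDerivAt z).continuousAt

lemma strictMono (hH : IsTerminalProfile H H') : StrictMono H :=
  strictMono_of_hasDerivAt_pos hH.hasDerivAt hH.deriv_pos

lemma exists_bound (hH : IsTerminalProfile H H') :
    ∃ C δ : ℝ, ∀ z, |H z| ≤ C * (1 + Real.exp (δ * z)) := by
  obtain ⟨C, δ, -, -, h⟩ := hH.growth
  exact ⟨C, δ, fun z => by rw [abs_of_pos (hH.pos z)]; exact h z⟩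

/-- By convexity `H'(z) ≤ H(z+1) - H(z)`, and `H > 0`. This passes the growth bound on to `H'`. -/
lemma deriv_le (hH : IsTerminalProfile H H') (z : ℝ) : H' z ≤ H (z + 1) := by
  obtain ⟨c, hc, h⟩ := exists_hasDerivAt_eq_slope H H' (show z < z + 1 by linarith)
    hH.continuous.continuousOn fun x _ => hH.hasDerivAt x
  have h1 := hH.deriv_mono hc.1.le
  have h2 := hH.pos z
  rw [h] at h1
  simp at h1
  linarith

lemma exists_bound_deriv (hH : IsTerminalProfile H H') :
    ∃ C δ : ℝ, ∀ z, |H' z| ≤ C * (1 + Real.exp (δ * z)) := by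
  obtain ⟨C, δ, hC, hδ, h⟩ := hH.growth
  refine ⟨C * Real.exp δ, δ, fun z => ?_⟩
  rw [abs_of_pos (hH.deriv_pos z)]
  refine (hH.deriv_le z).trans ((h _).trans ?_)
  rw [mul_assoc, mul_add δ, mul_one, Real.exp_add]
  have : 1 ≤ Real.exp δ := Real.one_le_exp hδ.le
  gcongr
  nlinarith [Real.exp_pos (δ * z)]

lemma integrable (hH : IsTerminalProfile H H') (m : ℝ) (v : ℝ≥0) (c : ℝ) :
    Integrable (fun y => H (c + y)) (gaussianReal m v) := by
  obtain ⟨C, δ, h⟩ := hH.exists_bound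
  exact integrable_comp_add_gaussianReal hH.continuous.measurable h m v c

lemma integrable_deriv (hH : IsTerminalProfile H H') (m : ℝ) (v : ℝ≥0) (c : ℝ) :
    Integrable (fun y => H' (c + y)) (gaussianReal m v) := by
  obtain ⟨C, δ, h⟩ := hH.exists_bound_deriv
  exact integrable_comp_add_gaussianReal hH.deriv_cont.measurable h m v c

/-- Differentiation under the integral: for arguments within distance `1` of `z`, the positive
increasing `H'` is dominated by its value shifted by `1`. -/
lemma hasDerivAt_heat (hH : IsTerminalProfile H H') (v : ℝ≥0) (z : ℝ) :
    HasDerivAt (heat H v) (heat H' v z) z := by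
  refine (hasDerivAt_integral_of_dominated_loc_of_deriv_le (bound := fun y => H' (z + 1 + y))
    (F' := fun x y => H' (x + y)) (Metric.ball_mem_nhds z one_pos) ?_ (hH.integrable 0 v z)
    ?_ ?_ (hH.integrable_deriv 0 v (z + 1)) ?_).2
  · exact Eventually.of_forall fun x => (hH.integrable 0 v x).aestronglyMeasurable
  · exact (hH.integrable_deriv 0 v z).aestronglyMeasurable
  · refine Eventually.of_forall fun y x hx => ?_
    rw [Real.norm_eq_abs, abs_of_pos (hH.deriv_pos _)]
    have := (abs_lt.1 (by simpa [Real.dist_eq] using hx : |x - z| < 1)).2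
    exact hH.deriv_mono (by linarith)
  · exact Eventually.of_forall fun y x _ => (hH.hasDerivAt (x + y)).comp_add_const x y

lemma continuous_heat_deriv (hH : IsTerminalProfile H H') (v : ℝ≥0) :
    Continuous (heat H' v) := by
  refine continuous_iff_continuousAt.2 fun z => ?_
  refine continuousAt_of_dominated (bound := fun y => H' (z + 1 + y)) ?_ ?_
    (hH.integrable_deriv 0 v (z + 1)) ?_
  · exact Eventually.of_forall fun x => (hH.integrable_deriv 0 v x).aestronglyMeasurable
  · filter_upwards [Metric.ball_mem_nhds z one_pos] with x hx
    refine Eventually.of_forall fun y => ?_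
    rw [Real.norm_eq_abs, abs_of_pos (hH.deriv_pos _)]
    have := (abs_lt.1 (by simpa [Real.dist_eq] using hx : |x - z| < 1)).2
    exact hH.deriv_mono (by linarith)
  · exact Eventually.of_forall fun y => (hH.deriv_cont.comp (continuous_add_const y)).continuousAt

lemma _root_.Merton.integral_pos_of_pos {μ : Measure ℝ} [IsProbabilityMeasure μ] {f : ℝ → ℝ}
    (hf : Integrable f μ) (hpos : ∀ y, 0 < f y) : 0 < ∫ y, f y ∂μ := by
  rw [integral_pos_iff_support_of_nonneg (fun y => (hpos y).le) hf]
  have : Function.support f = univ := eq_univ_of_forall fun y => (hpos y).ne'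
  simp [this]

lemma heat_pos (hH : IsTerminalProfile H H') (v : ℝ≥0) (z : ℝ) : 0 < heat H v z :=
  integral_pos_of_pos (hH.integrable 0 v z) fun _ => hH.pos _

lemma heat_deriv_pos (hH : IsTerminalProfile H H') (v : ℝ≥0) (z : ℝ) : 0 < heat H' v z :=
  integral_pos_of_pos (hH.integrable_deriv 0 v z) fun _ => hH.deriv_pos _

lemma heat_strictMono (hH : IsTerminalProfile H H') (v : ℝ≥0) : StrictMono (heat H v) :=
  strictMono_of_hasDerivAt_pos (hH.hasDerivAt_heat v) (hH.heat_deriv_pos v)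

lemma heat_deriv_monotone (hH : IsTerminalProfile H H') (v : ℝ≥0) : Monotone (heat H' v) :=
  fun _ _ hab => integral_mono (hH.integrable_deriv 0 v _) (hH.integrable_deriv 0 v _)
    fun _ => hH.deriv_mono (by linarith)

lemma heat_convexOn (hH : IsTerminalProfile H H') (v : ℝ≥0) : ConvexOn ℝ univ (heat H v) := by
  refine Monotone.convexOn_univ_of_deriv (fun z => (hH.hasDerivAt_heat v z).differentiableAt) ?_
  rw [show deriv (heat H v) = heat H' v from funext fun z => (hH.hasDerivAt_heat v z).deriv]
  exact hH.heat_deriv_monotone v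

lemma convexOn (hH : IsTerminalProfile H H') : ConvexOn ℝ univ H := by
  have := hH.heat_convexOn 0
  rwa [show heat H 0 = H from funext (heat_zero_var H)] at this

/-- Jensen's inequality: integrate the tangent line at `z` against a centred Gaussian. In
`heat_surj` it shows that `heat H v` reaches arbitrarily large values. -/
lemma le_heat (hH : IsTerminalProfile H H') (v : ℝ≥0) (z : ℝ) : H z ≤ heat H v z := by
  have ht : ∀ y, H z + H' z * y ≤ H (z + y) := fun y => by
    rcases lt_trichotomy 0 y with h | rfl | h
    · have := hH.convexOn.le_slope_of_hasDerivAt (mem_univ z) (mem_univ (z + y)) (by linarith)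
        (hH.hasDerivAt z)
      rw [slope_def_field, le_div_iff₀ (by linarith)] at this
      linarith
    · simp
    · have := hH.convexOn.slope_le_of_hasDerivAt (mem_univ (z + y)) (mem_univ z) (by linarith)
        (hH.hasDerivAt z)
      rw [slope_def_field, div_le_iff₀ (by linarith)] at this
      linarith
  have hid : Integrable (fun y : ℝ => y) (gaussianReal 0 v) :=
    (memLp_id_gaussianReal (μ := 0) (v := v) 1).integrable (by simp)
  have h1 : Integrable (fun y => H z + H' z * y) (gaussianReal 0 v) :=
    (integrable_const _).add (hid.const_mul _)
  calc H z = ∫ y, (H z + H' z * y) ∂gaussianReal 0 v := by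
        rw [integral_add (integrable_const _) (hid.const_mul _), integral_const_mul,
          integral_id_gaussianReal]
        simp
    _ ≤ _ := integral_mono h1 (hH.integrable 0 v z) ht

lemma tendsto_atBot (hH : IsTerminalProfile H H') : Tendsto H atBot (𝓝 0) := by
  refine tendsto_order.2 ⟨fun a ha => Eventually.of_forall fun z => ha.trans (hH.pos z),
    fun a ha => ?_⟩
  obtain ⟨z0, rfl⟩ := hH.surj a ha
  filter_upwards [eventually_lt_atBot z0] with z hz using hH.strictMono hz

lemma tendsto_heat_atBot (hH : IsTerminalProfile H H') (v : ℝ≥0) :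
    Tendsto (heat H v) atBot (𝓝 0) := by
  have : (0 : ℝ) = ∫ _, (0 : ℝ) ∂gaussianReal 0 v := by simp
  rw [this]
  refine tendsto_integral_filter_of_dominated_convergence (fun y => H (0 + y)) ?_ ?_
    (hH.integrable 0 v 0) ?_
  · exact Eventually.of_forall fun x => (hH.integrable 0 v x).aestronglyMeasurable
  · filter_upwards [eventually_le_atBot 0] with x hx
    refine Eventually.of_forall fun y => ?_
    rw [Real.norm_eq_abs, abs_of_pos (hH.pos _)]
    exact hH.strictMono.monotone (by linarith)
  · exact Eventually.of_forall fun y =>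
      hH.tendsto_atBot.comp (tendsto_atBot_add_const_right _ y tendsto_id)

lemma heat_continuous (hH : IsTerminalProfile H H') (v : ℝ≥0) : Continuous (heat H v) :=
  continuous_iff_continuousAt.2 fun z => (hH.hasDerivAt_heat v z).continuousAt

lemma heat_surj (hH : IsTerminalProfile H H') (v : ℝ≥0) {x : ℝ} (hx : 0 < x) :
    ∃ z, heat H v z = x := by
  obtain ⟨b, rfl⟩ := hH.surj x hx
  obtain ⟨a, ha⟩ := ((hH.tendsto_heat_atBot v).eventually (gt_mem_nhds hx)).exists
  exact mem_range_of_exists_le_of_exists_ge (hH.heat_continuous v) ⟨a, ha.le⟩ ⟨b, hH.le_heat v b⟩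

end IsTerminalProfile

/-! ### The logarithmic derivative of `heat H v` -/

/-- Chebyshev's inequality with an increasing exponential weight. -/
lemma integral_exp_mul_mul_le {μ : Measure ℝ} {g w : ℝ → ℝ} {c : ℝ} (hc : 0 < c)
    (hg : Antitone g) (hw : ∀ y, 0 ≤ w y) (h0 : Integrable w μ)
    (h1 : Integrable (fun y => Real.exp (c * y) * w y) μ)
    (h2 : Integrable (fun y => g y * w y) μ)
    (h3 : Integrable (fun y => Real.exp (c * y) * (g y * w y)) μ)
    (hp0 : 0 < ∫ y, w y ∂μ) (hp1 : 0 < ∫ y, Real.exp (c * y) * w y ∂μ) :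
    (∫ y, Real.exp (c * y) * (g y * w y) ∂μ) * ∫ y, w y ∂μ ≤
      (∫ y, g y * w y ∂μ) * ∫ y, Real.exp (c * y) * w y ∂μ := by
  set A := ∫ y, w y ∂μ
  set B := ∫ y, Real.exp (c * y) * w y ∂μ
  -- Chosen so that `e^{c y0}` is the `w`-mean of `e^{cy}`. On integrating the pointwise inequality
  -- below, the terms carrying `g y0` then cancel.
  set y0 := Real.log (B / A) / c with hy0
  have hB : Real.exp (c * y0) = B / A := by
    rw [hy0, mul_div_cancel₀ _ hc.ne', Real.exp_log (div_pos hp1 hp0)]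
  have hpt : ∀ y, (g y - g y0) * (Real.exp (c * y) - Real.exp (c * y0)) * w y ≤ 0 := fun y => by
    refine mul_nonpos_of_nonpos_of_nonneg ?_ (hw y)
    rcases le_total y y0 with h | h
    · exact mul_nonpos_of_nonneg_of_nonpos (sub_nonneg.2 (hg h))
        (sub_nonpos.2 (Real.exp_le_exp.2 (by gcongr)))
    · exact mul_nonpos_of_nonpos_of_nonneg (sub_nonpos.2 (hg h))
        (sub_nonneg.2 (Real.exp_le_exp.2 (by gcongr)))
  have hI := integral_nonpos (μ := μ) (Pi.le_def.2 hpt)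
  have e : (fun y => (g y - g y0) * (Real.exp (c * y) - Real.exp (c * y0)) * w y) = fun y =>
      (Real.exp (c * y) * (g y * w y) - Real.exp (c * y0) * (g y * w y)) -
        (g y0 * (Real.exp (c * y) * w y) - g y0 * Real.exp (c * y0) * w y) := by
    ext y; ring
  have i1 : Integrable (fun y => Real.exp (c * y) * (g y * w y) -
      Real.exp (c * y0) * (g y * w y)) μ := h3.sub (h2.const_mul _)
  have i2 : Integrable (fun y => g y0 * (Real.exp (c * y) * w y) -
      g y0 * Real.exp (c * y0) * w y) μ := (h1.const_mul _).sub (h0.const_mul _)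
  rw [e, integral_sub i1 i2,
    integral_sub h3 (h2.const_mul _), integral_sub (h1.const_mul _) (h0.const_mul _),
    integral_const_mul, integral_const_mul, integral_const_mul, hB] at hI
  have : g y0 * B - g y0 * (B / A) * A = 0 := by field_simp; ring
  rw [this, sub_zero, sub_nonpos] at hI
  calc _ ≤ (B / A * ∫ y, g y * w y ∂μ) * A := by gcongr
    _ = _ := by field_simp

namespace IsTerminalProfile

variable {H H' : ℝ → ℝ}

lemma integrable_exp_mul (hH : IsTerminalProfile H H') (v : ℝ≥0) (w : ℝ) :
    Integrable (fun y => Real.exp (w * y) * H y) (gaussianReal 0 v) := by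
  obtain ⟨C, δ, h⟩ := hH.exists_bound
  have h1 : Integrable (fun y => C * (Real.exp (w * y) + Real.exp ((w + δ) * y)))
      (gaussianReal 0 v) :=
    ((integrable_exp_mul_gaussianReal w).add (integrable_exp_mul_gaussianReal _)).const_mul _
  have := hH.continuous
  refine h1.mono' (by fun_prop) (Eventually.of_forall fun y => ?_)
  rw [norm_mul, Real.norm_eq_abs, Real.norm_eq_abs, Real.abs_exp, add_mul, Real.exp_add]
  calc _ ≤ Real.exp (w * y) * (C * (1 + Real.exp (δ * y))) := by gcongr; exact h y
    _ = _ := by ring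

lemma integrable_exp_mul_deriv (hH : IsTerminalProfile H H') (v : ℝ≥0) (w : ℝ) :
    Integrable (fun y => Real.exp (w * y) * H' y) (gaussianReal 0 v) := by
  obtain ⟨C, δ, h⟩ := hH.exists_bound_deriv
  have h1 : Integrable (fun y => C * (Real.exp (w * y) + Real.exp ((w + δ) * y)))
      (gaussianReal 0 v) :=
    ((integrable_exp_mul_gaussianReal w).add (integrable_exp_mul_gaussianReal _)).const_mul _
  have := hH.deriv_cont
  refine h1.mono' (by fun_prop) (Eventually.of_forall fun y => ?_)
  rw [norm_mul, Real.norm_eq_abs, Real.norm_eq_abs, Real.abs_exp, add_mul, Real.exp_add]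
  calc _ ≤ Real.exp (w * y) * (C * (1 + Real.exp (δ * y))) := by gcongr; exact h y
    _ = _ := by ring

/-- A multiple `ε` of the logarithmic slope being antitone is inherited by the semigroup; the
cases `ε = ± 1` give the antitone and the monotone versions. -/
lemma antitone_mul_heat_slope (hH : IsTerminalProfile H H') (v : ℝ≥0) (ε : ℝ)
    (hg : Antitone fun z => ε * (H' z / H z)) :
    Antitone fun z => ε * (heat H' v z / heat H v z) := by
  rcases eq_or_ne v 0 with rfl | hv
  · simpa only [heat_zero_var] using hg
  intro z1 z2 h12
  rcases h12.eq_or_lt with rfl | h12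
  · exact le_rfl
  have hv' : (0 : ℝ) < v := by exact_mod_cast pos_iff_ne_zero.2 hv
  -- The extra tilt that turns the weight at `z1` into the weight at `z2`.
  set c := (z2 - z1) / (v : ℝ) with hc
  have hcp : 0 < c := div_pos (by linarith) hv'
  have he : ∀ y, Real.exp (c * y) * Real.exp (z1 / v * y) = Real.exp (z2 / v * y) := fun y => by
    rw [← Real.exp_add, hc]; congr 1; ring
  -- Weighting by `H` turns `g` into `H'`, so the four integrals in the Chebyshev inequality are
  -- those of `H` and `H'` tilted at `z1` and `z2`.
  have hgw : ∀ y, ε * (H' y / H y) * (Real.exp (z1 / v * y) * H y) =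
      ε * (Real.exp (z1 / v * y) * H' y) := fun y => by
    have := (hH.pos y).ne'
    field_simp
  have hgw' : ∀ y, Real.exp (c * y) * (ε * (Real.exp (z1 / v * y) * H' y)) =
      ε * (Real.exp (z2 / v * y) * H' y) := fun y => by
    rw [← he]; ring
  have hw' : ∀ y, Real.exp (c * y) * (Real.exp (z1 / v * y) * H y) =
      Real.exp (z2 / v * y) * H y := fun y => by rw [← mul_assoc, he]
  have hpos : ∀ w, 0 < ∫ y, Real.exp (w * y) * H y ∂gaussianReal 0 v := fun w =>
    integral_pos_of_pos (hH.integrable_exp_mul v w)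
      fun y => mul_pos (Real.exp_pos _) (hH.pos y)
  have key := integral_exp_mul_mul_le (μ := gaussianReal 0 v) (w := fun y =>
    Real.exp (z1 / v * y) * H y) hcp hg (fun y => (mul_pos (Real.exp_pos _) (hH.pos y)).le)
    (hH.integrable_exp_mul v _)
  simp only [hgw, hgw', hw', integral_const_mul] at key
  have key := key (hH.integrable_exp_mul v _) ((hH.integrable_exp_mul_deriv v _).const_mul _)
    ((hH.integrable_exp_mul_deriv v _).const_mul _) (hpos _) (hpos _)
  simp only [heat_eq_integral_exp _ hv, mul_div_mul_left _ _ (Real.exp_ne_zero _)]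
  rw [mul_div_assoc', mul_div_assoc', div_le_div_iff₀ (hpos _) (hpos _)]
  exact key

end IsTerminalProfile

/-! ### The third cumulant of an exponential family -/

section Cumulant

variable {μ : Measure ℝ}

/-- The moments `∫ yⁿ e^{wy} μ(dy)` of an exponential family. -/
def expMoment (μ : Measure ℝ) (n : ℕ) (w : ℝ) : ℝ := ∫ y, y ^ n * Real.exp (w * y) ∂μ

lemma integrableExpSet_id_eq_univ (h : ∀ w, Integrable (fun y => Real.exp (w * y)) μ) :
    interior (integrableExpSet id μ) = univ := by
  have : integrableExpSet id μ = univ := eq_univ_of_forall fun w => h w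
  rw [this, interior_univ]

lemma integrable_pow_mul_exp_of_forall (h : ∀ w, Integrable (fun y => Real.exp (w * y)) μ)
    (n : ℕ) (w : ℝ) : Integrable (fun y => y ^ n * Real.exp (w * y)) μ :=
  integrable_pow_mul_exp_of_mem_interior_integrableExpSet (X := id)
    (by rw [integrableExpSet_id_eq_univ h]; trivial) n

lemma hasDerivAt_expMoment (h : ∀ w, Integrable (fun y => Real.exp (w * y)) μ) (n : ℕ) (w : ℝ) :
    HasDerivAt (expMoment μ n) (expMoment μ (n + 1) w) w :=
  hasDerivAt_integral_pow_mul_exp_real (X := id)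
    (by rw [integrableExpSet_id_eq_univ h]; trivial) n

lemma integral_sub_pow_three_mul_exp (h : ∀ w, Integrable (fun y => Real.exp (w * y)) μ)
    (m w : ℝ) :
    ∫ y, (y - m) ^ 3 * Real.exp (w * y) ∂μ = expMoment μ 3 w - 3 * m * expMoment μ 2 w +
      3 * m ^ 2 * expMoment μ 1 w - m ^ 3 * expMoment μ 0 w := by
  have hi := fun n => integrable_pow_mul_exp_of_forall h n w
  have i1 : Integrable (fun y => y ^ 3 * Real.exp (w * y) - 3 * m * (y ^ 2 * Real.exp (w * y))) μ :=
    (hi 3).sub ((hi 2).const_mul _)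
  have i2 : Integrable (fun y => y ^ 3 * Real.exp (w * y) - 3 * m * (y ^ 2 * Real.exp (w * y)) +
      3 * m ^ 2 * (y ^ 1 * Real.exp (w * y))) μ := i1.add ((hi 1).const_mul _)
  have e : (fun y => (y - m) ^ 3 * Real.exp (w * y)) = fun y =>
      y ^ 3 * Real.exp (w * y) - 3 * m * (y ^ 2 * Real.exp (w * y)) +
      3 * m ^ 2 * (y ^ 1 * Real.exp (w * y)) - m ^ 3 * (y ^ 0 * Real.exp (w * y)) := by
    ext y; ring
  rw [e, integral_sub i2 ((hi 0).const_mul _), integral_add i1 ((hi 1).const_mul _),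
    integral_sub (hi 3) ((hi 2).const_mul _), integral_const_mul, integral_const_mul,
    integral_const_mul]
  rfl

lemma integral_sub_mean_mul_exp (h : ∀ w, Integrable (fun y => Real.exp (w * y)) μ)
    (m w : ℝ) :
    ∫ y, (y - m) * Real.exp (w * y) ∂μ = expMoment μ 1 w - m * expMoment μ 0 w := by
  have hi := fun n => integrable_pow_mul_exp_of_forall h n w
  have e : (fun y => (y - m) * Real.exp (w * y)) = fun y =>
      y ^ 1 * Real.exp (w * y) - m * (y ^ 0 * Real.exp (w * y)) := by
    ext y; ring
  rw [e, integral_sub (hi 1) ((hi 0).const_mul _), integral_const_mul]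
  rfl

variable (μ) in
/-- The mean of the exponential family. -/
def expMean (w : ℝ) : ℝ := expMoment μ 1 w / expMoment μ 0 w

variable (μ) in
/-- The variance of the exponential family. -/
def expVar (w : ℝ) : ℝ := expMoment μ 2 w / expMoment μ 0 w - expMean μ w ^ 2

lemma hasDerivAt_expMean (h : ∀ w, Integrable (fun y => Real.exp (w * y)) μ)
    (h0 : ∀ w, 0 < expMoment μ 0 w) (w : ℝ) : HasDerivAt (expMean μ) (expVar μ w) w := by
  have hn := (h0 w).ne'
  refine ((hasDerivAt_expMoment h 1 w).div (hasDerivAt_expMoment h 0 w) hn).congr_deriv ?_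
  simp only [expVar, expMean]
  field_simp

lemma hasDerivAt_expVar (h : ∀ w, Integrable (fun y => Real.exp (w * y)) μ)
    (h0 : ∀ w, 0 < expMoment μ 0 w) (w : ℝ) :
    HasDerivAt (expVar μ)
      ((∫ y, (y - expMean μ w) ^ 3 * Real.exp (w * y) ∂μ) / expMoment μ 0 w) w := by
  have hn := (h0 w).ne'
  refine (((hasDerivAt_expMoment h 2 w).div (hasDerivAt_expMoment h 0 w) hn).sub
    ((hasDerivAt_expMean h h0 w).pow 2)).congr_deriv ?_
  rw [integral_sub_pow_three_mul_exp h]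
  simp only [expVar, expMean, Nat.cast_ofNat, Nat.add_one_sub_one, pow_one]
  field_simp
  ring

/-- The mean is the first derivative of the log-moment generating function, so its second derivative
is the third cumulant, which equals the third central moment. -/
lemma convexOn_expMean (h : ∀ w, Integrable (fun y => Real.exp (w * y)) μ)
    (h0 : ∀ w, 0 < expMoment μ 0 w)
    (h3 : ∀ w, 0 ≤ ∫ y, (y - expMean μ w) ^ 3 * Real.exp (w * y) ∂μ) :
    ConvexOn ℝ univ (expMean μ) := by
  refine Monotone.convexOn_univ_of_deriv
    (fun w => (hasDerivAt_expMean h h0 w).differentiableAt) ?_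
  rw [show deriv (expMean μ) = expVar μ from funext fun w => (hasDerivAt_expMean h h0 w).deriv]
  exact monotone_of_hasDerivAt_nonneg (hasDerivAt_expVar h h0)
    fun w => div_nonneg (h3 w) (h0 w).le

lemma concaveOn_expMean (h : ∀ w, Integrable (fun y => Real.exp (w * y)) μ)
    (h0 : ∀ w, 0 < expMoment μ 0 w)
    (h3 : ∀ w, ∫ y, (y - expMean μ w) ^ 3 * Real.exp (w * y) ∂μ ≤ 0) :
    ConcaveOn ℝ univ (expMean μ) := by
  refine Antitone.concaveOn_univ_of_deriv
    (fun w => (hasDerivAt_expMean h h0 w).differentiableAt) ?_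
  rw [show deriv (expMean μ) = expVar μ from funext fun w => (hasDerivAt_expMean h h0 w).deriv]
  exact antitone_of_hasDerivAt_nonpos (hasDerivAt_expVar h h0)
    fun w => div_nonpos_of_nonpos_of_nonneg (h3 w) (h0 w).le

end Cumulant

lemma convexOn_affine_comp {f : ℝ → ℝ} (hf : ConvexOn ℝ univ f) {α : ℝ} (hα : 0 ≤ α)
    (β γ c d : ℝ) : ConvexOn ℝ univ fun z => α * f (β * z + γ) + (c * z + d) := by
  refine ⟨convex_univ, fun x _ y _ a b ha hb hab => ?_⟩
  have h := mul_le_mul_of_nonneg_left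
    (hf.2 (mem_univ (β * x + γ)) (mem_univ (β * y + γ)) ha hb hab) hα
  obtain rfl : b = 1 - a := by linarith
  simp only [smul_eq_mul] at h ⊢
  rw [show β * (a * x + (1 - a) * y) + γ = a * (β * x + γ) + (1 - a) * (β * y + γ) by ring]
  linarith

lemma concaveOn_affine_comp {f : ℝ → ℝ} (hf : ConcaveOn ℝ univ f) {α : ℝ} (hα : 0 ≤ α)
    (β γ c d : ℝ) : ConcaveOn ℝ univ fun z => α * f (β * z + γ) + (c * z + d) := by
  refine (convexOn_affine_comp hf.neg hα β γ (-c) (-d)).neg.congr fun z _ => ?_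
  simp only [Pi.neg_apply]
  ring

/-! ### Convexity of the logarithmic slope along the heat flow -/

namespace IsTerminalProfile

variable {H H' : ℝ → ℝ} {v : ℝ≥0}

/-- The logarithm of `H(y) p_v(y)`, with `p_v` the density of `N(0, v)`. -/
def logWeight (H : ℝ → ℝ) (v : ℝ≥0) (y : ℝ) : ℝ :=
  Real.log (H y) - y ^ 2 / (2 * v) + Real.log (√(2 * Real.pi * v))⁻¹

lemma exp_logWeight (hH : IsTerminalProfile H H') (hv : v ≠ 0) (y : ℝ) :
    Real.exp (logWeight H v y) = gaussianPDFReal 0 v y * H y := by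
  have hv' : (0 : ℝ) < v := by exact_mod_cast pos_iff_ne_zero.2 hv
  have h1 : 0 < (√(2 * Real.pi * v))⁻¹ := by positivity
  rw [logWeight, Real.exp_add, sub_eq_add_neg, Real.exp_add, Real.exp_log (hH.pos y),
    Real.exp_log h1, gaussianPDFReal, sub_zero, neg_div]
  ring

lemma hasDerivAt_logWeight (hH : IsTerminalProfile H H') (hv : v ≠ 0) (y : ℝ) :
    HasDerivAt (logWeight H v) (H' y / H y - y / v) y := by
  have hv' : (v : ℝ) ≠ 0 := by exact_mod_cast hv
  refine ((((hH.hasDerivAt y).log (hH.pos y).ne').sub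
    (((hasDerivAt_id y).pow 2).div_const (2 * (v : ℝ)))).add_const _).congr_deriv ?_
  simp
  field_simp

/-- The finite measure `H(y) p_v(y) dy`. -/
def weightMeasure (H : ℝ → ℝ) (v : ℝ≥0) : Measure ℝ :=
  volume.withDensity fun y => ENNReal.ofReal (Real.exp (logWeight H v y))

lemma measurable_logWeight (hH : IsTerminalProfile H H') : Measurable (logWeight H v) := by
  have := hH.continuous.measurable
  unfold logWeight
  fun_prop

lemma integral_weightMeasure (hH : IsTerminalProfile H H') (F : ℝ → ℝ) :
    ∫ y, F y ∂weightMeasure H v = ∫ y, F y * Real.exp (logWeight H v y) := by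
  rw [weightMeasure, integral_withDensity_eq_integral_toReal_smul
    hH.measurable_logWeight.exp.ennreal_ofReal (by simp)]
  congr 1
  ext y
  rw [ENNReal.toReal_ofReal (Real.exp_pos _).le, smul_eq_mul, mul_comm]

lemma integrable_weightMeasure_iff (hH : IsTerminalProfile H H') {F : ℝ → ℝ} :
    Integrable F (weightMeasure H v) ↔
      Integrable fun y => F y * Real.exp (logWeight H v y) := by
  rw [weightMeasure, integrable_withDensity_iff hH.measurable_logWeight.exp.ennreal_ofReal
    (by simp)]
  simp only [ENNReal.toReal_ofReal (Real.exp_pos _).le]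

lemma integral_weightMeasure_eq_gaussian (hH : IsTerminalProfile H H') (hv : v ≠ 0)
    (F : ℝ → ℝ) : ∫ y, F y ∂weightMeasure H v = ∫ y, F y * H y ∂gaussianReal 0 v := by
  rw [hH.integral_weightMeasure, integral_gaussianReal_eq_integral_smul hv]
  congr 1
  ext y
  rw [hH.exp_logWeight hv, smul_eq_mul]
  ring

lemma integrable_exp_weightMeasure (hH : IsTerminalProfile H H') (hv : v ≠ 0) (w : ℝ) :
    Integrable (fun y => Real.exp (w * y)) (weightMeasure H v) := by
  have h := hH.integrable_exp_mul v w
  rw [gaussianReal_of_var_ne_zero _ hv, integrable_withDensity_iff (measurable_gaussianPDF _ _)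
    (Eventually.of_forall fun _ => gaussianPDF_lt_top)] at h
  rw [hH.integrable_weightMeasure_iff]
  refine h.congr (Eventually.of_forall fun y => ?_)
  simp only [toReal_gaussianPDF, hH.exp_logWeight hv]
  ring

lemma expMoment_zero_pos (hH : IsTerminalProfile H H') (hv : v ≠ 0) (w : ℝ) :
    0 < expMoment (weightMeasure H v) 0 w := by
  simp only [expMoment, pow_zero, one_mul]
  rw [hH.integral_weightMeasure_eq_gaussian hv]
  exact integral_pos_of_pos (hH.integrable_exp_mul v w)
    fun y => mul_pos (Real.exp_pos _) (hH.pos y)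

lemma heat_eq_expMoment (hH : IsTerminalProfile H H') (hv : v ≠ 0) (z : ℝ) :
    heat H v z = Real.exp (-z ^ 2 / (2 * v)) * expMoment (weightMeasure H v) 0 (z / v) := by
  rw [heat_eq_integral_exp H hv]
  simp only [expMoment, pow_zero, one_mul]
  rw [hH.integral_weightMeasure_eq_gaussian hv]

/-- Logarithmic differentiation of `heat H v z = e^{-z²/2v} M₀(z/v)`, where `M₀` is the total mass
of the tilted measure. The shape of the slope is thereby reduced to that of the mean of an
exponential family. -/
lemma heat_slope_eq (hH : IsTerminalProfile H H') (hv : v ≠ 0) (z : ℝ) :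
    heat H' v z / heat H v z = (expMean (weightMeasure H v) (z / v) - z) / v := by
  have hv' : (v : ℝ) ≠ 0 := by exact_mod_cast hv
  have h1 : HasDerivAt (fun z : ℝ => Real.exp (-z ^ 2 / (2 * v)))
      (Real.exp (-z ^ 2 / (2 * v)) * (-z / v)) z := by
    refine ((((hasDerivAt_id z).pow 2).neg).div_const (2 * (v : ℝ))).exp.congr_deriv ?_
    simp only [id_eq, Nat.cast_ofNat, Nat.add_one_sub_one, pow_one, Pi.neg_apply, Pi.pow_apply,
      mul_one]
    congr 1
    field_simp
  have h2 : HasDerivAt (fun z : ℝ => expMoment (weightMeasure H v) 0 (z / v))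
      (expMoment (weightMeasure H v) 1 (z / v) * (1 / v)) z :=
    HasDerivAt.comp (h₂ := expMoment (weightMeasure H v) 0) (h := fun z : ℝ => z / v) z
      (hasDerivAt_expMoment (hH.integrable_exp_weightMeasure hv) 0 (z / v))
      ((hasDerivAt_id' z).div_const (v : ℝ))
  have h3 := h1.mul h2
  have h4 : heat H v = (fun z : ℝ => Real.exp (-z ^ 2 / (2 * v))) *
      fun z : ℝ => expMoment (weightMeasure H v) 0 (z / v) :=
    funext fun z => hH.heat_eq_expMoment hv z
  rw [← h4] at h3
  rw [(hH.hasDerivAt_heat v z).unique h3, hH.heat_eq_expMoment hv, expMean]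
  have := (hH.expMoment_zero_pos hv (z / v)).ne'
  have := Real.exp_ne_zero (-z ^ 2 / (2 * (v : ℝ)))
  field_simp
  ring

/-- The derivative of the logarithm of the tilted and recentred density. -/
lemma hasDerivAt_tilt (hH : IsTerminalProfile H H') (hv : v ≠ 0) (w m s : ℝ) :
    HasDerivAt (fun s => w * (s + m) + logWeight H v (s + m))
      (w + (H' (s + m) / H (s + m) - (s + m) / v)) s := by
  have h1 := (hH.hasDerivAt_logWeight hv (s + m)).comp_add_const s m
  have h2 : HasDerivAt (fun s => w * (s + m)) w s := by
    simpa using ((hasDerivAt_id s).add_const m).const_mul w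
  exact h2.add h1

lemma integral_pow_central (hH : IsTerminalProfile H H') (w m : ℝ) (n : ℕ) :
    ∫ s, s ^ n * Real.exp (w * (s + m) + logWeight H v (s + m)) =
      ∫ y, (y - m) ^ n * Real.exp (w * y) ∂weightMeasure H v := by
  rw [hH.integral_weightMeasure, ← integral_add_right_eq_self (fun y =>
    (y - m) ^ n * Real.exp (w * y) * Real.exp (logWeight H v y)) m]
  simp only [add_sub_cancel_right, mul_assoc, Real.exp_add]

lemma integrable_pow_central (hH : IsTerminalProfile H H') (hv : v ≠ 0) (w m : ℝ) (n : ℕ) :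
    Integrable fun s => s ^ n * Real.exp (w * (s + m) + logWeight H v (s + m)) := by
  have h : Integrable (fun y => (y - m) ^ n * Real.exp (w * y)) (weightMeasure H v) := by
    simp only [sub_pow, Finset.sum_mul]
    refine integrable_finsetSum _ fun k _ => ?_
    have := (integrable_pow_mul_exp_of_forall (hH.integrable_exp_weightMeasure hv) k w).const_mul
      ((-1) ^ (k + n) * m ^ (n - k) * (n.choose k))
    refine this.congr (Eventually.of_forall fun y => ?_)
    simp only; ring
  rw [hH.integrable_weightMeasure_iff] at h
  have h := h.comp_add_right m
  simpa only [add_sub_cancel_right, mul_assoc, Real.exp_add] using h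

lemma integral_central_one (hH : IsTerminalProfile H H') (hv : v ≠ 0) (w : ℝ) :
    ∫ s, s ^ 1 * Real.exp (w * (s + expMean (weightMeasure H v) w) +
      logWeight H v (s + expMean (weightMeasure H v) w)) = 0 := by
  rw [hH.integral_pow_central]
  simp only [pow_one]
  rw [integral_sub_mean_mul_exp (hH.integrable_exp_weightMeasure hv), expMean,
    div_mul_cancel₀ _ (hH.expMoment_zero_pos hv w).ne', sub_self]

/-- Convexity of the logarithmic slope is inherited by the semigroup. -/
lemma convexOn_heat_slope (hH : IsTerminalProfile H H') (v : ℝ≥0)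
    (hg : ConvexOn ℝ univ fun z => H' z / H z) :
    ConvexOn ℝ univ fun z => heat H' v z / heat H v z := by
  rcases eq_or_ne v 0 with rfl | hv
  · simpa only [heat_zero_var] using hg
  have hv' : (0 : ℝ) < v := by exact_mod_cast pos_iff_ne_zero.2 hv
  have h3 : ∀ w, 0 ≤ ∫ y, (y - expMean (weightMeasure H v) w) ^ 3 * Real.exp (w * y)
      ∂weightMeasure H v := fun w => by
    rw [← hH.integral_pow_central]
    refine integral_pow_three_mul_exp_nonneg (hH.hasDerivAt_tilt hv w _) ?_
      (by simpa using hH.integrable_pow_central hv w _ 1) (hH.integrable_pow_central hv w _ 3)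
      (by simpa using hH.integral_central_one hv w)
    -- The derivative of the recentred tilted log-density is a translate of `g` plus an affine
    -- function: the Gaussian and the tilt do not affect convexity.
    refine (convexOn_affine_comp hg zero_le_one 1 (expMean (weightMeasure H v) w) (-1 / v)
      (w - expMean (weightMeasure H v) w / v)).congr fun y _ => ?_
    simp only
    ring_nf
  -- By `heat_slope_eq`, the slope is `1/v` times the mean at `z/v`, minus `z/v`.
  refine (convexOn_affine_comp (convexOn_expMean (hH.integrable_exp_weightMeasure hv)
    (hH.expMoment_zero_pos hv) h3) (α := 1 / v) (by positivity) (1 / v) 0 (-1 / v) 0).congr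
    fun z _ => ?_
  simp only [hH.heat_slope_eq hv]
  ring_nf

/-- Concavity of the logarithmic slope is inherited by the semigroup. -/
lemma concaveOn_heat_slope (hH : IsTerminalProfile H H') (v : ℝ≥0)
    (hg : ConcaveOn ℝ univ fun z => H' z / H z) :
    ConcaveOn ℝ univ fun z => heat H' v z / heat H v z := by
  rcases eq_or_ne v 0 with rfl | hv
  · simpa only [heat_zero_var] using hg
  have hv' : (0 : ℝ) < v := by exact_mod_cast pos_iff_ne_zero.2 hv
  have h3 : ∀ w, ∫ y, (y - expMean (weightMeasure H v) w) ^ 3 * Real.exp (w * y)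
      ∂weightMeasure H v ≤ 0 := fun w => by
    rw [← hH.integral_pow_central]
    refine integral_pow_three_mul_exp_nonpos (hH.hasDerivAt_tilt hv w _) ?_
      (by simpa using hH.integrable_pow_central hv w _ 1) (hH.integrable_pow_central hv w _ 3)
      (by simpa using hH.integral_central_one hv w)
    refine (concaveOn_affine_comp hg zero_le_one 1 (expMean (weightMeasure H v) w) (-1 / v)
      (w - expMean (weightMeasure H v) w / v)).congr fun y _ => ?_
    simp only
    ring_nf
  refine (concaveOn_affine_comp (concaveOn_expMean (hH.integrable_exp_weightMeasure hv)
    (hH.expMoment_zero_pos hv) h3) (α := 1 / v) (by positivity) (1 / v) 0 (-1 / v) 0).congr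
    fun z _ => ?_
  simp only [hH.heat_slope_eq hv]
  ring_nf

end IsTerminalProfile

/-- A convex antitone function of the inverse of a convex increasing function is convex. -/
lemma convexOn_comp_inverse {h k hinv : ℝ → ℝ} (hh : ConvexOn ℝ univ h) (hm : StrictMono h)
    (hinv_eq : ∀ x, 0 < x → h (hinv x) = x) (hk : ConvexOn ℝ univ k) (ha : Antitone k) :
    ConvexOn ℝ (Ioi 0) fun x => k (hinv x) := by
  refine ⟨convex_Ioi 0, fun x hx y hy a b h0 h1 hab => ?_⟩
  have hxy : 0 < a • x + b • y := convex_Ioi (0 : ℝ) hx hy h0 h1 hab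
  -- The inverse of a convex increasing function is concave, as applying `h` to both sides shows.
  have hle : a • hinv x + b • hinv y ≤ hinv (a • x + b • y) := by
    rw [← hm.le_iff_le, hinv_eq _ hxy]
    refine (hh.2 (mem_univ _) (mem_univ _) h0 h1 hab).trans ?_
    rw [hinv_eq _ hx, hinv_eq _ hy]
  exact (ha hle).trans (hk.2 (mem_univ _) (mem_univ _) h0 h1 hab)

/-! ### Independence and laws of Brownian increments -/

/-- Recasts independence of a pair as independence of a family, so that it can be nested inside the
independence of the coordinates. -/
lemma iIndepFun_bool {Ω : Type*} {β : Bool → Type*} [MeasurableSpace Ω]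
    [m : ∀ b, MeasurableSpace (β b)] {P : Measure Ω} [IsProbabilityMeasure P]
    {f : ∀ b, Ω → β b} (h : IndepFun (f true) (f false) P) : iIndepFun f P := by
  rw [iIndepFun_iff]
  intro S f' hf'
  have hS : ∀ S : Finset Bool, S = ∅ ∨ S = {true} ∨ S = {false} ∨ S = {true, false} := by
    decide
  rcases hS S with rfl | rfl | rfl | rfl
  · simp
  · simp
  · simp
  · rw [Finset.prod_pair (by decide)]
    rw [Finset.set_biInter_insert, Finset.set_biInter_singleton]
    exact h.meas_inter (hf' true (by simp)) (hf' false (by simp))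

lemma integral_mul_exp_gaussianReal (a : ℝ) (v : ℝ≥0) :
    ∫ x, x * Real.exp (a * x) ∂gaussianReal 0 v = a * v * Real.exp (a ^ 2 * v / 2) := by
  have h1 := hasDerivAt_mgf (X := id) (μ := gaussianReal 0 v) (t := a)
    (by rw [integrableExpSet_id_gaussianReal, interior_univ]; trivial)
  rw [mgf_id_gaussianReal] at h1
  have h2 : HasDerivAt (fun t : ℝ => Real.exp (0 * t + v * t ^ 2 / 2))
      (Real.exp (0 * a + v * a ^ 2 / 2) * (v * a)) a := by
    refine HasDerivAt.exp ?_
    refine (((hasDerivAt_id a).const_mul 0).add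
      ((((hasDerivAt_id a).pow 2).const_mul (v : ℝ)).div_const 2)).congr_deriv ?_
    simp
    ring
  rw [show (∫ x, x * Real.exp (a * x) ∂gaussianReal 0 v) =
    ∫ x, id x * Real.exp (a * id x) ∂gaussianReal 0 v from rfl, h1.unique h2]
  rw [show 0 * a + v * a ^ 2 / 2 = a ^ 2 * v / 2 by ring]
  ring

lemma integral_exp_mul_gaussianReal (a : ℝ) (v : ℝ≥0) :
    ∫ x, Real.exp (a * x) ∂gaussianReal 0 v = Real.exp (a ^ 2 * v / 2) := by
  have h := congrFun (mgf_id_gaussianReal (μ := 0) (v := v)) a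
  simp only [mgf, id] at h
  rw [h]
  ring_nf

lemma integral_sq_gaussianReal (v : ℝ≥0) : ∫ x, x ^ 2 ∂gaussianReal 0 v = v := by
  have h := variance_fun_id_gaussianReal (μ := 0) (v := v)
  rw [variance_of_integral_eq_zero (by fun_prop) (by simp [integral_id_gaussianReal])] at h
  exact h

section Brownian

variable {Ω : Type*} [MeasurableSpace Ω] {N : ℕ} {P : Measure Ω}
  {W : Fin N → ℝ≥0 → Ω → ℝ}

/-- The vector of increments `W_{s'} - W_s`. -/
def increment (W : Fin N → ℝ≥0 → Ω → ℝ) (s s' : ℝ≥0) (ω : Ω) : Fin N → ℝ :=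
  fun j => W j s' ω - W j s ω

lemma measurable_increment (hW : ∀ i s, Measurable (W i s)) (s s' : ℝ≥0) :
    Measurable (increment W s s') :=
  measurable_pi_lambda _ fun j => (hW j s').sub (hW j s)

/-- The path stopped at `s` (`true`) or the path of the increments after `s` (`false`). -/
def pastFuture (W : Fin N → ℝ≥0 → Ω → ℝ) (s : ℝ≥0) (i : Fin N) (b : Bool) (ω : Ω) : ℝ≥0 → ℝ :=
  fun u => if b then W i (min u s) ω else W i (s + u) ω - W i s ω

lemma measurable_pastFuture (hW : ∀ i s, Measurable (W i s)) (s : ℝ≥0) (i : Fin N) (b : Bool) :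
    Measurable (pastFuture W s i b) := by
  refine measurable_pi_lambda _ fun u => ?_
  cases b
  · exact (hW i (s + u)).sub (hW i s)
  · exact hW i (min u s)

/-- Two sources of independence are merged into one family: that of the coordinates, and the
independence of past and future increments within each coordinate. -/
lemma iIndepFun_pastFuture [IsProbabilityMeasure P] (hW : IsStandardBrownianMotion W P)
    (s : ℝ≥0) :
    iIndepFun (fun (p : Fin N × Bool) ω => pastFuture W s p.1 p.2 ω) P := by
  refine iIndepFun_uncurry' (fun i b => measurable_pastFuture hW.measurable s i b) ?_ fun i => ?_
  · have := hW.indep.comp (fun i (x : ℝ≥0 → ℝ) (b : Bool) (u : ℝ≥0) =>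
      if b then x (min u s) else x (s + u) - x s) fun i => by
        refine measurable_pi_lambda _ fun b => measurable_pi_lambda _ fun u => ?_
        cases b
        · exact (measurable_pi_apply _).sub (measurable_pi_apply _)
        · exact measurable_pi_apply _
    exact this
  · have h := (hW.brownian i).toIsPreBrownianReal.indepFun_shift s
    refine iIndepFun_bool ?_
    have hm : Measurable fun (x : Set.Iic s → ℝ) (u : ℝ≥0) =>
        x ⟨min u s, mem_Iic.2 (min_le_right _ _)⟩ :=
      measurable_pi_lambda _ fun u => measurable_pi_apply _
    exact h.symm.comp hm measurable_id

/-- Grouping the family `pastFuture` by its label, the past block determines the path up to `s` and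
the future block determines the increment. -/
lemma indep_brownianFiltration [IsProbabilityMeasure P] (hW : IsStandardBrownianMotion W P)
    {s s' : ℝ≥0} (hs : s ≤ s') :
    Indep (brownianFiltration W hW.measurable s)
      (MeasurableSpace.comap (increment W s s') inferInstance) P := by
  have hd : Disjoint (Finset.univ.filter fun p : Fin N × Bool => p.2 = true)
      (Finset.univ.filter fun p : Fin N × Bool => p.2 = false) := by
    rw [Finset.disjoint_filter]
    intro p _ h
    simp [h]
  have h := (iIndepFun_pastFuture hW s).indepFun_finset _ _ hd
    fun p => measurable_pastFuture hW.measurable s p.1 p.2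
  rw [IndepFun_iff_Indep] at h
  refine indep_of_indep_of_le_left (indep_of_indep_of_le_right h ?_) ?_
  · have hm : Measurable fun (x : (Finset.univ.filter fun p : Fin N × Bool => p.2 = false) →
        ℝ≥0 → ℝ) (j : Fin N) => x ⟨(j, false), by simp⟩ (s' - s) :=
      measurable_pi_lambda _ fun j => (measurable_pi_apply (s' - s)).comp (measurable_pi_apply _)
    have e : increment W s s' = (fun (x : (Finset.univ.filter fun p : Fin N × Bool =>
        p.2 = false) → ℝ≥0 → ℝ) (j : Fin N) => x ⟨(j, false), by simp⟩ (s' - s)) ∘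
        fun ω p => pastFuture W s p.1.1 p.1.2 ω := by
      ext ω j
      simp [increment, pastFuture, add_tsub_cancel_of_le hs]
    rw [e, ← MeasurableSpace.comap_comp]
    exact MeasurableSpace.comap_mono hm.comap_le
  · refine iSup₂_le fun u hu => ?_
    have hm : Measurable fun (x : (Finset.univ.filter fun p : Fin N × Bool => p.2 = true) →
        ℝ≥0 → ℝ) (j : Fin N) => x ⟨(j, true), by simp⟩ u :=
      measurable_pi_lambda _ fun j => (measurable_pi_apply u).comp (measurable_pi_apply _)
    have e : (fun ω i => W i u ω) = (fun (x : (Finset.univ.filter fun p : Fin N × Bool =>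
        p.2 = true) → ℝ≥0 → ℝ) (j : Fin N) => x ⟨(j, true), by simp⟩ u) ∘
        fun ω p => pastFuture W s p.1.1 p.1.2 ω := by
      ext ω j
      simp [pastFuture, min_eq_left hu]
    change MeasurableSpace.comap (fun ω i => W i u ω) _ ≤ _
    rw [e, ← MeasurableSpace.comap_comp]
    exact MeasurableSpace.comap_mono hm.comap_le

lemma indepFun_increment [IsProbabilityMeasure P] (hW : IsStandardBrownianMotion W P)
    {s s' : ℝ≥0} (hs : s ≤ s') {β γ : Type*} [MeasurableSpace β] [MeasurableSpace γ] {Y : Ω → β}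
    (hY : Measurable[brownianFiltration W hW.measurable s] Y) {f : (Fin N → ℝ) → γ}
    (hf : Measurable f) : IndepFun Y (fun ω => f (increment W s s' ω)) P := by
  rw [IndepFun_iff_Indep]
  refine indep_of_indep_of_le_left (indep_of_indep_of_le_right
    (indep_brownianFiltration hW hs) ?_) hY.comap_le
  rw [show (fun ω => f (increment W s s' ω)) = f ∘ increment W s s' from rfl,
    ← MeasurableSpace.comap_comp]
  exact MeasurableSpace.comap_mono hf.comap_le

lemma measurable_brownianFiltration (hW : ∀ i s, Measurable (W i s)) {u s : ℝ≥0} (h : u ≤ s)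
    (i : Fin N) : Measurable[brownianFiltration W hW s] (W i u) := by
  have h1 : Measurable[brownianFiltration W hW s] fun ω i => W i u ω := by
    have := (Filtration.stronglyAdapted_natural (β := fun _ : ℝ≥0 => Fin N → ℝ)
      (u := fun s ω i => W i s ω)
      (fun s => (measurable_pi_lambda _ (fun i => hW i s)).stronglyMeasurable)) u
    exact (this.mono ((brownianFiltration W hW).mono h)).measurable
  exact (measurable_pi_apply i).comp h1

lemma hasLaw_increment (hW : IsStandardBrownianMotion W P) {s s' : ℝ≥0} (hs : s ≤ s')
    (j : Fin N) : P.map (fun ω => increment W s s' ω j) = gaussianReal 0 (s' - s) := by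
  have h := ((hW.brownian j).toIsPreBrownianReal.hasLaw_sub s' s).map_eq
  have e : nndist (s' : ℝ) (s : ℝ) = s' - s := by
    ext
    rw [coe_nndist, Real.dist_eq, NNReal.coe_sub hs, abs_of_nonneg
      (sub_nonneg.2 (NNReal.coe_le_coe.2 hs))]
  rw [← e]
  exact h

lemma iIndepFun_increment (hW : IsStandardBrownianMotion W P) (s s' : ℝ≥0) :
    iIndepFun (fun j ω => increment W s s' ω j) P :=
  hW.indep.comp (fun _ (x : ℝ≥0 → ℝ) => x s' - x s)
    fun _ => (measurable_pi_apply _).sub (measurable_pi_apply _)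

/-- `|λ|²`. -/
def normSq (lam : Fin N → ℝ) : ℝ≥0 := ∑ j, ‖lam j‖₊ ^ 2

lemma coe_normSq (lam : Fin N → ℝ) : (normSq lam : ℝ) = ∑ j, lam j ^ 2 := by
  simp [normSq]

/-- The increment of `λ · W`. -/
def noise (W : Fin N → ℝ≥0 → Ω → ℝ) (lam : Fin N → ℝ) (s s' : ℝ≥0) (ω : Ω) : ℝ :=
  ∑ j, lam j * increment W s s' ω j

lemma measurable_noise (hW : ∀ i s, Measurable (W i s)) (lam : Fin N → ℝ) (s s' : ℝ≥0) :
    Measurable (noise W lam s s') :=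
  Finset.measurable_fun_sum _ fun j _ =>
    ((measurable_pi_apply j).comp (measurable_increment hW s s')).const_mul _

lemma noise_add (lam : Fin N → ℝ) (s s' s'' : ℝ≥0) (ω : Ω) :
    noise W lam s s' ω + noise W lam s' s'' ω = noise W lam s s'' ω := by
  rw [noise, noise, noise, ← Finset.sum_add_distrib]
  refine Finset.sum_congr rfl fun j _ => ?_
  simp only [increment]
  ring

lemma noise_self (lam : Fin N → ℝ) (s : ℝ≥0) (ω : Ω) : noise W lam s s ω = 0 := by
  simp [noise, increment]

lemma measurable_noise_filtration (hW : ∀ i s, Measurable (W i s)) (lam : Fin N → ℝ)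
    {s s' u : ℝ≥0} (h : s ≤ u) (h' : s' ≤ u) :
    Measurable[brownianFiltration W hW u] (noise W lam s s') :=
  Finset.measurable_fun_sum _ fun j _ =>
    ((measurable_brownianFiltration hW h' j).sub (measurable_brownianFiltration hW h j)).const_mul _

lemma map_noise [IsProbabilityMeasure P] (hW : IsStandardBrownianMotion W P) (lam : Fin N → ℝ)
    {s s' : ℝ≥0} (hs : s ≤ s') :
    P.map (noise W lam s s') = gaussianReal 0 (normSq lam * (s' - s)) := by
  have hm : ∀ j, Measurable fun ω => increment W s s' ω j := fun j =>
    (measurable_pi_apply j).comp (measurable_increment hW.measurable s s')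
  have : IsProbabilityMeasure (P.map (noise W lam s s')) :=
    Measure.isProbabilityMeasure_map (measurable_noise hW.measurable lam s s').aemeasurable
  refine Measure.ext_of_charFun ?_
  have hi : iIndepFun (fun j ω => lam j * increment W s s' ω j) P :=
    (iIndepFun_increment hW s s').comp (fun j x => lam j * x) fun j => measurable_const_mul _
  have h := hi.charFun_map_fun_sum_eq_prod fun j => ((hm j).const_mul _).aemeasurable
  rw [show noise W lam s s' = fun ω => ∑ j, lam j * increment W s s' ω j from rfl, h]
  ext x
  rw [Finset.prod_apply]
  have e : ∀ j, P.map (fun ω => lam j * increment W s s' ω j) =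
      gaussianReal 0 (‖lam j‖₊ ^ 2 * (s' - s)) := fun j => by
    have := gaussianReal_map_const_mul (μ := 0) (v := s' - s) (lam j)
    rw [show NNReal.mk (lam j ^ 2) (sq_nonneg _) = ‖lam j‖₊ ^ 2 by ext; simp] at this
    rw [mul_zero, ← hasLaw_increment hW hs j, Measure.map_map (measurable_const_mul _) (hm j)]
      at this
    exact this
  simp only [e, charFun_gaussianReal, ← Complex.exp_sum]
  congr 1
  rw [normSq]
  simp only [Finset.sum_mul, NNReal.coe_sum, NNReal.coe_mul, Finset.sum_neg_distrib,
    Complex.ofReal_zero, mul_zero, zero_mul, Complex.ofReal_sum,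
    zero_sub, NNReal.coe_pow, coe_nnnorm, Real.norm_eq_abs, sq_abs,
    Finset.sum_div]

lemma integral_comp_noise [IsProbabilityMeasure P] (hW : IsStandardBrownianMotion W P)
    (lam : Fin N → ℝ) {s s' : ℝ≥0} (hs : s ≤ s') {f : ℝ → ℝ} (hf : Measurable f) :
    ∫ ω, f (noise W lam s s' ω) ∂P = ∫ x, f x ∂gaussianReal 0 (normSq lam * (s' - s)) := by
  rw [← map_noise hW lam hs, integral_map (measurable_noise hW.measurable lam s s').aemeasurable
    hf.aestronglyMeasurable]

lemma integrable_comp_noise [IsProbabilityMeasure P] (hW : IsStandardBrownianMotion W P)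
    (lam : Fin N → ℝ) {s s' : ℝ≥0} (hs : s ≤ s') {f : ℝ → ℝ} (hf : Measurable f)
    (hi : Integrable f (gaussianReal 0 (normSq lam * (s' - s)))) :
    Integrable (fun ω => f (noise W lam s s' ω)) P := by
  rw [← map_noise hW lam hs] at hi
  exact hi.comp_measurable (measurable_noise hW.measurable lam s s')

/-- `E[e^{-λ·ΔW} ΔW_j] = -λ_j Δ e^{|λ|²Δ/2}`. -/
lemma integral_exp_noise_mul_increment [IsProbabilityMeasure P]
    (hW : IsStandardBrownianMotion W P) (lam : Fin N → ℝ) {s s' : ℝ≥0} (hs : s ≤ s')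
    (j : Fin N) :
    ∫ ω, Real.exp (-noise W lam s s' ω) * increment W s s' ω j ∂P =
      -(lam j * (s' - s : ℝ≥0)) * Real.exp (normSq lam * (s' - s : ℝ≥0) / 2) := by
  have hm : ∀ j, Measurable fun ω => increment W s s' ω j := fun j =>
    (measurable_pi_apply j).comp (measurable_increment hW.measurable s s')
  -- The integrand factorises over coordinates; only coordinate `j` carries the extra factor `x`.
  let f : Fin N → ℝ → ℝ := fun i x => if i = j then x * Real.exp (-lam i * x)
    else Real.exp (-lam i * x)
  have hfm : ∀ i, Measurable (f i) := fun i => by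
    simp only [f]
    split_ifs <;> fun_prop
  have h := (iIndepFun_increment hW s s').integral_fun_prod_comp (f := f)
    (fun i => (hm i).aemeasurable) (fun i => (hfm i).aestronglyMeasurable)
  have e1 : ∀ ω, ∏ i, f i (increment W s s' ω i) =
      Real.exp (-noise W lam s s' ω) * increment W s s' ω j := fun ω => by
    have : ∀ i, f i (increment W s s' ω i) = Real.exp (-lam i * increment W s s' ω i) *
        if i = j then increment W s s' ω i else 1 := fun i => by
      simp only [f]; split_ifs <;> ring
    simp only [this, Finset.prod_mul_distrib, ← Real.exp_sum, Finset.prod_ite_eq',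
      Finset.mem_univ, if_true]
    congr 2
    rw [noise, ← Finset.sum_neg_distrib]
    simp only [neg_mul]
  have e2 : ∀ i, ∫ ω, f i (increment W s s' ω i) ∂P =
      Real.exp (lam i ^ 2 * (s' - s : ℝ≥0) / 2) * if i = j then -(lam i * (s' - s : ℝ≥0)) else 1 :=
    fun i => by
      rw [← integral_map (φ := fun ω => increment W s s' ω i) (f := f i) (hm i).aemeasurable
        (hfm i).aestronglyMeasurable, hasLaw_increment hW hs i]
      simp only [f]
      split_ifs
      · rw [integral_mul_exp_gaussianReal, neg_sq]; ring
      · rw [integral_exp_mul_gaussianReal, neg_sq]; ring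
  simp only [e1, e2, Finset.prod_mul_distrib, ← Real.exp_sum, Finset.prod_ite_eq',
      Finset.mem_univ, if_true] at h
  rw [h, coe_normSq, Finset.sum_mul, Finset.sum_div]
  ring

end Brownian

/-! ### Second moments -/

section SecondMoment

variable {Ω : Type*} [MeasurableSpace Ω] {P : Measure Ω}

lemma sq_integral_mul_le {f g : Ω → ℝ} (hf : MemLp f 2 P) (hg : MemLp g 2 P) :
    (∫ ω, f ω * g ω ∂P) ^ 2 ≤ (∫ ω, f ω ^ 2 ∂P) * ∫ ω, g ω ^ 2 ∂P := by
  have hfg : Integrable (fun ω => f ω * g ω) P := hf.integrable_mul hg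
  set A := ∫ ω, f ω * g ω ∂P
  set B := ∫ ω, g ω ^ 2 ∂P with hB
  set F := ∫ ω, f ω ^ 2 ∂P
  have hB0 : 0 ≤ B := integral_nonneg fun ω => sq_nonneg _
  rcases hB0.eq_or_lt with h | h
  · have hz := (integral_eq_zero_iff_of_nonneg (fun ω => sq_nonneg (g ω)) hg.integrable_sq).1 h.symm
    have : A = 0 := by
      refine integral_eq_zero_of_ae ?_
      filter_upwards [hz] with ω hω
      have : g ω = 0 := by simpa using hω
      simp [this]
    rw [this, ← h]
    simp
  · have h1 : 0 ≤ ∫ ω, (B * f ω - A * g ω) ^ 2 ∂P := integral_nonneg fun ω => sq_nonneg _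
    have e : (fun ω => (B * f ω - A * g ω) ^ 2) = fun ω =>
        B ^ 2 * f ω ^ 2 - 2 * A * B * (f ω * g ω) + A ^ 2 * g ω ^ 2 := by ext ω; ring
    have i1 : Integrable (fun ω => B ^ 2 * f ω ^ 2 - 2 * A * B * (f ω * g ω)) P :=
      (hf.integrable_sq.const_mul _).sub (hfg.const_mul _)
    rw [e, integral_add i1 (hg.integrable_sq.const_mul _),
      integral_sub (hf.integrable_sq.const_mul _) (hfg.const_mul _), integral_const_mul,
      integral_const_mul, integral_const_mul] at h1
    have : 0 ≤ B * (F * B - A ^ 2) := by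
      change 0 ≤ B ^ 2 * F - 2 * A * B * A + A ^ 2 * B at h1
      linarith
    have := nonneg_of_mul_nonneg_right this h
    linarith

/-- The (extended) second moment. -/
def moment2 (P : Measure Ω) (f : Ω → ℝ) : ℝ≥0∞ := ∫⁻ ω, ENNReal.ofReal (f ω ^ 2) ∂P

lemma moment2_eq_ofReal {f : Ω → ℝ} (hf : MemLp f 2 P) :
    moment2 P f = ENNReal.ofReal (∫ ω, f ω ^ 2 ∂P) :=
  (ofReal_integral_eq_lintegral_ofReal hf.integrable_sq
    (Eventually.of_forall fun _ => sq_nonneg _)).symm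

lemma memLp_two_of_moment2_lt_top {f : Ω → ℝ} (hf : AEMeasurable f P) (h : moment2 P f < ∞) :
    MemLp f 2 P := by
  rw [memLp_two_iff_integrable_sq hf.aestronglyMeasurable]
  refine ⟨(hf.pow_const 2).aestronglyMeasurable, ?_⟩
  rw [hasFiniteIntegral_iff_ofReal (Eventually.of_forall fun _ => sq_nonneg _)]
  exact h

lemma moment2_add_le {f g : Ω → ℝ} (hf : AEMeasurable f P) :
    moment2 P (fun ω => f ω + g ω) ≤ 2 * moment2 P f + 2 * moment2 P g := by
  unfold moment2
  rw [← lintegral_const_mul'' _ (by fun_prop), ← lintegral_const_mul' _ _ (by simp),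
    ← lintegral_add_left' (by fun_prop)]
  refine lintegral_mono fun ω => ?_
  rw [← ENNReal.ofReal_ofNat, ← ENNReal.ofReal_mul (by norm_num),
    ← ENNReal.ofReal_mul (by norm_num), ← ENNReal.ofReal_add (by positivity) (by positivity)]
  exact ENNReal.ofReal_le_ofReal (by nlinarith [sq_nonneg (f ω - g ω)])

lemma moment2_neg (f : Ω → ℝ) : moment2 P (fun ω => -f ω) = moment2 P f := by
  simp [moment2]

lemma moment2_congr {f g : Ω → ℝ} (h : f =ᵐ[P] g) : moment2 P f = moment2 P g :=
  lintegral_congr_ae (h.mono fun ω hω => by simp only [hω])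

lemma moment2_sum_le {ι : Type*} (s : Finset ι) {f : ι → Ω → ℝ}
    (hf : ∀ i ∈ s, AEMeasurable (f i) P) :
    moment2 P (fun ω => ∑ i ∈ s, f i ω) ≤ s.card * ∑ i ∈ s, moment2 P (f i) := by
  unfold moment2
  rw [← lintegral_finsetSum' _ fun i hi => by have := hf i hi; fun_prop,
    ← lintegral_const_mul' _ _ (by simp)]
  refine lintegral_mono fun ω => ?_
  rw [← ENNReal.ofReal_sum_of_nonneg fun i _ => sq_nonneg _, ← ENNReal.ofReal_natCast,
    ← ENNReal.ofReal_mul (by positivity)]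
  exact ENNReal.ofReal_le_ofReal sq_sum_le_card_mul_sum_sq

/-- `(∫_t^s f)² ≤ (s - t) ∫_t^s f²`. -/
lemma ofReal_sq_intervalIntegral_le {t s : ℝ} (hts : t ≤ s) {f : ℝ → ℝ} :
    ENNReal.ofReal ((∫ v in t..s, f v) ^ 2) ≤
      ENNReal.ofReal (s - t) * ∫⁻ v in Icc t s, ENNReal.ofReal (f v ^ 2) := by
  rcases hts.eq_or_lt with rfl | hlt
  · simp
  rw [intervalIntegral.integral_of_le hts, ← integral_Icc_eq_integral_Ioc]
  by_cases hi : Integrable f (volume.restrict (Icc t s))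
  swap
  -- Without integrability the integral on the left is `0` by convention.
  · rw [integral_undef hi]; simp
  rcases eq_or_ne (∫⁻ v in Icc t s, ENNReal.ofReal (f v ^ 2)) ∞ with h | h
  · rw [h, ENNReal.mul_top (by simpa using hlt)]
    exact le_top
  have hL : MemLp f 2 (volume.restrict (Icc t s)) :=
    memLp_two_of_moment2_lt_top hi.aestronglyMeasurable.aemeasurable h.lt_top
  have h1 : MemLp (fun _ => (1 : ℝ)) 2 (volume.restrict (Icc t s)) := memLp_const 1
  have key := sq_integral_mul_le h1 hL
  have e := moment2_eq_ofReal hL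
  unfold moment2 at e
  rw [e, ← ENNReal.ofReal_mul (by linarith)]
  refine ENNReal.ofReal_le_ofReal ?_
  simpa [hts, measureReal_def] using key

end SecondMoment

/-! ### Simple processes and the budget equation -/

section Simple

variable {Ω : Type*} [mΩ : MeasurableSpace Ω] {N : ℕ} {P : Measure Ω}
  {W : Fin N → ℝ≥0 → Ω → ℝ} {ℱ : Filtration ℝ≥0 mΩ}

/-- The time `u` clamped to `[t, s]`. -/
def clamp (t s u : ℝ≥0) : ℝ≥0 := max t (min u s)

lemma le_clamp (t s u : ℝ≥0) : t ≤ clamp t s u := le_max_left _ _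

lemma clamp_le {t s : ℝ≥0} (h : t ≤ s) (u : ℝ≥0) : clamp t s u ≤ s :=
  max_le h (min_le_right _ _)

lemma clamp_mono (t s : ℝ≥0) : Monotone (clamp t s) := fun _ _ h =>
  max_le_max le_rfl (min_le_min h le_rfl)

lemma clamp_of_le {t s u : ℝ≥0} (hts : t ≤ s) (h : s ≤ u) : clamp t s u = s := by
  rw [clamp, min_eq_right h, max_eq_right hts]

lemma le_clamp_of_le {t s u : ℝ≥0} (h : u ≤ s) : u ≤ clamp t s u := by
  rw [clamp, min_eq_left h]
  exact le_max_right _ _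

/-- `∫_t^s S · (dW + λ dv)` for a simple integrand. -/
def SimpleProcess.total (S : SimpleProcess ℱ N) (W : Fin N → ℝ≥0 → Ω → ℝ) (lam : Fin N → ℝ)
    (t s : ℝ≥0) (ω : Ω) : ℝ :=
  ∑ k ∈ Finset.range S.n, ∑ j : Fin N, S.coef k ω j *
    (increment W (clamp t s (S.time k)) (clamp t s (S.time (k + 1))) ω j +
      lam j * ((clamp t s (S.time (k + 1)) : ℝ) - clamp t s (S.time k)))

lemma integral_indicator_time {t s a b : ℝ≥0} (hts : t ≤ s) (hab : a ≤ b) (c : ℝ) :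
    ∫ v in (t : ℝ)..s, (if a < v.toNNReal ∧ v.toNNReal ≤ b then c else 0) =
      c * ((clamp t s b : ℝ) - clamp t s a) := by
  have hts' : (t : ℝ) ≤ s := by exact_mod_cast hts
  rw [intervalIntegral.integral_of_le hts']
  have e : ∫ v in Ioc (t : ℝ) s, (if a < v.toNNReal ∧ v.toNNReal ≤ b then c else 0) =
      ∫ v in Ioc (t : ℝ) s, (Ioc (clamp t s a : ℝ) (clamp t s b)).indicator (fun _ => c) v := by
    refine setIntegral_congr_fun measurableSet_Ioc fun v hv => ?_
    have hv0 : 0 ≤ v := t.2.trans hv.1.le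
    lift v to ℝ≥0 using hv0
    have h1 : t < v := by exact_mod_cast hv.1
    have h2 : v ≤ s := by exact_mod_cast hv.2
    simp only [Real.toNNReal_coe, indicator_apply, mem_Ioc, NNReal.coe_lt_coe, NNReal.coe_le_coe]
    refine if_congr ?_ rfl rfl
    simp only [clamp, max_lt_iff, min_lt_iff, le_max_iff, le_min_iff]
    constructor
    · rintro ⟨ha, hb⟩
      exact ⟨⟨h1, Or.inl ha⟩, Or.inr ⟨hb, h2⟩⟩
    · rintro ⟨⟨-, ha⟩, hb⟩
      exact ⟨ha.resolve_right (not_lt.2 h2), (hb.resolve_left (not_le.2 h1)).1⟩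
  have hsub : Ioc (clamp t s a : ℝ) (clamp t s b) ⊆ Ioc (t : ℝ) s :=
    Ioc_subset_Ioc (by exact_mod_cast le_clamp t s a) (by exact_mod_cast clamp_le hts b)
  have hle : (clamp t s a : ℝ) ≤ clamp t s b := by exact_mod_cast clamp_mono t s hab
  rw [e, setIntegral_indicator measurableSet_Ioc, inter_eq_self_of_subset_right hsub,
    setIntegral_const, smul_eq_mul, mul_comm, measureReal_def, Real.volume_Ioc,
    ENNReal.toReal_ofReal (by linarith)]

lemma SimpleProcess.eval_dotProduct (S : SimpleProcess ℱ N) (lam : Fin N → ℝ) (v : ℝ≥0) (ω : Ω) :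
    S.eval v ω ⬝ᵥ lam = ∑ k ∈ Finset.range S.n,
      if S.time k < v ∧ v ≤ S.time (k + 1) then S.coef k ω ⬝ᵥ lam else 0 := by
  rw [SimpleProcess.eval, sum_dotProduct]
  refine Finset.sum_congr rfl fun k _ => ?_
  split_ifs <;> simp

lemma measurable_ite_toNNReal (a b : ℝ≥0) (c : ℝ) :
    Measurable fun v : ℝ => if a < v.toNNReal ∧ v.toNNReal ≤ b then c else 0 := by
  have h : MeasurableSet {u : ℝ≥0 | a < u ∧ u ≤ b} := measurableSet_Ioc
  exact Measurable.ite (measurable_real_toNNReal h) measurable_const measurable_const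

lemma intervalIntegrable_ite_toNNReal (a b : ℝ≥0) (c x y : ℝ) :
    IntervalIntegrable (fun v : ℝ => if a < v.toNNReal ∧ v.toNNReal ≤ b then c else 0)
      volume x y := by
  refine (intervalIntegrable_const (c := |c|)).mono_fun
    (measurable_ite_toNNReal a b c).aestronglyMeasurable (Eventually.of_forall fun v => ?_)
  simp only
  split_ifs <;> simp

lemma SimpleProcess.intervalIntegrable_eval (S : SimpleProcess ℱ N) (lam : Fin N → ℝ)
    (x y : ℝ) (ω : Ω) :
    IntervalIntegrable (fun v : ℝ => S.eval v.toNNReal ω ⬝ᵥ lam) volume x y := by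
  simp only [S.eval_dotProduct lam]
  have h := IntervalIntegrable.sum (Finset.range S.n) fun k _ =>
    intervalIntegrable_ite_toNNReal (S.time k) (S.time (k + 1)) (S.coef k ω ⬝ᵥ lam) x y
  rwa [Finset.sum_fn] at h

lemma SimpleProcess.total_eq (S : SimpleProcess ℱ N) (lam : Fin N → ℝ) {t s : ℝ≥0}
    (hts : t ≤ s) (ω : Ω) :
    S.total W lam t s ω =
      (∫ v in (t : ℝ)..s, S.eval v.toNNReal ω ⬝ᵥ lam) + S.integral W t s ω := by
  simp only [S.eval_dotProduct lam]
  rw [intervalIntegral.integral_finsetSum fun k _ => intervalIntegrable_ite_toNNReal _ _ _ _ _,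
    SimpleProcess.integral, ← Finset.sum_add_distrib, SimpleProcess.total]
  refine Finset.sum_congr rfl fun k _ => ?_
  rw [integral_indicator_time hts (S.mono (Nat.le_succ k)), dotProduct, Finset.sum_mul,
    ← Finset.sum_add_distrib]
  refine Finset.sum_congr rfl fun j _ => ?_
  simp only [increment, clamp]
  ring

end Simple

/-! ### The budget equation for admissible strategies -/

section Budget

variable {Ω : Type*} [mΩ : MeasurableSpace Ω] {N : ℕ} {P : Measure Ω}
  {W : Fin N → ℝ≥0 → Ω → ℝ}

lemma memLp_increment (hW : IsStandardBrownianMotion W P) (s s' : ℝ≥0) (j : Fin N) :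
    MemLp (fun ω => increment W s s' ω j) 2 P := by
  have h := (hW.brownian j).toIsPreBrownianReal.hasLaw_sub s' s
  have hm := memLp_id_gaussianReal' (μ := 0) (v := nndist (s' : ℝ) (s : ℝ)) 2 (by norm_num)
  exact (memLp_map_measure_iff aestronglyMeasurable_id h.aemeasurable).1 (h.map_eq.symm ▸ hm)

lemma integrable_exp_mul_noise [IsProbabilityMeasure P] (hW : IsStandardBrownianMotion W P)
    (lam : Fin N → ℝ) {s s' : ℝ≥0} (hs : s ≤ s') (c : ℝ) :
    Integrable (fun ω => Real.exp (c * noise W lam s s' ω)) P :=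
  integrable_comp_noise hW lam hs (f := fun x => Real.exp (c * x)) (by fun_prop)
    (integrable_exp_mul_gaussianReal c)

lemma integral_exp_mul_noise [IsProbabilityMeasure P] (hW : IsStandardBrownianMotion W P)
    (lam : Fin N → ℝ) {s s' : ℝ≥0} (hs : s ≤ s') (c : ℝ) :
    ∫ ω, Real.exp (c * noise W lam s s' ω) ∂P =
      Real.exp (c ^ 2 * (normSq lam * (s' - s : ℝ≥0)) / 2) := by
  rw [integral_comp_noise hW lam hs (f := fun x => Real.exp (c * x)) (by fun_prop),
    integral_exp_mul_gaussianReal]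
  simp

lemma memLp_exp_mul_noise [IsProbabilityMeasure P] (hW : IsStandardBrownianMotion W P)
    (lam : Fin N → ℝ) {s s' : ℝ≥0} (hs : s ≤ s') (c : ℝ) :
    MemLp (fun ω => Real.exp (c * noise W lam s s' ω)) 2 P := by
  have hm := measurable_noise hW.measurable lam s s'
  rw [memLp_two_iff_integrable_sq (by fun_prop)]
  refine (integrable_exp_mul_noise hW lam hs (2 * c)).congr (Eventually.of_forall fun ω => ?_)
  simp only [← Real.exp_nat_mul]
  congr 1
  push_cast
  ring

/-- The state price density `exp(-λ·(W_T - W_t) - |λ|²(T-t)/2)`. -/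
def pricing (W : Fin N → ℝ≥0 → Ω → ℝ) (lam : Fin N → ℝ) (t T : ℝ≥0) (ω : Ω) : ℝ :=
  Real.exp (-noise W lam t T ω - normSq lam * (T - t : ℝ≥0) / 2)

lemma pricing_eq (lam : Fin N → ℝ) (t T : ℝ≥0) : pricing W lam t T = fun ω =>
    Real.exp (-(normSq lam * (T - t : ℝ≥0) / 2)) * Real.exp (-1 * noise W lam t T ω) := by
  ext ω
  rw [pricing, ← Real.exp_add]
  ring_nf

lemma measurable_pricing (hW : ∀ i s, Measurable (W i s)) (lam : Fin N → ℝ) (t T : ℝ≥0) :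
    Measurable (pricing W lam t T) := by
  have := measurable_noise hW lam t T
  unfold pricing
  fun_prop

lemma memLp_pricing [IsProbabilityMeasure P] (hW : IsStandardBrownianMotion W P)
    (lam : Fin N → ℝ) {t T : ℝ≥0} (h : t ≤ T) : MemLp (pricing W lam t T) 2 P := by
  rw [pricing_eq]
  exact (memLp_exp_mul_noise hW lam h (-1)).const_mul _

lemma integral_pricing [IsProbabilityMeasure P] (hW : IsStandardBrownianMotion W P)
    (lam : Fin N → ℝ) {t T : ℝ≥0} (h : t ≤ T) : ∫ ω, pricing W lam t T ω ∂P = 1 := by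
  rw [pricing_eq, integral_const_mul, integral_exp_mul_noise hW lam h, ← Real.exp_add,
    Real.exp_eq_one_iff]
  ring

lemma pricing_mul (lam : Fin N → ℝ) {t a b : ℝ≥0} (hta : t ≤ a) (hab : a ≤ b) (ω : Ω) :
    pricing W lam t b ω = pricing W lam t a ω * pricing W lam a b ω := by
  rw [pricing, pricing, pricing, ← Real.exp_add, ← noise_add lam t a b,
    NNReal.coe_sub (hta.trans hab), NNReal.coe_sub hta, NNReal.coe_sub hab]
  ring_nf

/-- Girsanov's theorem for a single increment: under the pricing density `W` has drift `-λ`, so the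
drifted increment has mean zero. -/
lemma integral_pricing_mul_increment [IsProbabilityMeasure P]
    (hW : IsStandardBrownianMotion W P) (lam : Fin N → ℝ) {a b : ℝ≥0} (h : a ≤ b) (j : Fin N) :
    ∫ ω, pricing W lam a b ω * (increment W a b ω j + lam j * ((b : ℝ) - a)) ∂P = 0 := by
  have h1 : Integrable (fun ω => pricing W lam a b ω * increment W a b ω j) P :=
    (memLp_pricing hW lam h).integrable_mul (memLp_increment hW a b j)
  have h2 : Integrable (pricing W lam a b) P := (memLp_pricing hW lam h).integrable (by norm_num)
  simp only [mul_add]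
  rw [integral_add h1 (h2.mul_const _), integral_mul_const, integral_pricing hW lam h, one_mul]
  have e : (fun ω => pricing W lam a b ω * increment W a b ω j) = fun ω =>
      Real.exp (-(normSq lam * (b - a : ℝ≥0) / 2)) *
        (Real.exp (-noise W lam a b ω) * increment W a b ω j) := by
    ext ω
    simp only [pricing_eq, neg_one_mul]
    ring
  rw [e, integral_const_mul, integral_exp_noise_mul_increment hW lam h, ← NNReal.coe_sub h,
    mul_left_comm, ← Real.exp_add, neg_add_cancel, Real.exp_zero]
  ring

/-- The pricing density annihilates the elementary gains. -/
lemma integral_pricing_mul_gain [IsProbabilityMeasure P] (hW : IsStandardBrownianMotion W P)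
    (lam : Fin N → ℝ) {t a b T : ℝ≥0} (hta : t ≤ a) (hab : a ≤ b) (hbT : b ≤ T) {ξ : Ω → ℝ}
    (hξ : Measurable[brownianFiltration W hW.measurable a] ξ) (j : Fin N) :
    ∫ ω, pricing W lam t T ω *
      (ξ ω * (increment W a b ω j + lam j * ((b : ℝ) - a))) ∂P = 0 := by
  set 𝓕 := brownianFiltration W hW.measurable with h𝓕
  have hpm : ∀ {r s u : ℝ≥0}, r ≤ u → s ≤ u → Measurable[𝓕 u] (pricing W lam r s) :=
    fun {r s u} hr hs => by
      unfold pricing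
      exact Real.measurable_exp.comp
        ((measurable_noise_filtration hW.measurable lam hr hs).neg.sub measurable_const)
  have hmn : Measurable fun x : Fin N → ℝ => ∑ i, lam i * x i :=
    Finset.measurable_fun_sum _ fun i _ => (measurable_pi_apply i).const_mul _
  have hY : Measurable[𝓕 a] fun ω => ξ ω * pricing W lam t a ω := hξ.mul (hpm hta le_rfl)
  have hfm : Measurable fun x : Fin N → ℝ =>
      Real.exp (-(∑ i, lam i * x i) - normSq lam * (b - a : ℝ≥0) / 2) *
        (x j + lam j * ((b : ℝ) - a)) :=
    (Real.measurable_exp.comp (hmn.neg.sub measurable_const)).mul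
      ((measurable_pi_apply j).add measurable_const)
  have i1 := indepFun_increment hW hab hY hfm
  have hfm2 : Measurable fun x : Fin N → ℝ =>
      Real.exp (-(∑ i, lam i * x i) - normSq lam * (T - b : ℝ≥0) / 2) :=
    Real.measurable_exp.comp (hmn.neg.sub measurable_const)
  have hinc : Measurable[𝓕 b] fun ω => increment W a b ω j :=
    (measurable_brownianFiltration hW.measurable le_rfl j).sub
      (measurable_brownianFiltration hW.measurable hab j)
  have hY2 : Measurable[𝓕 b] fun ω => (ξ ω * pricing W lam t a ω) *
      (pricing W lam a b ω * (increment W a b ω j + lam j * ((b : ℝ) - a))) :=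
    (hY.mono (𝓕.mono hab) le_rfl).mul ((hpm hab le_rfl).mul (hinc.add measurable_const))
  have i2 := indepFun_increment hW hbT hY2 hfm2
  -- The density splits over `[t,a]`, `[a,b]`, `[b,T]`. Independence after `b` removes the last
  -- factor, and independence after `a` isolates the middle one, whose mean is zero.
  have e : ∀ ω, pricing W lam t T ω * (ξ ω * (increment W a b ω j + lam j * ((b : ℝ) - a))) =
      ((ξ ω * pricing W lam t a ω) *
      (pricing W lam a b ω * (increment W a b ω j + lam j * ((b : ℝ) - a)))) *
        pricing W lam b T ω := fun ω => by
    rw [pricing_mul lam (hta.trans hab) hbT, pricing_mul lam hta hab]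
    ring
  simp only [e]
  have m1 := (hY.mono (𝓕.le a) le_rfl)
  have m2 := (hY2.mono (𝓕.le b) le_rfl)
  have m3 := measurable_pricing hW.measurable lam b T
  have m4 : Measurable fun ω =>
      pricing W lam a b ω * (increment W a b ω j + lam j * ((b : ℝ) - a)) :=
    (measurable_pricing hW.measurable lam a b).mul
      ((hinc.mono (𝓕.le b) le_rfl).add measurable_const)
  have k2 := i2.integral_fun_mul_eq_mul_integral m2.aestronglyMeasurable m3.aestronglyMeasurable
  have k1 := i1.integral_fun_mul_eq_mul_integral m1.aestronglyMeasurable m4.aestronglyMeasurable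
  refine k2.trans ?_
  have k1' := k1.trans (congrArg _ (integral_pricing_mul_increment hW lam hab j))
  rw [mul_zero] at k1'
  have k1'' : ∫ ω, ξ ω * pricing W lam t a ω *
    (pricing W lam a b ω * (increment W a b ω j + lam j * ((b : ℝ) - a))) ∂P = 0 := k1'
  rw [k1'', zero_mul]

variable {ℱ : Filtration ℝ≥0 mΩ}

lemma memLp_gain [IsProbabilityMeasure P] (hW : IsStandardBrownianMotion W P)
    (S : SimpleProcess ℱ N) (lam : Fin N → ℝ) (a b : ℝ≥0) (k : ℕ) (j : Fin N) :
    MemLp (fun ω => S.coef k ω j * (increment W a b ω j + lam j * ((b : ℝ) - a))) 2 P := by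
  obtain ⟨C, hC⟩ := S.bounded
  have h1 : MemLp (fun ω => increment W a b ω j + lam j * ((b : ℝ) - a)) 2 P :=
    (memLp_increment hW a b j).add (memLp_const _)
  have hm : Measurable fun ω => S.coef k ω j :=
    (measurable_pi_apply j).comp ((S.measurable k).mono (ℱ.le _) le_rfl)
  refine MemLp.of_le_mul (c := C) h1 (hm.aestronglyMeasurable.mul h1.1)
    (Eventually.of_forall fun ω => ?_)
  rw [norm_mul]
  gcongr
  exact hC k ω j

lemma memLp_total [IsProbabilityMeasure P] (hW : IsStandardBrownianMotion W P)
    (S : SimpleProcess ℱ N) (lam : Fin N → ℝ) (t s : ℝ≥0) :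
    MemLp (S.total W lam t s) 2 P :=
  memLp_finsetSum _ fun k _ => memLp_finsetSum _ fun j _ => memLp_gain hW S lam _ _ k j

lemma integral_pricing_mul_total [IsProbabilityMeasure P] (hW : IsStandardBrownianMotion W P)
    (S : SimpleProcess (brownianFiltration W hW.measurable) N) (lam : Fin N → ℝ) {t T : ℝ≥0}
    (htT : t ≤ T) : ∫ ω, pricing W lam t T ω * S.total W lam t T ω ∂P = 0 := by
  simp only [SimpleProcess.total, Finset.mul_sum]
  have hint : ∀ k j, Integrable (fun ω => pricing W lam t T ω * (S.coef k ω j *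
      (increment W (clamp t T (S.time k)) (clamp t T (S.time (k + 1))) ω j +
      lam j * ((clamp t T (S.time (k + 1)) : ℝ) - clamp t T (S.time k))))) P := fun k j =>
    (memLp_pricing hW lam htT).integrable_mul (memLp_gain hW S lam _ _ k j)
  rw [integral_finsetSum _ fun k _ => integrable_finsetSum _ fun j _ => hint k j]
  refine Finset.sum_eq_zero fun k _ => ?_
  rw [integral_finsetSum _ fun j _ => hint k j]
  refine Finset.sum_eq_zero fun j _ => ?_
  rcases le_total (S.time k) T with h | h
  -- For `S.time k ≤ T` clamping can only move the left endpoint later, so the coefficient is still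
  -- measurable there.
  · refine integral_pricing_mul_gain hW lam (le_clamp _ _ _)
      (clamp_mono _ _ (S.mono (Nat.le_succ k))) (clamp_le htT _) ?_ j
    exact ((measurable_pi_apply j).comp (S.measurable k)).mono
      ((brownianFiltration W hW.measurable).mono (le_clamp_of_le h)) le_rfl
  -- A block starting at or after `T` is clamped to a single point and contributes nothing.
  · rw [clamp_of_le htT h, clamp_of_le htT (h.trans (S.mono (Nat.le_succ k)))]
    simp [increment]

end Budget

/-! ### Square integrability and pricing of admissible terminal wealth. -/

section Admissible

variable {Ω : Type*} [mΩ : MeasurableSpace Ω] {N : ℕ} {P : Measure Ω}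
  {W : Fin N → ℝ≥0 → Ω → ℝ} {ℱ : Filtration ℝ≥0 mΩ}

/-- Progressivity at the single time `T` gives joint measurability of the process stopped at `T`,
which agrees with `φ` on `[t, T]`; this is what Tonelli's theorem and Fubini-type measurability
require. -/
lemma measurable_stopped_of_isProgressive {φ : ℝ≥0 → Ω → Fin N → ℝ} (h : IsProgressive ℱ φ)
    (T : ℝ≥0) : Measurable fun p : ℝ × Ω => φ (min p.1.toNNReal T) p.2 := by
  have h1 := h T
  have h2 : @Measurable (ℝ × Ω) (Set.Iic T × Ω) _
      (@Prod.instMeasurableSpace _ _ Subtype.instMeasurableSpace (ℱ T))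
      fun p => (⟨min p.1.toNNReal T, mem_Iic.2 (min_le_right _ _)⟩, p.2) := by
    refine @Measurable.prodMk _ _ _ _ Subtype.instMeasurableSpace (ℱ T) _ _ ?_ ?_
    · exact ((measurable_real_toNNReal.comp measurable_fst).min measurable_const).subtype_mk
    · exact measurable_snd.mono le_rfl (ℱ.le T)
  exact h1.comp h2

lemma sq_dotProduct_le (a lam : Fin N → ℝ) : (a ⬝ᵥ lam) ^ 2 ≤ normSq lam * ∑ j, a j ^ 2 := by
  rw [coe_normSq, mul_comm]
  exact Finset.sum_mul_sq_le_sq_mul_sq _ _ _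

lemma ofReal_sq_intervalIntegral_dotProduct_le {t s T : ℝ≥0} (hts : t ≤ s) (hsT : s ≤ T)
    (f : ℝ → Fin N → ℝ) (lam : Fin N → ℝ) :
    ENNReal.ofReal ((∫ v in (t : ℝ)..s, f v ⬝ᵥ lam) ^ 2) ≤
      ((T - t : ℝ≥0) * normSq lam : ℝ≥0) *
        ∫⁻ v in Icc (t : ℝ) T, ENNReal.ofReal (∑ j, f v j ^ 2) := by
  refine (ofReal_sq_intervalIntegral_le (by exact_mod_cast hts)).trans ?_
  rw [ENNReal.coe_mul, mul_assoc, ← lintegral_const_mul' _ _ ENNReal.coe_ne_top]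
  have h1 : ENNReal.ofReal ((s : ℝ) - t) ≤ ((T - t : ℝ≥0) : ℝ≥0∞) := by
    rw [← NNReal.coe_sub hts, ENNReal.ofReal_coe_nnreal]
    exact_mod_cast tsub_le_tsub_right hsT t
  refine mul_le_mul' h1 (lintegral_mono' (Measure.restrict_mono
    (Icc_subset_Icc le_rfl (by exact_mod_cast hsT)) le_rfl) fun v => ?_)
  rw [← ENNReal.ofReal_coe_nnreal, ← ENNReal.ofReal_mul (by positivity)]
  exact ENNReal.ofReal_le_ofReal (sq_dotProduct_le _ _)

lemma ae_intervalIntegrable_dotProduct [SFinite P] {φ : ℝ≥0 → Ω → Fin N → ℝ} {t s T : ℝ≥0}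
    (hts : t ≤ s) (hsT : s ≤ T)
    (hφ : Measurable fun p : ℝ × Ω => φ (min p.1.toNNReal T) p.2)
    (hsq : sqIntegral P φ t T < ∞) (lam : Fin N → ℝ) :
    ∀ᵐ ω ∂P, IntervalIntegrable (fun v : ℝ => φ v.toNNReal ω ⬝ᵥ lam) volume t s := by
  have hmin : ∀ v ∈ Icc (t : ℝ) T, min v.toNNReal T = v.toNNReal := fun v hv =>
    min_eq_left (Real.toNNReal_le_iff_le_coe.2 hv.2)
  have e : ∀ ω, ∫⁻ v in Icc (t : ℝ) T, ENNReal.ofReal (∑ j, (φ v.toNNReal ω j) ^ 2) =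
      ∫⁻ v in Icc (t : ℝ) T, ENNReal.ofReal (∑ j, (φ (min v.toNNReal T) ω j) ^ 2) := fun ω =>
    setLIntegral_congr_fun measurableSet_Icc fun v hv => by simp only [hmin v hv]
  have hj : ∀ j, Measurable fun p : ℝ × Ω => φ (min p.1.toNNReal T) p.2 j := fun j =>
    (measurable_pi_apply j).comp hφ
  have hm : Measurable fun p : ℝ × Ω =>
      ENNReal.ofReal (∑ j, (φ (min p.1.toNNReal T) p.2 j) ^ 2) :=
    (Finset.measurable_fun_sum _ fun j _ => (hj j).pow_const 2).ennreal_ofReal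
  have hfin : ∀ᵐ ω ∂P, ∫⁻ v in Icc (t : ℝ) T, ENNReal.ofReal (∑ j, (φ v.toNNReal ω j) ^ 2) < ∞ := by
    refine ae_lt_top' ?_ hsq.ne
    simp only [e]
    exact (Measurable.lintegral_prod_left' (μ := volume.restrict (Icc (t : ℝ) T)) hm).aemeasurable
  filter_upwards [hfin] with ω hω
  have hts' : (t : ℝ) ≤ s := by exact_mod_cast hts
  rw [intervalIntegrable_iff_integrableOn_Icc_of_le hts']
  refine IntegrableOn.mono_set (t := Icc (t : ℝ) T) ?_
    (Icc_subset_Icc le_rfl (by exact_mod_cast hsT))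
  have hms : Measurable fun v : ℝ => φ (min v.toNNReal T) ω ⬝ᵥ lam := by
    simp only [dotProduct]
    exact Finset.measurable_fun_sum _ fun j _ =>
      ((hj j).comp (measurable_id.prodMk measurable_const)).mul_const _
  have h2 : MemLp (fun v : ℝ => φ (min v.toNNReal T) ω ⬝ᵥ lam) 2
      (volume.restrict (Icc (t : ℝ) T)) := by
    refine memLp_two_of_moment2_lt_top hms.aemeasurable ?_
    rw [e] at hω
    refine lt_of_le_of_lt (lintegral_mono (g := fun v : ℝ => (normSq lam : ℝ≥0∞) *
      ENNReal.ofReal (∑ j, (φ (min v.toNNReal T) ω j) ^ 2)) fun v => ?_) ?_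
    · beta_reduce
      rw [← ENNReal.ofReal_coe_nnreal, ← ENNReal.ofReal_mul (by positivity)]
      exact ENNReal.ofReal_le_ofReal (sq_dotProduct_le _ _)
    · rw [lintegral_const_mul' _ _ ENNReal.coe_ne_top]
      exact ENNReal.mul_lt_top ENNReal.coe_lt_top hω
  refine (IntegrableOn.congr_fun (f := fun v : ℝ => φ (min v.toNNReal T) ω ⬝ᵥ lam)
    (h2.integrable (by norm_num)) (fun v hv => ?_) measurableSet_Icc)
  simp only [hmin v hv]

/-- The second moment of the drift error of a simple approximation. -/
lemma moment2_drift_le {φ : ℝ≥0 → Ω → Fin N → ℝ} {t s T : ℝ≥0} (hts : t ≤ s) (hsT : s ≤ T)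
    {lam : Fin N → ℝ}
    (hφ : ∀ᵐ ω ∂P, IntervalIntegrable (fun v : ℝ => φ v.toNNReal ω ⬝ᵥ lam) volume t s)
    (S : SimpleProcess ℱ N) :
    moment2 P (fun ω => (∫ v in (t : ℝ)..s, S.eval v.toNNReal ω ⬝ᵥ lam) -
      ∫ v in (t : ℝ)..s, φ v.toNNReal ω ⬝ᵥ lam) ≤
      ((T - t : ℝ≥0) * normSq lam : ℝ≥0) * sqIntegral P (fun v ω => S.eval v ω - φ v ω) t T := by
  have h1 : (fun ω => (∫ v in (t : ℝ)..s, S.eval v.toNNReal ω ⬝ᵥ lam) -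
      ∫ v in (t : ℝ)..s, φ v.toNNReal ω ⬝ᵥ lam) =ᵐ[P]
      fun ω => ∫ v in (t : ℝ)..s, (S.eval v.toNNReal ω - φ v.toNNReal ω) ⬝ᵥ lam := by
    filter_upwards [hφ] with ω hω
    rw [← intervalIntegral.integral_sub (S.intervalIntegrable_eval lam _ _ ω) hω]
    simp only [sub_dotProduct]
  rw [moment2_congr h1, sqIntegral, ← lintegral_const_mul' _ _ ENNReal.coe_ne_top]
  exact lintegral_mono fun ω => ofReal_sq_intervalIntegral_dotProduct_le hts hsT _ lam

lemma measurable_intervalIntegral_dotProduct [SFinite P] {φ : ℝ≥0 → Ω → Fin N → ℝ}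
    {t s T : ℝ≥0} (hts : t ≤ s) (hsT : s ≤ T)
    (hφ : Measurable fun p : ℝ × Ω => φ (min p.1.toNNReal T) p.2) (lam : Fin N → ℝ) :
    Measurable fun ω => ∫ v in (t : ℝ)..s, φ v.toNNReal ω ⬝ᵥ lam := by
  have hts' : (t : ℝ) ≤ s := by exact_mod_cast hts
  have e : ∀ ω, ∫ v in (t : ℝ)..s, φ v.toNNReal ω ⬝ᵥ lam =
      ∫ v in Ioc (t : ℝ) s, φ (min v.toNNReal T) ω ⬝ᵥ lam := fun ω => by
    rw [intervalIntegral.integral_of_le hts']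
    refine setIntegral_congr_fun measurableSet_Ioc fun v hv => ?_
    have : min v.toNNReal T = v.toNNReal :=
      min_eq_left (Real.toNNReal_le_iff_le_coe.2 (hv.2.trans (by exact_mod_cast hsT)))
    simp only [this]
  simp only [e]
  have hm : Measurable fun p : ℝ × Ω => φ (min p.1.toNNReal T) p.2 ⬝ᵥ lam := by
    simp only [dotProduct]
    exact Finset.measurable_fun_sum _ fun j _ =>
      ((measurable_pi_apply j).comp hφ).mul_const _
  exact (hm.stronglyMeasurable.integral_prod_left' (μ := volume.restrict (Ioc (t : ℝ) s))).measurable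

lemma SimpleProcess.measurable_integral (hW : ∀ i s, Measurable (W i s))
    (S : SimpleProcess ℱ N) (t s : ℝ≥0) : Measurable (S.integral W t s) :=
  Finset.measurable_fun_sum _ fun k _ => Finset.measurable_fun_sum _ fun j _ =>
    ((measurable_pi_apply j).comp ((S.measurable k).mono (ℱ.le _) le_rfl)).mul
      ((hW _ _).sub (hW _ _))

lemma tendsto_total_sub (hW : IsStandardBrownianMotion W P) {t s T : ℝ≥0} (hts : t ≤ s)
    (hsT : s ≤ T) {φ : ℝ≥0 → Ω → Fin N → ℝ} {lam : Fin N → ℝ}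
    (hφ : ∀ᵐ ω ∂P, IntervalIntegrable (fun v : ℝ => φ v.toNNReal ω ⬝ᵥ lam) volume t s)
    {M X : Ω → ℝ} {x : ℝ} (hM : AEMeasurable M P)
    (hX : ∀ᵐ ω ∂P, X ω = x + (∫ v in (t : ℝ)..s, φ v.toNNReal ω ⬝ᵥ lam) + M ω)
    {S : ℕ → SimpleProcess ℱ N}
    (hS1 : Tendsto (fun n => sqIntegral P (fun v ω => (S n).eval v ω - φ v ω) t T) atTop (𝓝 0))
    (hS2 : Tendsto (fun n => ∫⁻ ω, ENNReal.ofReal (((S n).integral W t s ω - M ω) ^ 2) ∂P)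
      atTop (𝓝 0)) :
    Tendsto (fun n => moment2 P (fun ω => (S n).total W lam t s ω - (X ω - x))) atTop (𝓝 0) := by
  have key : ∀ n, moment2 P (fun ω => (S n).total W lam t s ω - (X ω - x)) ≤
      2 * moment2 P (fun ω => (S n).integral W t s ω - M ω) +
      2 * (((T - t : ℝ≥0) * normSq lam : ℝ≥0) *
        sqIntegral P (fun v ω => (S n).eval v ω - φ v ω) t T) := fun n => by
    have e : (fun ω => (S n).total W lam t s ω - (X ω - x)) =ᵐ[P] fun ω =>
        ((S n).integral W t s ω - M ω) +
        ((∫ v in (t : ℝ)..s, (S n).eval v.toNNReal ω ⬝ᵥ lam) -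
          ∫ v in (t : ℝ)..s, φ v.toNNReal ω ⬝ᵥ lam) := by
      filter_upwards [hX] with ω hω
      rw [(S n).total_eq lam hts, hω]
      ring
    rw [moment2_congr e]
    refine (moment2_add_le
      (((S n).measurable_integral hW.measurable t s).aemeasurable.sub hM)).trans ?_
    exact add_le_add le_rfl (mul_le_mul_right (moment2_drift_le hts hsT hφ (S n)) 2)
  refine tendsto_of_tendsto_of_tendsto_of_le_of_le tendsto_const_nhds ?_
    (fun n => zero_le) key
  have l1 := ENNReal.Tendsto.const_mul (a := 2) hS2 (Or.inr (by simp))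
  have l2 := ENNReal.Tendsto.const_mul (a := 2) (ENNReal.Tendsto.const_mul
    (a := (((T - t : ℝ≥0) * normSq lam : ℝ≥0) : ℝ≥0∞)) hS1 (Or.inr ENNReal.coe_ne_top))
    (Or.inr (by simp))
  have l3 := l1.add l2
  rw [mul_zero, mul_zero, mul_zero, add_zero] at l3
  exact l3

variable {σ : Matrix (Fin N) (Fin N) ℝ} {lam : Fin N → ℝ} {t T : ℝ≥0} {x : ℝ}
  {π : ℝ≥0 → Ω → Fin N → ℝ} {X : ℝ≥0 → Ω → ℝ}

lemma mulVec_dotProduct' (σ : Matrix (Fin N) (Fin N) ℝ) (a lam : Fin N → ℝ) :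
    (σ *ᵥ a) ⬝ᵥ lam = a ⬝ᵥ (σᵀ *ᵥ lam) := by
  rw [dotProduct_comm, dotProduct_mulVec, dotProduct_comm, mulVec_transpose]

/-- The wealth of an admissible strategy is approximated by gains of simple processes. -/
lemma IsAdmissible.exists_simple [IsProbabilityMeasure P]
    (hW : IsStandardBrownianMotion W P) (htT : t ≤ T)
    (h : IsAdmissible P ℱ W σ lam t T x π X) :
    AEMeasurable (X T) P ∧ ∃ S : ℕ → SimpleProcess ℱ N,
      Tendsto (fun n => moment2 P (fun ω => (S n).total W lam t T ω - (X T ω - x)))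
        atTop (𝓝 0) := by
  obtain ⟨M, ⟨hM, S, hS1, hS2⟩, hX⟩ := h.wealth
  have hTT : T ∈ Icc t T := ⟨htT, le_rfl⟩
  have hπ := measurable_stopped_of_isProgressive h.progressive T
  have hint : ∀ᵐ ω ∂P, IntervalIntegrable
      (fun v : ℝ => (σ *ᵥ π v.toNNReal ω) ⬝ᵥ lam) volume t T :=
    (ae_intervalIntegrable_dotProduct htT le_rfl hπ h.sq_integrable (σᵀ *ᵥ lam)).mono
      fun ω hω => hω.congr fun v _ => (mulVec_dotProduct' σ _ lam).symm
  have hmeas : AEMeasurable (X T) P := by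
    have h1 := measurable_intervalIntegral_dotProduct (P := P) htT le_rfl hπ (σᵀ *ᵥ lam)
    refine ((h1.const_add x).aemeasurable.add (hM T hTT)).congr ?_
    filter_upwards [hX T hTT] with ω hω
    rw [hω]
    simp only [mulVec_dotProduct', Pi.add_apply]
  exact ⟨hmeas, S, tendsto_total_sub (φ := fun v ω => σ *ᵥ π v ω) hW htT le_rfl hint
    (hM T hTT) (hX T hTT) hS1 (hS2 T hTT)⟩

lemma IsAdmissible.memLp [IsProbabilityMeasure P]
    (hW : IsStandardBrownianMotion W P) (htT : t ≤ T)
    (h : IsAdmissible P ℱ W σ lam t T x π X) : MemLp (X T) 2 P := by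
  obtain ⟨hm, S, hS⟩ := h.exists_simple hW htT
  -- One approximant at finite `L²` distance is enough, since simple gains are square integrable.
  obtain ⟨n, hn⟩ := (hS.eventually (gt_mem_nhds (ENNReal.zero_lt_top))).exists
  have h1 := memLp_total hW (S n) lam t T
  have h2 := memLp_two_of_moment2_lt_top
    (h1.1.aemeasurable.sub (hm.sub_const x)) hn
  convert (h1.sub h2).add (memLp_const x) using 1
  ext ω
  simp

/-- The budget equation. -/
lemma IsAdmissible.integral_pricing_mul [IsProbabilityMeasure P]
    (hW : IsStandardBrownianMotion W P) (htT : t ≤ T)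
    (h : IsAdmissible P (brownianFiltration W hW.measurable) W σ lam t T x π X) :
    ∫ ω, pricing W lam t T ω * X T ω ∂P = x := by
  obtain ⟨hm, S, hS⟩ := h.exists_simple hW htT
  have hX := h.memLp hW htT
  have hξ := memLp_pricing hW lam htT
  have hXx : MemLp (fun ω => X T ω - x) 2 P := hX.sub (memLp_const x)
  have hD : ∀ n, MemLp (fun ω => (S n).total W lam t T ω - (X T ω - x)) 2 P := fun n =>
    (memLp_total hW (S n) lam t T).sub hXx
  have key : ∀ n, (∫ ω, pricing W lam t T ω * (X T ω - x) ∂P) ^ 2 ≤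
      (∫ ω, pricing W lam t T ω ^ 2 ∂P) *
        ∫ ω, ((S n).total W lam t T ω - (X T ω - x)) ^ 2 ∂P := fun n => by
    have h1 := sq_integral_mul_le hξ (hD n)
    -- Simple gains have price zero, so the price of `X_T - x` is minus that of the approximation
    -- error; Cauchy–Schwarz sends the latter to zero.
    have e : ∫ ω, pricing W lam t T ω * ((S n).total W lam t T ω - (X T ω - x)) ∂P =
        -∫ ω, pricing W lam t T ω * (X T ω - x) ∂P := by
      simp only [mul_sub _ (SimpleProcess.total _ _ _ _ _ _)]
      have i1 : Integrable (fun ω => pricing W lam t T ω * (S n).total W lam t T ω) P :=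
        hξ.integrable_mul (memLp_total hW (S n) lam t T)
      have i2 : Integrable (fun ω => pricing W lam t T ω * (X T ω - x)) P :=
        hξ.integrable_mul hXx
      rw [integral_sub i1 i2, integral_pricing_mul_total hW (S n) lam htT, zero_sub]
    rwa [e, neg_sq] at h1
  have hlim : Tendsto (fun n => ∫ ω, ((S n).total W lam t T ω - (X T ω - x)) ^ 2 ∂P)
      atTop (𝓝 0) := by
    have h0 := (ENNReal.tendsto_toReal ENNReal.zero_ne_top).comp hS
    simp only [ENNReal.toReal_zero] at h0
    refine h0.congr fun n => ?_
    simp only [Function.comp]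
    rw [moment2_eq_ofReal (hD n), ENNReal.toReal_ofReal (integral_nonneg fun _ => sq_nonneg _)]
  have hz := ge_of_tendsto' (hlim.const_mul (∫ ω, pricing W lam t T ω ^ 2 ∂P)) key
  rw [mul_zero] at hz
  have hz' : ∫ ω, pricing W lam t T ω * (X T ω - x) ∂P = 0 :=
    pow_eq_zero_iff (two_ne_zero) |>.1 (le_antisymm hz (sq_nonneg _))
  simp only [mul_sub] at hz'
  have i1 : Integrable (fun ω => pricing W lam t T ω * X T ω) P := hξ.integrable_mul hX
  rw [integral_sub i1 ((hξ.integrable (by norm_num)).mul_const _),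
    integral_mul_const, integral_pricing hW lam htT] at hz'
  linarith

end Admissible

/-! ### Exponential martingales under the pricing measure -/

section Exponential

variable {Ω : Type*} [mΩ : MeasurableSpace Ω] {N : ℕ} {P : Measure Ω}
  {W : Fin N → ℝ≥0 → Ω → ℝ}

/-- The growth rate for which `exp(a λ·W_s + rate s)` is a martingale after pricing. -/
def growthRate (lam : Fin N → ℝ) (a : ℝ) : ℝ := a * normSq lam - a ^ 2 * normSq lam / 2

/-- The value at time `s` of the payoff proportional to `exp(a λ·W)` that is worth `1` at `t`. -/
def expo (W : Fin N → ℝ≥0 → Ω → ℝ) (lam : Fin N → ℝ) (a : ℝ) (t s : ℝ≥0) (ω : Ω) : ℝ :=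
  Real.exp (a * noise W lam t s ω + growthRate lam a * ((s : ℝ) - t))

lemma expo_pos (lam : Fin N → ℝ) (a : ℝ) (t s : ℝ≥0) (ω : Ω) : 0 < expo W lam a t s ω :=
  Real.exp_pos _

lemma expo_self (lam : Fin N → ℝ) (a : ℝ) (t : ℝ≥0) (ω : Ω) : expo W lam a t t ω = 1 := by
  simp [expo, noise_self]

lemma expo_mul (lam : Fin N → ℝ) (a : ℝ) (t s u : ℝ≥0) (ω : Ω) :
    expo W lam a t s ω * expo W lam a s u ω = expo W lam a t u ω := by
  rw [expo, expo, expo, ← Real.exp_add, ← noise_add lam t s u]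
  ring_nf

lemma measurable_expo (hW : ∀ i s, Measurable (W i s)) (lam : Fin N → ℝ) (a : ℝ) (t s : ℝ≥0) :
    Measurable (expo W lam a t s) := by
  have := measurable_noise hW lam t s
  unfold expo
  fun_prop

lemma measurable_expo_filtration (hW : ∀ i s, Measurable (W i s)) (lam : Fin N → ℝ) (a : ℝ)
    {t s u : ℝ≥0} (ht : t ≤ u) (hs : s ≤ u) :
    Measurable[brownianFiltration W hW u] (expo W lam a t s) :=
  Real.measurable_exp.comp
    (((measurable_noise_filtration hW lam ht hs).const_mul a).add measurable_const)

lemma expo_pow (lam : Fin N → ℝ) (a : ℝ) (t s : ℝ≥0) (ω : Ω) (m : ℕ) :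
    expo W lam a t s ω ^ m = Real.exp (m * growthRate lam a * ((s : ℝ) - t)) *
      Real.exp ((m * a) * noise W lam t s ω) := by
  rw [expo, ← Real.exp_nat_mul, ← Real.exp_add]
  ring_nf

variable [IsProbabilityMeasure P]

lemma integrable_expo_pow (hW : IsStandardBrownianMotion W P) (lam : Fin N → ℝ) (a : ℝ)
    {t s : ℝ≥0} (h : t ≤ s) (m : ℕ) : Integrable (fun ω => expo W lam a t s ω ^ m) P := by
  simp only [expo_pow]
  exact (integrable_exp_mul_noise hW lam h _).const_mul _

lemma integral_expo_pow (hW : IsStandardBrownianMotion W P) (lam : Fin N → ℝ) (a : ℝ)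
    {t s : ℝ≥0} (h : t ≤ s) (m : ℕ) : ∫ ω, expo W lam a t s ω ^ m ∂P =
      Real.exp ((m * growthRate lam a + m ^ 2 * a ^ 2 * normSq lam / 2) * ((s : ℝ) - t)) := by
  simp only [expo_pow]
  rw [integral_const_mul, integral_exp_mul_noise hW lam h, ← Real.exp_add, NNReal.coe_sub h]
  ring_nf

lemma memLp_expo (hW : IsStandardBrownianMotion W P) (lam : Fin N → ℝ) (a : ℝ)
    {t s : ℝ≥0} (h : t ≤ s) : MemLp (expo W lam a t s) 2 P :=
  (memLp_two_iff_integrable_sq (measurable_expo hW.measurable lam a t s).aestronglyMeasurable).2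
    (integrable_expo_pow hW lam a h 2)

lemma exists_bound_integral_expo_pow (hW : IsStandardBrownianMotion W P) (lam : Fin N → ℝ) (a : ℝ)
    (t T : ℝ≥0) (m : ℕ) :
    ∃ C, 0 ≤ C ∧ ∀ s ∈ Icc t T, ∫ ω, expo W lam a t s ω ^ m ∂P ≤ C := by
  refine ⟨Real.exp (|m * growthRate lam a + m ^ 2 * a ^ 2 * normSq lam / 2| * ((T : ℝ) - t)),
    (Real.exp_pos _).le, fun s hs => ?_⟩
  rw [integral_expo_pow hW lam a hs.1]
  have h1 : (t : ℝ) ≤ s := by exact_mod_cast hs.1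
  have h2 : (s : ℝ) ≤ T := by exact_mod_cast hs.2
  refine Real.exp_le_exp.2 ((mul_le_mul_of_nonneg_right (le_abs_self _) (by linarith)).trans ?_)
  gcongr

lemma memLp_noise (hW : IsStandardBrownianMotion W P) (lam : Fin N → ℝ) (t s : ℝ≥0) :
    MemLp (noise W lam t s) 2 P :=
  memLp_finsetSum _ fun j _ => (memLp_increment hW t s j).const_mul _

lemma integral_noise (hW : IsStandardBrownianMotion W P) (lam : Fin N → ℝ)
    {t s : ℝ≥0} (h : t ≤ s) : ∫ ω, noise W lam t s ω ∂P = 0 := by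
  rw [integral_comp_noise hW lam h (f := fun x => x) measurable_id, integral_id_gaussianReal]

lemma integral_noise_sq (hW : IsStandardBrownianMotion W P) (lam : Fin N → ℝ)
    {t s : ℝ≥0} (h : t ≤ s) :
    ∫ ω, noise W lam t s ω ^ 2 ∂P = normSq lam * ((s : ℝ) - t) := by
  rw [integral_comp_noise hW lam h (f := fun x => x ^ 2) (by fun_prop), integral_sq_gaussianReal,
    NNReal.coe_mul, NNReal.coe_sub h]

lemma integral_expo_mul_noise (hW : IsStandardBrownianMotion W P) (lam : Fin N → ℝ) (a : ℝ)
    {t s : ℝ≥0} (h : t ≤ s) : ∫ ω, expo W lam a t s ω * noise W lam t s ω ∂P =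
      a * normSq lam * ((s : ℝ) - t) * Real.exp (a * normSq lam * ((s : ℝ) - t)) := by
  have e : ∀ ω, expo W lam a t s ω * noise W lam t s ω =
      Real.exp (growthRate lam a * ((s : ℝ) - t)) *
        (noise W lam t s ω * Real.exp (a * noise W lam t s ω)) := fun ω => by
    rw [expo, Real.exp_add]
    ring
  simp only [e]
  rw [integral_const_mul, integral_comp_noise hW lam h (f := fun x => x * Real.exp (a * x))
    (by fun_prop), integral_mul_exp_gaussianReal, NNReal.coe_mul, NNReal.coe_sub h,
    mul_left_comm, ← Real.exp_add, growthRate]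
  ring_nf

/-- The error in the linearization of an exponential increment. -/
def expoError (W : Fin N → ℝ≥0 → Ω → ℝ) (lam : Fin N → ℝ) (a : ℝ) (t s : ℝ≥0) (ω : Ω) : ℝ :=
  expo W lam a t s ω - 1 - a * (noise W lam t s ω + normSq lam * ((s : ℝ) - t))

lemma memLp_expoError (hW : IsStandardBrownianMotion W P) (lam : Fin N → ℝ) (a : ℝ)
    {t s : ℝ≥0} (h : t ≤ s) : MemLp (expoError W lam a t s) 2 P :=
  ((memLp_expo hW lam a h).sub (memLp_const 1)).sub
    (((memLp_noise hW lam t s).add (memLp_const _)).const_mul a)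

lemma integral_expo (hW : IsStandardBrownianMotion W P) (lam : Fin N → ℝ) (a : ℝ)
    {t s : ℝ≥0} (h : t ≤ s) : ∫ ω, expo W lam a t s ω ∂P =
      Real.exp (a * normSq lam * ((s : ℝ) - t)) := by
  have h1 := integral_expo_pow hW lam a h 1
  simp only [pow_one] at h1
  rw [h1, growthRate]
  congr 1
  push_cast
  ring

lemma integral_expo_sq (hW : IsStandardBrownianMotion W P) (lam : Fin N → ℝ) (a : ℝ)
    {t s : ℝ≥0} (h : t ≤ s) : ∫ ω, expo W lam a t s ω ^ 2 ∂P =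
      Real.exp ((a ^ 2 + 2 * a) * normSq lam * ((s : ℝ) - t)) := by
  rw [integral_expo_pow hW lam a h 2, growthRate]
  congr 1
  push_cast
  ring

lemma integral_expoError (hW : IsStandardBrownianMotion W P) (lam : Fin N → ℝ) (a : ℝ)
    {t s : ℝ≥0} (h : t ≤ s) : ∫ ω, expoError W lam a t s ω ∂P =
      Real.exp (a * normSq lam * ((s : ℝ) - t)) - 1 - a * normSq lam * ((s : ℝ) - t) := by
  have i1 := (memLp_expo hW lam a h).integrable (by norm_num)
  have i2 := (memLp_noise hW lam t s).integrable (by norm_num)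
  have e : ∀ ω, expoError W lam a t s ω = expo W lam a t s ω + (-a) * noise W lam t s ω +
      (-1 - a * (normSq lam * ((s : ℝ) - t))) := fun ω => by
    simp only [expoError]
    ring
  simp only [e]
  rw [integral_add (i1.fun_add (i2.const_mul _)) (integrable_const _),
    integral_add i1 (i2.const_mul _), integral_const_mul, integral_expo hW lam a h,
    integral_noise hW lam h]
  simp
  ring

lemma integral_expoError_sq (hW : IsStandardBrownianMotion W P) (lam : Fin N → ℝ) (a : ℝ)
    {t s : ℝ≥0} (h : t ≤ s) : ∫ ω, expoError W lam a t s ω ^ 2 ∂P =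
      (Real.exp ((a ^ 2 + 2 * a) * normSq lam * ((s : ℝ) - t)) - 1 -
        (a ^ 2 + 2 * a) * normSq lam * ((s : ℝ) - t)) -
      2 * (Real.exp (a * normSq lam * ((s : ℝ) - t)) - 1 - a * normSq lam * ((s : ℝ) - t)) -
      2 * a * (a + 1) * normSq lam * ((s : ℝ) - t) *
        (Real.exp (a * normSq lam * ((s : ℝ) - t)) - 1) +
      (a * normSq lam * ((s : ℝ) - t)) ^ 2 := by
  set D := (normSq lam : ℝ) * ((s : ℝ) - t) with hD
  have m1 := memLp_expo hW lam a h
  have m2 := memLp_noise hW lam t s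
  have i1 := m1.integrable (by norm_num)
  have i2 := m2.integrable (by norm_num)
  have i3 : Integrable (fun ω => expo W lam a t s ω ^ 2) P := m1.integrable_sq
  have i4 : Integrable (fun ω => noise W lam t s ω ^ 2) P := m2.integrable_sq
  have i5 : Integrable (fun ω => expo W lam a t s ω * noise W lam t s ω) P := m1.integrable_mul m2
  have e : ∀ ω, expoError W lam a t s ω ^ 2 = expo W lam a t s ω ^ 2
      + a ^ 2 * noise W lam t s ω ^ 2 + (-2 * a) * (expo W lam a t s ω * noise W lam t s ω)
      + (-2 - 2 * a * D) * expo W lam a t s ω + (2 * a ^ 2 * D + 2 * a) * noise W lam t s ω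
      + (1 + a * D) ^ 2 := fun ω => by
    simp only [expoError, ← hD]
    ring
  simp only [e]
  rw [integral_add ((((i3.fun_add (i4.const_mul _)).fun_add (i5.const_mul _)).fun_add (i1.const_mul _)).fun_add
      (i2.const_mul _)) (integrable_const _),
    integral_add (((i3.fun_add (i4.const_mul _)).fun_add (i5.const_mul _)).fun_add (i1.const_mul _))
      (i2.const_mul _),
    integral_add ((i3.fun_add (i4.const_mul _)).fun_add (i5.const_mul _)) (i1.const_mul _),
    integral_add (i3.fun_add (i4.const_mul _)) (i5.const_mul _),
    integral_add i3 (i4.const_mul _)]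
  simp only [integral_const_mul, integral_const]
  rw [integral_expo_sq hW lam a h, integral_noise_sq hW lam h, integral_expo_mul_noise hW lam a h,
    integral_expo hW lam a h, integral_noise hW lam h]
  simp only [mul_assoc, ← hD, probReal_univ, smul_eq_mul]
  ring

lemma integral_sq_expo_sub_one (hW : IsStandardBrownianMotion W P) (lam : Fin N → ℝ) (a : ℝ)
    {t s : ℝ≥0} (h : t ≤ s) : ∫ ω, (expo W lam a t s ω - 1) ^ 2 ∂P =
      (Real.exp ((a ^ 2 + 2 * a) * normSq lam * ((s : ℝ) - t)) - 1) -
      2 * (Real.exp (a * normSq lam * ((s : ℝ) - t)) - 1) := by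
  have m1 := memLp_expo hW lam a h
  have i1 := m1.integrable (by norm_num)
  have i3 : Integrable (fun ω => expo W lam a t s ω ^ 2) P := m1.integrable_sq
  have e : ∀ ω, (expo W lam a t s ω - 1) ^ 2 = expo W lam a t s ω ^ 2
      + (-2) * expo W lam a t s ω + 1 := fun ω => by ring
  simp only [e]
  rw [integral_add (i3.fun_add (i1.const_mul _)) (integrable_const _), integral_add i3 (i1.const_mul _),
    integral_const_mul, integral_expo_sq hW lam a h, integral_expo hW lam a h]
  simp
  ring

/-- Quadratic bounds for the errors over short time intervals. -/
lemma exists_bound_expoError (hW : IsStandardBrownianMotion W P) (lam : Fin N → ℝ) (a : ℝ) :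
    ∃ Q δ : ℝ, 0 ≤ Q ∧ 0 < δ ∧ ∀ t s : ℝ≥0, t ≤ s → (s : ℝ) - t ≤ δ →
      |∫ ω, expoError W lam a t s ω ∂P| ≤ Q * ((s : ℝ) - t) ^ 2 ∧
      ∫ ω, expoError W lam a t s ω ^ 2 ∂P ≤ Q * ((s : ℝ) - t) ^ 2 ∧
      ∫ ω, (expo W lam a t s ω - 1) ^ 2 ∂P ≤ Q * ((s : ℝ) - t) := by
  set θ : ℝ := (normSq lam : ℝ)
  have hθ : 0 ≤ θ := NNReal.coe_nonneg _
  -- A single constant dominating `|a|θ`, `|a² + 2a|θ` and `|2a(a+1)|θ`. For `Δ ≤ 1/R` the exponents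
  -- are at most `1` in modulus, as the estimates of `e^x - 1` and `e^x - 1 - x` require.
  set R : ℝ := 2 * (|a| + 1) ^ 2 * (θ + 1) with hR
  have ha := abs_nonneg a
  have hR1 : 1 ≤ R := by rw [hR]; nlinarith [mul_nonneg ha hθ, mul_nonneg ha (mul_nonneg ha hθ)]
  refine ⟨6 * R ^ 2, 1 / R, by positivity, by positivity, fun t s hts hδ => ?_⟩
  have hΔ : 0 ≤ (s : ℝ) - t := sub_nonneg.2 (by exact_mod_cast hts)
  set Δ := (s : ℝ) - t
  have hr1 : R * Δ ≤ 1 := by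
    rw [le_div_iff₀ (by positivity)] at hδ
    linarith
  have hr0 : 0 ≤ R * Δ := by positivity
  have q1 : |a * θ * Δ| ≤ R * Δ := by
    rw [abs_mul, abs_mul, abs_of_nonneg hθ, abs_of_nonneg hΔ]
    refine mul_le_mul_of_nonneg_right ?_ hΔ
    rw [hR]; nlinarith [mul_nonneg ha hθ, mul_nonneg ha (mul_nonneg ha hθ)]
  have p1 : |(a ^ 2 + 2 * a) * θ * Δ| ≤ R * Δ := by
    rw [abs_mul, abs_mul, abs_of_nonneg hθ, abs_of_nonneg hΔ]
    refine mul_le_mul_of_nonneg_right ?_ hΔ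
    have h1 : |a ^ 2 + 2 * a| ≤ |a| ^ 2 + 2 * |a| := by
      refine (abs_add_le _ _).trans (by rw [abs_pow, abs_mul, abs_two])
    refine (mul_le_mul_of_nonneg_right h1 hθ).trans ?_
    rw [hR]; nlinarith [mul_nonneg ha hθ, mul_nonneg ha (mul_nonneg ha hθ)]
  have w1 : |2 * a * (a + 1) * θ * Δ| ≤ R * Δ := by
    rw [abs_mul, abs_mul, abs_mul, abs_mul, abs_two, abs_of_nonneg hθ, abs_of_nonneg hΔ]
    refine mul_le_mul_of_nonneg_right ?_ hΔ
    have h1 : |a + 1| ≤ |a| + 1 := (abs_add_le _ _).trans (by rw [abs_one])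
    have h2 : 2 * |a| * |a + 1| ≤ 2 * |a| * (|a| + 1) := by gcongr
    refine (mul_le_mul_of_nonneg_right h2 hθ).trans ?_
    rw [hR]; nlinarith [mul_nonneg ha hθ, mul_nonneg ha (mul_nonneg ha hθ)]
  have sq_le : ∀ {x : ℝ}, |x| ≤ R * Δ → x ^ 2 ≤ (R * Δ) ^ 2 := fun {x} hx => by
    rw [← sq_abs]; gcongr
  have hq := Real.abs_exp_sub_one_sub_id_le (q1.trans hr1)
  have hp := Real.abs_exp_sub_one_sub_id_le (p1.trans hr1)
  have hq' := Real.abs_exp_sub_one_le (q1.trans hr1)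
  have hp' := Real.abs_exp_sub_one_le (p1.trans hr1)
  have sq := sq_le q1
  have sp := sq_le p1
  refine ⟨?_, ?_, ?_⟩
  · rw [integral_expoError hW lam a hts]
    refine hq.trans (sq.trans ?_)
    rw [show 6 * R ^ 2 * Δ ^ 2 = 6 * (R * Δ) ^ 2 by ring]
    linarith [sq_nonneg (R * Δ)]
  · rw [integral_expoError_sq hW lam a hts]
    have hw : |2 * a * (a + 1) * θ * Δ * (Real.exp (a * θ * Δ) - 1)| ≤ R * Δ * (2 * (R * Δ)) := by
      rw [abs_mul]
      refine mul_le_mul w1 (hq'.trans ?_) (abs_nonneg _) hr0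
      gcongr
    have e1 := (abs_le.1 hp).2
    have e2 := (abs_le.1 hq).1
    have e3 := (abs_le.1 hw).1
    -- The four terms contribute `1 + 2 + 2 + 1 = 6` multiples of `(RΔ)²`.
    rw [show 6 * R ^ 2 * Δ ^ 2 = 6 * (R * Δ) ^ 2 by ring]
    have e4 : R * Δ * (2 * (R * Δ)) = 2 * (R * Δ) ^ 2 := by ring
    linarith
  · rw [integral_sq_expo_sub_one hW lam a hts]
    have e1 := (abs_le.1 hp').2
    have e2 := (abs_le.1 hq').1
    have : 6 * (R * Δ) ≤ 6 * R ^ 2 * Δ := by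
      rw [show 6 * R ^ 2 * Δ = R * (6 * (R * Δ)) by ring]
      exact le_mul_of_one_le_left (by positivity) hR1
    linarith

end Exponential

/-! ### Riemann sums for the stochastic integrals of exponentials -/

section RiemannSums

variable {Ω : Type*} [mΩ : MeasurableSpace Ω] {N : ℕ} {P : Measure Ω}
  {W : Fin N → ℝ≥0 → Ω → ℝ}

lemma measurable_increment_filtration (hW : ∀ i s, Measurable (W i s)) {s s' : ℝ≥0} (h : s ≤ s') :
    Measurable[brownianFiltration W hW s'] (increment W s s') :=
  @measurable_pi_lambda _ _ _ (brownianFiltration W hW s') _ _ fun j =>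
    (measurable_brownianFiltration hW le_rfl j).sub (measurable_brownianFiltration hW h j)

variable [IsProbabilityMeasure P]

lemma IndepFun.memLp_two_mul {X Y : Ω → ℝ} (h : IndepFun X Y P) (hX : MemLp X 2 P)
    (hY : MemLp Y 2 P) :
    MemLp (fun ω => X ω * Y ω) 2 P ∧
      ∫ ω, (X ω * Y ω) ^ 2 ∂P = (∫ ω, X ω ^ 2 ∂P) * ∫ ω, Y ω ^ 2 ∂P := by
  have h2 : IndepFun (fun ω => X ω ^ 2) (fun ω => Y ω ^ 2) P :=
    h.comp (φ := fun x => x ^ 2) (ψ := fun x => x ^ 2) (by fun_prop) (by fun_prop)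
  constructor
  · refine (memLp_two_iff_integrable_sq (hX.1.mul hY.1)).2 ?_
    simp only [Pi.mul_apply, mul_pow]
    exact h2.integrable_mul hX.integrable_sq hY.integrable_sq
  · simp only [mul_pow]
    exact h2.integral_fun_mul_eq_mul_integral hX.integrable_sq.1 hY.integrable_sq.1

/-- Second moments of martingale transforms. -/
lemma integral_sq_transform_le (hW : IsStandardBrownianMotion W P) {τ : ℕ → ℝ≥0} (hτ : Monotone τ)
    {Y : ℕ → Ω → ℝ} (hYm : ∀ k, Measurable[brownianFiltration W hW.measurable (τ k)] (Y k))
    (hYL : ∀ k, MemLp (Y k) 2 P) {f : ℕ → (Fin N → ℝ) → ℝ} (hf : ∀ k, Measurable (f k))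
    (hfL : ∀ k, MemLp (fun ω => f k (increment W (τ k) (τ (k + 1)) ω)) 2 P)
    (h0 : ∀ k, ∫ ω, f k (increment W (τ k) (τ (k + 1)) ω) ∂P = 0)
    {A : ℝ} {B : ℕ → ℝ} (hA : ∀ k, ∫ ω, Y k ω ^ 2 ∂P ≤ A)
    (hB : ∀ k, ∫ ω, f k (increment W (τ k) (τ (k + 1)) ω) ^ 2 ∂P ≤ B k) (n : ℕ) :
    Measurable[brownianFiltration W hW.measurable (τ n)] (fun ω => ∑ k ∈ Finset.range n,
      Y k ω * f k (increment W (τ k) (τ (k + 1)) ω)) ∧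
    MemLp (fun ω => ∑ k ∈ Finset.range n, Y k ω * f k (increment W (τ k) (τ (k + 1)) ω)) 2 P ∧
    ∫ ω, (∑ k ∈ Finset.range n, Y k ω * f k (increment W (τ k) (τ (k + 1)) ω)) ^ 2 ∂P ≤
      A * ∑ k ∈ Finset.range n, B k := by
  induction n with
  | zero => simp
  | succ n ih =>
    obtain ⟨ih1, ih2, ih3⟩ := ih
    simp only [Finset.sum_range_succ]
    set 𝓕 := brownianFiltration W hW.measurable with h𝓕
    set Z : Ω → ℝ := fun ω => ∑ k ∈ Finset.range n, Y k ω * f k (increment W (τ k) (τ (k + 1)) ω)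
    set η : Ω → ℝ := fun ω => f n (increment W (τ n) (τ (n + 1)) ω) with hη
    have hle : τ n ≤ τ (n + 1) := hτ (Nat.le_succ n)
    have hηm : Measurable[𝓕 (τ (n + 1))] η :=
      (hf n).comp (measurable_increment_filtration hW.measurable hle)
    obtain ⟨p1, p2⟩ := IndepFun.memLp_two_mul (indepFun_increment hW hle (hYm n) (hf n))
      (hYL n) (hfL n)
    have hZY : Measurable[𝓕 (τ n)] fun ω => Z ω * Y n ω := ih1.mul (hYm n)
    have i1 := indepFun_increment hW hle hZY (hf n)
    -- Orthogonality of martingale increments: the new increment is centred and independent of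
    -- everything known at `τ n`.
    have hc : ∫ ω, Z ω * (Y n ω * η ω) ∂P = 0 := by
      have h1 := i1.integral_fun_mul_eq_mul_integral
        (hZY.mono (𝓕.le _) le_rfl).aestronglyMeasurable (hfL n).1
      simp only [← mul_assoc]
      refine h1.trans ?_
      rw [h0 n, mul_zero]
    refine ⟨?_, ih2.add p1, ?_⟩
    · exact (ih1.mono (𝓕.mono hle) le_rfl).add (((hYm n).mono (𝓕.mono hle) le_rfl).mul hηm)
    · have e : ∀ ω, (Z ω + Y n ω * η ω) ^ 2 =
          Z ω ^ 2 + 2 * (Z ω * (Y n ω * η ω)) + (Y n ω * η ω) ^ 2 := fun ω => by ring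
      have j1 : Integrable (fun ω => Z ω ^ 2) P := ih2.integrable_sq
      have j2 : Integrable (fun ω => Z ω * (Y n ω * η ω)) P := ih2.integrable_mul p1
      have j3 : Integrable (fun ω => (Y n ω * η ω) ^ 2) P := p1.integrable_sq
      have hsum : ∫ ω, (Z ω + Y n ω * η ω) ^ 2 ∂P =
          ∫ ω, Z ω ^ 2 ∂P + ∫ ω, (Y n ω * η ω) ^ 2 ∂P := by
        simp only [e]
        rw [integral_add (j1.fun_add (j2.const_mul _)) j3, integral_add j1 (j2.const_mul _),
          integral_const_mul, hc, mul_zero, add_zero]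
      rw [hsum, mul_add]
      refine add_le_add ih3 (p2.le.trans ?_)
      exact mul_le_mul (hA n) (hB n) (integral_nonneg fun _ => sq_nonneg _)
        ((integral_nonneg fun _ => sq_nonneg _).trans (hA n))

/-- Each factor is split into its mean and a centred part. The centred parts form an orthogonal sum,
with variance at most the second moment, giving `n * B`; the means are summed by Cauchy–Schwarz,
giving `(n * b)²`. The outer factor is from `(x + y)² ≤ 2x² + 2y²`. -/
lemma integral_sq_transform_le' (hW : IsStandardBrownianMotion W P) {τ : ℕ → ℝ≥0}
    (hτ : Monotone τ) {Y : ℕ → Ω → ℝ}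
    (hYm : ∀ k, Measurable[brownianFiltration W hW.measurable (τ k)] (Y k))
    (hYL : ∀ k, MemLp (Y k) 2 P) {f : ℕ → (Fin N → ℝ) → ℝ} (hf : ∀ k, Measurable (f k))
    (hfL : ∀ k, MemLp (fun ω => f k (increment W (τ k) (τ (k + 1)) ω)) 2 P)
    {A B b : ℝ} (hA : ∀ k, ∫ ω, Y k ω ^ 2 ∂P ≤ A)
    (hB : ∀ k, ∫ ω, f k (increment W (τ k) (τ (k + 1)) ω) ^ 2 ∂P ≤ B)
    (hb : ∀ k, |∫ ω, f k (increment W (τ k) (τ (k + 1)) ω) ∂P| ≤ b) (n : ℕ) :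
    MemLp (fun ω => ∑ k ∈ Finset.range n, Y k ω * f k (increment W (τ k) (τ (k + 1)) ω)) 2 P ∧
    ∫ ω, (∑ k ∈ Finset.range n, Y k ω * f k (increment W (τ k) (τ (k + 1)) ω)) ^ 2 ∂P ≤
      2 * A * (n * B + (n * b) ^ 2) := by
  set m : ℕ → ℝ := fun k => ∫ ω, f k (increment W (τ k) (τ (k + 1)) ω) ∂P with hm
  have hA0 : 0 ≤ A := (integral_nonneg fun _ => sq_nonneg _).trans (hA 0)
  have hcL : ∀ k, MemLp (fun ω => f k (increment W (τ k) (τ (k + 1)) ω) - m k) 2 P := fun k =>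
    (hfL k).sub (memLp_const _)
  have hi : ∀ k, Integrable (fun ω => f k (increment W (τ k) (τ (k + 1)) ω)) P := fun k =>
    (hfL k).integrable (by norm_num)
  obtain ⟨-, h1, h2⟩ := integral_sq_transform_le hW hτ hYm hYL (f := fun k x => f k x - m k)
    (fun k => (hf k).sub_const _) hcL (fun k => by
      rw [integral_sub (hi k) (integrable_const _)]; simp [hm]) (B := fun _ => B) hA (fun k => by
      have e : ∀ ω, (f k (increment W (τ k) (τ (k + 1)) ω) - m k) ^ 2 =
          f k (increment W (τ k) (τ (k + 1)) ω) ^ 2 +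
          (-2 * m k) * f k (increment W (τ k) (τ (k + 1)) ω) + m k ^ 2 := fun ω => by ring
      simp only [e]
      rw [integral_add ((hfL k).integrable_sq.fun_add ((hi k).const_mul _)) (integrable_const _),
        integral_add (hfL k).integrable_sq ((hi k).const_mul _), integral_const_mul]
      have := hB k
      have h3 : ∫ ω, f k (increment W (τ k) (τ (k + 1)) ω) ∂P = m k := rfl
      rw [h3]
      simp only [integral_const, probReal_univ, one_smul]
      nlinarith [sq_nonneg (m k)]) n
  have h3 : MemLp (fun ω => ∑ k ∈ Finset.range n, m k * Y k ω) 2 P :=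
    memLp_finsetSum _ fun k _ => (hYL k).const_mul _
  have h4 : ∫ ω, (∑ k ∈ Finset.range n, m k * Y k ω) ^ 2 ∂P ≤ A * (n * b) ^ 2 := by
    have i1 : ∀ k, Integrable (fun ω => (m k * Y k ω) ^ 2) P := fun k =>
      ((hYL k).const_mul (m k)).integrable_sq
    calc ∫ ω, (∑ k ∈ Finset.range n, m k * Y k ω) ^ 2 ∂P
        ≤ ∫ ω, n * ∑ k ∈ Finset.range n, (m k * Y k ω) ^ 2 ∂P := by
          refine integral_mono h3.integrable_sq
            ((integrable_finsetSum _ fun k _ => i1 k).const_mul _) fun ω => ?_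
          simpa using sq_sum_le_card_mul_sum_sq (s := Finset.range n) (f := fun k => m k * Y k ω)
      _ = n * ∑ k ∈ Finset.range n, m k ^ 2 * ∫ ω, Y k ω ^ 2 ∂P := by
          rw [integral_const_mul, integral_finsetSum _ fun k _ => i1 k]
          simp only [mul_pow, integral_const_mul]
      _ ≤ n * ∑ k ∈ Finset.range n, b ^ 2 * A := by
          refine mul_le_mul_of_nonneg_left (Finset.sum_le_sum fun k _ => ?_) n.cast_nonneg
          refine mul_le_mul ?_ (hA k) (integral_nonneg fun _ => sq_nonneg _) (sq_nonneg b)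
          rw [← sq_abs]
          exact pow_le_pow_left₀ (abs_nonneg _) (hb k) 2
      _ = A * (n * b) ^ 2 := by
          rw [Finset.sum_const, Finset.card_range, nsmul_eq_mul]; ring
  have e : ∀ ω, ∑ k ∈ Finset.range n, Y k ω * f k (increment W (τ k) (τ (k + 1)) ω) =
      (∑ k ∈ Finset.range n, Y k ω * (f k (increment W (τ k) (τ (k + 1)) ω) - m k)) +
      ∑ k ∈ Finset.range n, m k * Y k ω := fun ω => by
    rw [← Finset.sum_add_distrib]
    refine Finset.sum_congr rfl fun k _ => by ring
  simp only [e]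
  refine ⟨h1.add h3, ?_⟩
  refine (integral_mono (h1.add h3).integrable_sq
    ((h1.integrable_sq.const_mul 2).fun_add (h3.integrable_sq.const_mul 2)) fun ω => ?_).trans ?_
  · simp only [Pi.add_apply]
    exact (add_sq_le (a := _) (b := _)).trans_eq (by ring)
  · rw [integral_add (h1.integrable_sq.const_mul 2) (h3.integrable_sq.const_mul 2),
      integral_const_mul, integral_const_mul]
    rw [Finset.sum_const, Finset.card_range, nsmul_eq_mul] at h2
    linarith

/-- The uniform grid of `[t, T]` with `n + 1` steps. -/
def grid (t T : ℝ≥0) (n k : ℕ) : ℝ≥0 := t + k * ((T - t) / (n + 1))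

lemma grid_mono (t T : ℝ≥0) (n : ℕ) : Monotone (grid t T n) := fun _ _ h => by
  unfold grid
  gcongr

lemma grid_zero (t T : ℝ≥0) (n : ℕ) : grid t T n 0 = t := by simp [grid]

lemma le_grid (t T : ℝ≥0) (n k : ℕ) : t ≤ grid t T n k := le_self_add

lemma grid_last {t T : ℝ≥0} (h : t ≤ T) (n : ℕ) : grid t T n (n + 1) = T := by
  rw [grid]
  push_cast
  rw [mul_div_cancel₀ _ (by positivity), add_tsub_cancel_of_le h]

lemma grid_succ (t T : ℝ≥0) (n k : ℕ) :
    grid t T n (k + 1) = grid t T n k + (T - t) / (n + 1) := by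
  rw [grid, grid]
  push_cast
  ring

lemma clamp_add_le (t s u h : ℝ≥0) : clamp t s (u + h) ≤ clamp t s u + h := by
  unfold clamp
  refine max_le (le_add_right (le_max_left _ _)) ?_
  rcases le_total u s with hu | hu
  · refine (min_le_left _ _).trans (add_le_add_left ?_ h)
    rw [min_eq_left hu]
    exact le_max_right _ _
  · refine (min_le_right _ _).trans (le_add_right ?_)
    rw [min_eq_right hu]
    exact le_max_right _ _

/-- The clamped grid. -/
def cgrid (t T s : ℝ≥0) (n k : ℕ) : ℝ≥0 := clamp t s (grid t T n k)

lemma cgrid_mono (t T s : ℝ≥0) (n : ℕ) : Monotone (cgrid t T s n) :=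
  (clamp_mono t s).comp (grid_mono t T n)

lemma cgrid_step (t T s : ℝ≥0) (n k : ℕ) :
    (cgrid t T s n (k + 1) : ℝ) - cgrid t T s n k ≤ (T - t : ℝ≥0) / (n + 1) := by
  have h : cgrid t T s n (k + 1) ≤ cgrid t T s n k + (T - t) / (n + 1) := by
    rw [cgrid, grid_succ]
    exact clamp_add_le _ _ _ _
  have h' : (cgrid t T s n (k + 1) : ℝ) ≤ ((cgrid t T s n k + (T - t) / (n + 1) : ℝ≥0) : ℝ) := by
    exact_mod_cast h
  push_cast at h' ⊢
  linarith

/-- The drifted increment of `λ · W`. -/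
def gain (W : Fin N → ℝ≥0 → Ω → ℝ) (lam : Fin N → ℝ) (s s' : ℝ≥0) (ω : Ω) : ℝ :=
  noise W lam s s' ω + normSq lam * ((s' : ℝ) - s)

/-- Truncation matters only for `x > m`, where `x - m ≤ x²/m`. Fourth moments therefore control the
mean square truncation error. -/
lemma sq_sub_min_le {x m : ℝ} (hx : 0 ≤ x) (hm : 0 < m) : (min x m - x) ^ 2 ≤ x ^ 4 / m ^ 2 := by
  rcases le_total x m with h | h
  · rw [min_eq_left h, sub_self, zero_pow two_ne_zero]; positivity
  · rw [min_eq_right h, le_div_iff₀ (by positivity)]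
    have h1 : (x - m) * m ≤ x ^ 2 := by nlinarith
    have h2 : 0 ≤ (x - m) * m := mul_nonneg (by linarith) hm.le
    nlinarith [mul_self_le_mul_self h2 h1]

lemma memLp_min_expo (hW : IsStandardBrownianMotion W P) (lam : Fin N → ℝ) (a : ℝ)
    {t s : ℝ≥0} (h : t ≤ s) {m : ℝ} (hm : 0 < m) :
    MemLp (fun ω => min (expo W lam a t s ω) m) 2 P := by
  have hme := measurable_expo hW.measurable lam a t s
  refine (memLp_expo hW lam a h).mono (hme.min measurable_const).aestronglyMeasurable
    (Eventually.of_forall fun ω => ?_)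
  have h0 := expo_pos (W := W) lam a t s ω
  rw [Real.norm_of_nonneg h0.le, Real.norm_of_nonneg (le_min h0.le hm.le)]
  exact min_le_left _ _

lemma integral_sq_truncation_le (hW : IsStandardBrownianMotion W P) (lam : Fin N → ℝ) (a : ℝ)
    {t s : ℝ≥0} (h : t ≤ s) {m : ℝ} (hm : 0 < m) :
    ∫ ω, (min (expo W lam a t s ω) m - expo W lam a t s ω) ^ 2 ∂P ≤
      (∫ ω, expo W lam a t s ω ^ 4 ∂P) / m ^ 2 := by
  rw [← integral_div]
  exact integral_mono ((memLp_min_expo hW lam a h hm).sub (memLp_expo hW lam a h)).integrable_sq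
    ((integrable_expo_pow hW lam a h 4).div_const _)
    fun ω => sq_sub_min_le (expo_pos lam a t s ω).le hm

lemma memLp_gainIncrement (hW : IsStandardBrownianMotion W P) (lam : Fin N → ℝ) (s s' : ℝ≥0) :
    MemLp (gain W lam s s') 2 P := (memLp_noise hW lam s s').add (memLp_const _)

lemma integral_gain (hW : IsStandardBrownianMotion W P) (lam : Fin N → ℝ) {s s' : ℝ≥0}
    (h : s ≤ s') : ∫ ω, gain W lam s s' ω ∂P = normSq lam * ((s' : ℝ) - s) := by
  simp only [gain]
  rw [integral_add ((memLp_noise hW lam s s').integrable (by norm_num)) (integrable_const _),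
    integral_noise hW lam h]
  simp

lemma integral_gain_sq (hW : IsStandardBrownianMotion W P) (lam : Fin N → ℝ) {s s' : ℝ≥0}
    (h : s ≤ s') : ∫ ω, gain W lam s s' ω ^ 2 ∂P =
      normSq lam * ((s' : ℝ) - s) + (normSq lam * ((s' : ℝ) - s)) ^ 2 := by
  set D := normSq lam * ((s' : ℝ) - s) with hD
  have e : ∀ ω, gain W lam s s' ω ^ 2 = noise W lam s s' ω ^ 2 + 2 * D * noise W lam s s' ω
      + D ^ 2 := fun ω => by
    simp only [gain, ← hD]
    ring
  have m1 := memLp_noise hW lam s s'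
  have i1 := m1.integrable (by norm_num)
  simp only [e]
  rw [integral_add (m1.integrable_sq.fun_add (i1.const_mul _)) (integrable_const _),
    integral_add m1.integrable_sq (i1.const_mul _), integral_const_mul, integral_noise hW lam h,
    integral_noise_sq hW lam h]
  simp [hD]

/-- The error of the truncated Riemann sum for an exponential. -/
def riemannError (W : Fin N → ℝ≥0 → Ω → ℝ) (lam : Fin N → ℝ) (a : ℝ) (t T s : ℝ≥0) (n : ℕ)
    (ω : Ω) : ℝ :=
  (∑ k ∈ Finset.range (n + 1), a * min (expo W lam a t (cgrid t T s n k) ω) (n + 1) *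
    gain W lam (cgrid t T s n k) (cgrid t T s n (k + 1)) ω) - (expo W lam a t s ω - 1)

/-- The exponential minus `1` telescopes along the grid, and each step is linearised. What remains
is a truncation error minus a linearisation error, both sums of the type bounded in
`integral_sq_transform_le'`. -/
lemma riemannError_eq (lam : Fin N → ℝ) (a : ℝ) {t T s : ℝ≥0} (hts : t ≤ s) (hsT : s ≤ T) (n : ℕ)
    (ω : Ω) : riemannError W lam a t T s n ω =
      (∑ k ∈ Finset.range (n + 1), (a * (min (expo W lam a t (cgrid t T s n k) ω) (n + 1) -
        expo W lam a t (cgrid t T s n k) ω)) *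
        gain W lam (cgrid t T s n k) (cgrid t T s n (k + 1)) ω) -
      ∑ k ∈ Finset.range (n + 1), expo W lam a t (cgrid t T s n k) ω *
        expoError W lam a (cgrid t T s n k) (cgrid t T s n (k + 1)) ω := by
  have htel := Finset.sum_range_sub (fun k => expo W lam a t (cgrid t T s n k) ω) (n + 1)
  have e1 : cgrid t T s n (n + 1) = s := by
    rw [cgrid, grid_last (hts.trans hsT), clamp_of_le hts hsT]
  have e0 : cgrid t T s n 0 = t := by
    rw [cgrid, grid_zero, clamp, min_eq_left hts, max_self]
  rw [e1, e0, expo_self] at htel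
  rw [riemannError, ← htel, ← Finset.sum_sub_distrib, ← Finset.sum_sub_distrib]
  refine Finset.sum_congr rfl fun k _ => ?_
  rw [← expo_mul lam a t (cgrid t T s n k) (cgrid t T s n (k + 1)), expoError, gain]
  ring

/-- Truncating at level `n + 1`, which makes the integrands bounded, costs order `(n+1)⁻²` in mean
square. Linearisation errors have mean and second moment of order `(n+1)⁻²` per step, hence order
`(n+1)⁻¹` in total once the mesh is below `δ`. -/
lemma tendsto_riemannError (hW : IsStandardBrownianMotion W P) (lam : Fin N → ℝ) (a : ℝ)
    {t T s : ℝ≥0} (hts : t ≤ s) (hsT : s ≤ T) :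
    (∀ᶠ n in atTop, MemLp (riemannError W lam a t T s n) 2 P) ∧
    Tendsto (fun n => ∫ ω, riemannError W lam a t T s n ω ^ 2 ∂P) atTop (𝓝 0) := by
  obtain ⟨Q, δ, hQ, hδ, hE⟩ := exists_bound_expoError hW lam a
  obtain ⟨C2, hC2, h2⟩ := exists_bound_integral_expo_pow hW lam a t T 2
  obtain ⟨C4, hC4, h4⟩ := exists_bound_integral_expo_pow hW lam a t T 4
  set θ : ℝ := (normSq lam : ℝ) with hθdef
  have hθ : 0 ≤ θ := NNReal.coe_nonneg _
  set L : ℝ := ((T - t : ℝ≥0) : ℝ) with hL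
  have hL0 : 0 ≤ L := NNReal.coe_nonneg _
  have hh : Tendsto (fun n : ℕ => 1 / ((n : ℝ) + 1)) atTop (𝓝 0) :=
    tendsto_one_div_add_atTop_nhds_zero_nat
  have hstep0 : ∀ n k, 0 ≤ (cgrid t T s n (k + 1) : ℝ) - cgrid t T s n k := fun n k =>
    sub_nonneg.2 (by exact_mod_cast cgrid_mono t T s n (Nat.le_succ k))
  have hmem : ∀ n k, cgrid t T s n k ∈ Icc t T := fun n k =>
    ⟨le_clamp _ _ _, (clamp_le hts _).trans hsT⟩
  have hmeas_noise : ∀ c : ℝ, Measurable fun x : Fin N → ℝ => ∑ i, lam i * x i + c := fun c =>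
    (Finset.measurable_fun_sum _ fun i _ => (measurable_pi_apply i).const_mul _).add_const c
  set F1 : ℕ → Ω → ℝ := fun n ω =>
    ∑ k ∈ Finset.range (n + 1), (a * (min (expo W lam a t (cgrid t T s n k) ω) (n + 1) -
        expo W lam a t (cgrid t T s n k) ω)) *
        gain W lam (cgrid t T s n k) (cgrid t T s n (k + 1)) ω with hF1
  set F2 : ℕ → Ω → ℝ := fun n ω =>
      ∑ k ∈ Finset.range (n + 1), expo W lam a t (cgrid t T s n k) ω *
        expoError W lam a (cgrid t T s n k) (cgrid t T s n (k + 1)) ω with hF2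
  have b1 : ∀ n : ℕ, MemLp (F1 n) 2 P ∧ ∫ ω, F1 n ω ^ 2 ∂P ≤
      2 * (a ^ 2 * C4 * (1 / ((n : ℝ) + 1)) ^ 2) * ((θ * L + (θ * L) ^ 2) + (θ * L) ^ 2) := by
    intro n
    have hn : (0 : ℝ) < (n : ℝ) + 1 := by positivity
    have key := integral_sq_transform_le' hW (cgrid_mono t T s n)
      (Y := fun k ω => a * (min (expo W lam a t (cgrid t T s n k) ω) (n + 1) -
        expo W lam a t (cgrid t T s n k) ω))
      (fun k => by
        have := measurable_expo_filtration hW.measurable lam a (hmem n k).1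
          (le_refl (cgrid t T s n k))
        exact ((this.min measurable_const).sub this).const_mul a)
      (fun k => ((memLp_min_expo hW lam a (hmem n k).1 hn).sub
        (memLp_expo hW lam a (hmem n k).1)).const_mul a)
      (f := fun k x => ∑ i, lam i * x i +
        θ * ((cgrid t T s n (k + 1) : ℝ) - cgrid t T s n k))
      (fun k => hmeas_noise _) (fun k => memLp_gainIncrement hW lam _ _)
      (A := a ^ 2 * C4 * (1 / ((n : ℝ) + 1)) ^ 2)
      (B := θ * (L / (n + 1)) + (θ * (L / (n + 1))) ^ 2) (b := θ * (L / (n + 1)))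
      (fun k => by
        simp only [mul_pow]
        rw [integral_const_mul, mul_assoc]
        refine mul_le_mul_of_nonneg_left ((integral_sq_truncation_le hW lam a (hmem n k).1 hn).trans
          ?_) (sq_nonneg a)
        rw [one_div, inv_pow, div_eq_mul_inv]
        exact mul_le_mul_of_nonneg_right (h4 _ (hmem n k)) (by positivity))
      (fun k => by
        have h5 := integral_gain_sq hW lam (cgrid_mono t T s n (Nat.le_succ k))
        have h6 := cgrid_step t T s n k
        have h7 := hstep0 n k
        refine h5.le.trans ?_
        gcongr)
      (fun k => by
        have h5 := integral_gain hW lam (cgrid_mono t T s n (Nat.le_succ k))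
        have h6 := cgrid_step t T s n k
        have h7 := hstep0 n k
        refine (congrArg abs h5).le.trans ?_
        rw [abs_of_nonneg (by positivity)]
        gcongr) (n + 1)
    refine ⟨key.1, key.2.trans ?_⟩
    refine mul_le_mul_of_nonneg_left ?_ (by positivity)
    have hN1 : (1 : ℝ) ≤ (n : ℝ) + 1 := by linarith [n.cast_nonneg (α := ℝ)]
    have e1 : ((n + 1 : ℕ) : ℝ) * (θ * (L / (n + 1))) = θ * L := by push_cast; field_simp
    rw [mul_add, e1]
    have e2 : ((n + 1 : ℕ) : ℝ) * (θ * (L / (n + 1))) ^ 2 = (θ * L) ^ 2 / (n + 1) := by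
      push_cast; field_simp
    rw [e2]
    have := div_le_self (sq_nonneg (θ * L)) hN1
    linarith
  have b2 : ∀ᶠ n : ℕ in atTop, MemLp (F2 n) 2 P ∧ ∫ ω, F2 n ω ^ 2 ∂P ≤
      2 * C2 * (Q * L ^ 2 * (1 / ((n : ℝ) + 1)) + (Q * L ^ 2 * (1 / ((n : ℝ) + 1))) ^ 2) := by
    have hev : ∀ᶠ n : ℕ in atTop, L * (1 / ((n : ℝ) + 1)) ≤ δ := by
      have := hh.const_mul L
      rw [mul_zero] at this
      exact (this.eventually (gt_mem_nhds hδ)).mono fun n hn => le_of_lt hn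
    filter_upwards [hev] with n hnδ
    have hn : (0 : ℝ) < (n : ℝ) + 1 := by positivity
    rw [mul_one_div] at hnδ
    have hst : ∀ k, (cgrid t T s n (k + 1) : ℝ) - cgrid t T s n k ≤ δ := fun k =>
      (cgrid_step t T s n k).trans hnδ
    have hpow : ∀ k, Q * ((cgrid t T s n (k + 1) : ℝ) - cgrid t T s n k) ^ 2 ≤
        Q * (L / (n + 1)) ^ 2 := fun k => by
      have h6 := cgrid_step t T s n k
      have h7 := hstep0 n k
      gcongr
    have key := integral_sq_transform_le' hW (cgrid_mono t T s n)
      (Y := fun k => expo W lam a t (cgrid t T s n k))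
      (fun k => measurable_expo_filtration hW.measurable lam a (hmem n k).1 le_rfl)
      (fun k => memLp_expo hW lam a (hmem n k).1)
      (f := fun k x => Real.exp (a * (∑ i, lam i * x i) + growthRate lam a *
          ((cgrid t T s n (k + 1) : ℝ) - cgrid t T s n k)) - 1 -
        a * (∑ i, lam i * x i + θ * ((cgrid t T s n (k + 1) : ℝ) - cgrid t T s n k)))
      (fun k => by
        have h0 : Measurable fun x : Fin N → ℝ => ∑ i, lam i * x i :=
          Finset.measurable_fun_sum _ fun i _ => (measurable_pi_apply i).const_mul _
        fun_prop)
      (fun k => memLp_expoError hW lam a (cgrid_mono t T s n (Nat.le_succ k)))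
      (A := C2) (B := Q * (L / (n + 1)) ^ 2) (b := Q * (L / (n + 1)) ^ 2)
      (fun k => h2 _ (hmem n k))
      (fun k => ((hE _ _ (cgrid_mono t T s n (Nat.le_succ k)) (hst k)).2.1).trans (hpow k))
      (fun k => ((hE _ _ (cgrid_mono t T s n (Nat.le_succ k)) (hst k)).1).trans (hpow k)) (n + 1)
    refine ⟨key.1, key.2.trans (le_of_eq ?_)⟩
    have e1 : ((n + 1 : ℕ) : ℝ) * (Q * (L / (n + 1)) ^ 2) = Q * L ^ 2 * (1 / ((n : ℝ) + 1)) := by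
      push_cast; field_simp
    rw [e1]
  have hFe : ∀ n, riemannError W lam a t T s n = fun ω => F1 n ω - F2 n ω := fun n => by
    ext ω
    exact riemannError_eq lam a hts hsT n ω
  refine ⟨b2.mono fun n hn => by rw [hFe]; exact (b1 n).1.sub hn.1, ?_⟩
  have hlim : Tendsto (fun n : ℕ => 2 * (2 * (a ^ 2 * C4 * (1 / ((n : ℝ) + 1)) ^ 2) *
      ((θ * L + (θ * L) ^ 2) + (θ * L) ^ 2)) + 2 * (2 * C2 * (Q * L ^ 2 * (1 / ((n : ℝ) + 1)) +
      (Q * L ^ 2 * (1 / ((n : ℝ) + 1))) ^ 2))) atTop (𝓝 0) := by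
    have : Tendsto (fun x : ℝ => 2 * (2 * (a ^ 2 * C4 * x ^ 2) *
      ((θ * L + (θ * L) ^ 2) + (θ * L) ^ 2)) + 2 * (2 * C2 * (Q * L ^ 2 * x +
      (Q * L ^ 2 * x) ^ 2))) (𝓝 0) (𝓝 0) := by
      refine Continuous.tendsto' (by fun_prop) _ _ (by simp)
    exact this.comp hh
  refine tendsto_of_tendsto_of_tendsto_of_le_of_le' tendsto_const_nhds hlim
    (Eventually.of_forall fun n => integral_nonneg fun _ => sq_nonneg _) ?_
  filter_upwards [b2] with n hn
  have g1 := (b1 n).1.integrable_sq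
  have g2 := hn.1.integrable_sq
  rw [hFe]
  refine (integral_mono ((b1 n).1.sub hn.1).integrable_sq
    ((g1.const_mul 2).fun_add (g2.const_mul 2)) fun ω => ?_).trans ?_
  · simp only [Pi.sub_apply]
    nlinarith [sq_nonneg (F1 n ω + F2 n ω)]
  · rw [integral_add (g1.const_mul 2) (g2.const_mul 2), integral_const_mul, integral_const_mul]
    have := (b1 n).2
    have := hn.2
    linarith

/-- The mean square distance between an exponential and its truncation at an earlier time. -/
lemma exists_bound_truncation (hW : IsStandardBrownianMotion W P) (lam : Fin N → ℝ) (a : ℝ)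
    (t T : ℝ≥0) : ∃ C δ : ℝ, 0 ≤ C ∧ 0 < δ ∧ ∀ s ∈ Icc t T, ∀ v : ℝ≥0, s ≤ v →
      (v : ℝ) - s ≤ δ → ∀ m : ℝ, 0 < m →
      ∫ ω, (min (expo W lam a t s ω) m - expo W lam a t v ω) ^ 2 ∂P ≤
        C * (1 / m ^ 2 + ((v : ℝ) - s)) := by
  obtain ⟨Q, δ, hQ, hδ, hE⟩ := exists_bound_expoError hW lam a
  obtain ⟨C2, hC2, h2⟩ := exists_bound_integral_expo_pow hW lam a t T 2
  obtain ⟨C4, hC4, h4⟩ := exists_bound_integral_expo_pow hW lam a t T 4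
  refine ⟨2 * C4 + 2 * (C2 * Q), δ, by positivity, hδ, fun s hs v hsv hv m hm => ?_⟩
  have hv0 : 0 ≤ (v : ℝ) - s := sub_nonneg.2 (by exact_mod_cast hsv)
  have hm1 : Measurable fun x : Fin N → ℝ => Real.exp (a * (∑ i, lam i * x i) + growthRate lam a *
      ((v : ℝ) - s)) - 1 := by
    have h0 : Measurable fun x : Fin N → ℝ => ∑ i, lam i * x i :=
      Finset.measurable_fun_sum _ fun i _ => (measurable_pi_apply i).const_mul _
    fun_prop
  have hind := indepFun_increment hW hsv
    (measurable_expo_filtration hW.measurable lam a hs.1 le_rfl) hm1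
  have hL2 : MemLp (fun ω => expo W lam a s v ω - 1) 2 P :=
    (memLp_expo hW lam a hsv).sub (memLp_const 1)
  obtain ⟨p1, p2⟩ := IndepFun.memLp_two_mul hind (memLp_expo hW lam a hs.1) hL2
  have p1' : MemLp (fun ω => expo W lam a t s ω * (expo W lam a s v ω - 1)) 2 P := p1
  have p2' : ∫ ω, (expo W lam a t s ω * (expo W lam a s v ω - 1)) ^ 2 ∂P =
    (∫ ω, expo W lam a t s ω ^ 2 ∂P) * ∫ ω, (expo W lam a s v ω - 1) ^ 2 ∂P := p2
  have q1 : MemLp (fun ω => min (expo W lam a t s ω) m - expo W lam a t s ω) 2 P :=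
    (memLp_min_expo hW lam a hs.1 hm).sub (memLp_expo hW lam a hs.1)
  have q2 := (integral_sq_truncation_le hW lam a hs.1 hm).trans
    (div_le_div_of_nonneg_right (h4 s hs) (sq_nonneg m))
  have e : ∀ ω, (min (expo W lam a t s ω) m - expo W lam a t v ω) ^ 2 ≤
      2 * (min (expo W lam a t s ω) m - expo W lam a t s ω) ^ 2 +
      2 * (expo W lam a t s ω * (expo W lam a s v ω - 1)) ^ 2 := fun ω => by
    rw [← expo_mul lam a t s v]
    nlinarith [sq_nonneg ((min (expo W lam a t s ω) m - expo W lam a t s ω) +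
      (expo W lam a t s ω * (expo W lam a s v ω - 1)))]
  refine (integral_mono ((memLp_min_expo hW lam a hs.1 hm).sub
    (memLp_expo hW lam a (hs.1.trans hsv))).integrable_sq
    ((q1.integrable_sq.const_mul 2).fun_add (p1'.integrable_sq.const_mul 2)) e).trans ?_
  rw [integral_add (q1.integrable_sq.const_mul 2) (p1'.integrable_sq.const_mul 2),
    integral_const_mul, integral_const_mul, p2']
  have h6 : (∫ ω, expo W lam a t s ω ^ 2 ∂P) * ∫ ω, (expo W lam a s v ω - 1) ^ 2 ∂P ≤
      C2 * (Q * ((v : ℝ) - s)) :=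
    mul_le_mul (h2 s hs) (hE s v hsv hv).2.2 (integral_nonneg fun _ => sq_nonneg _) hC2
  have h7 : 0 ≤ C4 * ((v : ℝ) - s) := mul_nonneg hC4 hv0
  have h8 : 0 ≤ C2 * Q * (1 / m ^ 2) := by positivity
  rw [div_eq_mul_one_div] at q2
  linarith

end RiemannSums

/-! ### A progressive version of Brownian motion -/

section Progressive

variable {Ω : Type*} [mΩ : MeasurableSpace Ω] {N : ℕ} {P : Measure Ω}
  {W : Fin N → ℝ≥0 → Ω → ℝ}

/-- The largest multiple of `1 / (n + 1)` that is at most `v`. -/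
def floorTime (n : ℕ) (v : ℝ≥0) : ℝ≥0 := (⌊(v : ℝ) * ((n : ℝ) + 1)⌋₊ : ℝ≥0) / (n + 1)

lemma floorTime_le (n : ℕ) (v : ℝ≥0) : floorTime n v ≤ v := by
  rw [floorTime, div_le_iff₀ (by positivity)]
  have := Nat.floor_le (a := (v : ℝ) * ((n : ℝ) + 1)) (by positivity)
  exact_mod_cast this

lemma tendsto_floorTime (v : ℝ≥0) : Tendsto (fun n => floorTime n v) atTop (𝓝 v) := by
  have h : Tendsto (fun n : ℕ => ((⌊(v : ℝ) * ((n : ℝ) + 1)⌋₊ : ℝ)) / ((n : ℝ) + 1)) atTop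
      (𝓝 (v : ℝ)) :=
    (tendsto_nat_floor_mul_div_atTop v.2).comp
      (tendsto_atTop_add_const_right _ _ tendsto_natCast_atTop_atTop)
  rw [← NNReal.tendsto_coe]
  refine h.congr fun n => ?_
  rw [floorTime]
  push_cast
  rfl

/-- A progressively measurable version of `W`. -/
def progVersion (W : Fin N → ℝ≥0 → Ω → ℝ) (j : Fin N) (v : ℝ≥0) (ω : Ω) : ℝ :=
  limsup (fun n => W j (floorTime n v) ω) atTop

lemma progVersion_eq {j : Fin N} {ω : Ω} (h : Continuous fun v => W j v ω) (v : ℝ≥0) :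
    progVersion W j v ω = W j v ω :=
  ((h.tendsto v).comp (tendsto_floorTime v)).limsup_eq

/-- Paths are continuous only almost surely and the filtration is not completed, so `W` itself is
replaced. For each `n`, `floorTime n` takes countably many values and never looks ahead, which gives
joint measurability; `limsup` preserves it. The time change `h` serves both `v` and `min t v`. -/
lemma isProgressive_progVersion (hW : ∀ i s, Measurable (W i s)) (j : Fin N) {h : ℝ≥0 → ℝ≥0}
    (hm : Measurable h) (hle : ∀ v, h v ≤ v) :
    IsProgressive (brownianFiltration W hW) fun v ω => progVersion W j (h v) ω := by
  intro u
  let mu : MeasurableSpace (Iic u × Ω) :=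
    @Prod.instMeasurableSpace _ _ Subtype.instMeasurableSpace (brownianFiltration W hW u)
  refine Measurable.limsup fun n => ?_
  have h1 : @Measurable (ℕ × Ω) ℝ
      (@Prod.instMeasurableSpace _ _ inferInstance (brownianFiltration W hW u)) _
      fun p => W j (min ((p.1 : ℝ≥0) / (n + 1)) u) p.2 :=
    @measurable_from_prod_countable_right _ _ _ _ (brownianFiltration W hW u) _ _ _ _ fun m => by
      have := measurable_brownianFiltration hW (min_le_right ((m : ℝ≥0) / (n + 1)) u) j
      exact this
  have h2 : @Measurable (Iic u × Ω) (ℕ × Ω) mu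
      (@Prod.instMeasurableSpace _ _ inferInstance (brownianFiltration W hW u))
      fun p => (⌊(h p.1 : ℝ) * ((n : ℝ) + 1)⌋₊, p.2) := by
    refine @Measurable.prodMk _ _ _ _ _ (brownianFiltration W hW u) _ _ ?_ ?_
    · refine Nat.measurable_floor.comp
        (Measurable.mul_const (measurable_coe_nnreal_real.comp (hm.comp ?_)) _)
      exact measurable_subtype_coe.comp (@measurable_fst _ _ _ (brownianFiltration W hW u))
    · exact @measurable_snd _ _ _ (brownianFiltration W hW u)
  have h4 : (fun p : Iic u × Ω => W j (floorTime n (h p.1)) p.2) = fun p =>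
      W j (min ((⌊(h p.1 : ℝ) * ((n : ℝ) + 1)⌋₊ : ℝ≥0) / (n + 1)) u) p.2 := by
    ext p
    have h3 : floorTime n (h p.1) ≤ u := (floorTime_le _ _).trans ((hle _).trans p.1.2)
    rw [floorTime] at h3
    rw [floorTime, min_eq_left h3]
  rw [h4]
  have h5 := h1.comp h2
  simp only [Function.comp_def] at h5
  exact h5

/-- A progressively measurable version of `v ↦ expo W lam a t v` on `[t, ∞)`. -/
def progExpo (W : Fin N → ℝ≥0 → Ω → ℝ) (lam : Fin N → ℝ) (a : ℝ) (t v : ℝ≥0) (ω : Ω) : ℝ :=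
  Real.exp (a * ∑ j, lam j * (progVersion W j v ω - progVersion W j (min t v) ω) +
    growthRate lam a * ((v : ℝ) - t))

lemma isProgressive_progExpo (hW : ∀ i s, Measurable (W i s)) (lam : Fin N → ℝ) (a : ℝ)
    (t : ℝ≥0) : IsProgressive (brownianFiltration W hW) (progExpo W lam a t) := by
  intro u
  let mu : MeasurableSpace (Iic u × Ω) :=
    @Prod.instMeasurableSpace _ _ Subtype.instMeasurableSpace (brownianFiltration W hW u)
  have h1 : ∀ j, Measurable fun p : Iic u × Ω => progVersion W j p.1 p.2 := fun j =>
    isProgressive_progVersion hW j measurable_id (fun v => le_rfl) u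
  have h2 : ∀ j, Measurable fun p : Iic u × Ω => progVersion W j (min t p.1) p.2 := fun j =>
    isProgressive_progVersion hW j (h := fun v => min t v) (by fun_prop)
      (fun v => min_le_right _ _) u
  have h3 : Measurable fun p : Iic u × Ω => ((p.1 : ℝ≥0) : ℝ) :=
    measurable_coe_nnreal_real.comp
      (measurable_subtype_coe.comp (@measurable_fst _ _ _ (brownianFiltration W hW u)))
  exact Real.measurable_exp.comp (((Finset.measurable_fun_sum _ fun j _ =>
    ((h1 j).sub (h2 j)).const_mul _).const_mul a).add ((h3.sub_const _).const_mul _))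

lemma ae_continuous (hW : IsStandardBrownianMotion W P) :
    ∀ᵐ ω ∂P, ∀ j, Continuous fun v => W j v ω :=
  ae_all_iff.2 fun j => (hW.brownian j).cont

lemma ae_progExpo_eq (hW : IsStandardBrownianMotion W P) (lam : Fin N → ℝ) (t : ℝ≥0) :
    ∀ᵐ ω ∂P, ∀ a, ∀ v, t ≤ v → progExpo W lam a t v ω = expo W lam a t v ω := by
  filter_upwards [ae_continuous hW] with ω hω a v hv
  simp only [progExpo, expo, noise, increment, progVersion_eq (hω _), min_eq_left hv]

end Progressive

/-! ### Approximation of the exponential strategies by simple ones -/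

section Replication

variable {Ω : Type*} [mΩ : MeasurableSpace Ω] {N : ℕ} {P : Measure Ω}
  {W : Fin N → ℝ≥0 → Ω → ℝ} {ℱ : Filtration ℝ≥0 mΩ}

lemma SimpleProcess.eval_eq_coef (S : SimpleProcess ℱ N) {k : ℕ} (hk : k < S.n) {v : ℝ≥0}
    (h1 : S.time k < v) (h2 : v ≤ S.time (k + 1)) (ω : Ω) : S.eval v ω = S.coef k ω := by
  rw [SimpleProcess.eval, Finset.sum_eq_single k]
  · rw [if_pos ⟨h1, h2⟩]
  · intro i _ hik
    refine if_neg ?_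
    rintro ⟨h3, h4⟩
    rcases lt_or_gt_of_ne hik with h | h
    · exact absurd (h4.trans (S.mono h)) (not_le.2 h1)
    · exact absurd (h2.trans (S.mono h)) (not_le.2 h3)
  · intro h
    exact absurd (Finset.mem_range.2 hk) h

lemma exists_lt_le_of_monotone {τ : ℕ → ℝ≥0} {v : ℝ≥0} (h0 : τ 0 < v) (n : ℕ) (hn : v ≤ τ n) :
    ∃ k < n, τ k < v ∧ v ≤ τ (k + 1) := by
  induction n with
  | zero => exact absurd hn (not_le.2 h0)
  | succ n ih =>
    rcases lt_or_ge (τ n) v with h | h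
    · exact ⟨n, Nat.lt_succ_self n, h, hn⟩
    · obtain ⟨k, hk, h1⟩ := ih h
      exact ⟨k, hk.trans (Nat.lt_succ_self n), h1⟩

lemma SimpleProcess.measurable_stopped_eval (S : SimpleProcess ℱ N) (T : ℝ≥0) :
    Measurable fun p : ℝ × Ω => S.eval (min p.1.toNNReal T) p.2 := by
  refine Finset.measurable_fun_sum _ fun k _ => ?_
  have h : Measurable fun p : ℝ × Ω => min p.1.toNNReal T :=
    (measurable_real_toNNReal.comp measurable_fst).min measurable_const
  have hs : MeasurableSet {u : ℝ≥0 | S.time k < u ∧ u ≤ S.time (k + 1)} := measurableSet_Ioc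
  exact Measurable.ite (h hs) (((S.measurable k).mono (ℱ.le _) le_rfl).comp measurable_snd)
    measurable_const

lemma sqIntegral_le [SFinite P] {ψ : ℝ≥0 → Ω → Fin N → ℝ} {t T : ℝ≥0}
    (hψ : Measurable fun p : ℝ × Ω => ψ (min p.1.toNNReal T) p.2) {B : ℝ≥0∞}
    (hB : ∀ v : ℝ≥0, t < v → v ≤ T → ∫⁻ ω, ENNReal.ofReal (∑ j, ψ v ω j ^ 2) ∂P ≤ B) :
    sqIntegral P ψ t T ≤ B * ENNReal.ofReal ((T : ℝ) - t) := by
  have hm : Measurable fun p : ℝ × Ω => ENNReal.ofReal (∑ j, (ψ (min p.1.toNNReal T) p.2 j) ^ 2) :=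
    (Finset.measurable_fun_sum _ fun j _ =>
      ((measurable_pi_apply j).comp hψ).pow_const 2).ennreal_ofReal
  have e : sqIntegral P ψ t T = ∫⁻ ω, (∫⁻ v in Ioc (t : ℝ) (T : ℝ),
      ENNReal.ofReal (∑ j, (ψ (min v.toNNReal T) ω j) ^ 2)) ∂P := by
    refine lintegral_congr fun ω => ?_
    -- Dropping the null endpoint `t` matters because simple processes live on left-open cells and
    -- vanish at `t`.
    rw [← restrict_Ioc_eq_restrict_Icc]
    refine setLIntegral_congr_fun measurableSet_Ioc fun v hv => ?_
    simp only [min_eq_left (Real.toNNReal_le_iff_le_coe.2 hv.2)]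
  rw [e, lintegral_lintegral_swap (f := fun ω (v : ℝ) =>
    ENNReal.ofReal (∑ j, (ψ (min v.toNNReal T) ω j) ^ 2)) (hm.comp measurable_swap).aemeasurable]
  calc ∫⁻ v in Ioc (t : ℝ) (T : ℝ), ∫⁻ ω,
        ENNReal.ofReal (∑ j, (ψ (min v.toNNReal T) ω j) ^ 2) ∂P
      ≤ ∫⁻ _ in Ioc (t : ℝ) (T : ℝ), B := by
        refine setLIntegral_mono measurable_const fun v hv => ?_
        have hv2 : v.toNNReal ≤ T := Real.toNNReal_le_iff_le_coe.2 hv.2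
        rw [min_eq_left hv2]
        exact hB _ (Real.lt_toNNReal_iff_coe_lt.2 hv.1) hv2
    _ = B * ENNReal.ofReal ((T : ℝ) - t) := by
        rw [setLIntegral_const, Real.volume_Ioc]

variable {ι : Type*} (I : Finset ι) (c a : ι → ℝ)

/-- The truncated Riemann approximation of the strategy replicating `∑ c_i expo (a_i)`. -/
def riemannProcess (hW : ∀ i s, Measurable (W i s)) (lam : Fin N → ℝ) (t T : ℝ≥0) (n : ℕ) :
    SimpleProcess (brownianFiltration W hW) N where
  n := n + 1
  time := grid t T n
  mono := grid_mono t T n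
  coef k ω j := (∑ i ∈ I, c i * (a i * min (expo W lam (a i) t (grid t T n k) ω) (n + 1))) * lam j
  measurable k := @measurable_pi_lambda _ _ _ (brownianFiltration W hW _) _ _ fun j =>
    (Finset.measurable_fun_sum _ fun i _ => (((measurable_expo_filtration hW lam (a i)
      (le_grid t T n k) le_rfl).min measurable_const).const_mul _).const_mul _).mul_const _
  bounded := by
    refine ⟨(∑ i ∈ I, |c i| * (|a i| * (n + 1))) * ∑ j, |lam j|, fun k ω j => ?_⟩
    rw [abs_mul]
    refine mul_le_mul ((Finset.abs_sum_le_sum_abs _ _).trans (Finset.sum_le_sum fun i _ => ?_))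
      (Finset.single_le_sum (f := fun j => |lam j|) (fun j _ => abs_nonneg _) (Finset.mem_univ j))
      (abs_nonneg _) (Finset.sum_nonneg fun i _ => by positivity)
    rw [abs_mul, abs_mul]
    have h0 := expo_pos (W := W) lam (a i) t (grid t T n k) ω
    rw [abs_of_nonneg (le_min h0.le (by positivity) :
      0 ≤ min (expo W lam (a i) t (grid t T n k) ω) ((n : ℝ) + 1))]
    gcongr
    exact min_le_right _ _

lemma gain_eq (lam : Fin N → ℝ) (s s' : ℝ≥0) (ω : Ω) : gain W lam s s' ω =
    ∑ j, lam j * (increment W s s' ω j + lam j * ((s' : ℝ) - s)) := by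
  rw [gain, noise, coe_normSq, Finset.sum_mul, ← Finset.sum_add_distrib]
  refine Finset.sum_congr rfl fun j _ => by ring

lemma riemannProcess_total_sub (hW : ∀ i s, Measurable (W i s)) (lam : Fin N → ℝ) {t T s : ℝ≥0}
    (hts : t ≤ s) (n : ℕ) (ω : Ω) :
    (riemannProcess I c a hW lam t T n).total W lam t s ω -
      (∑ i ∈ I, c i * expo W lam (a i) t s ω - ∑ i ∈ I, c i) =
      ∑ i ∈ I, c i * riemannError W lam (a i) t T s n ω := by
  have h1 : (riemannProcess I c a hW lam t T n).total W lam t s ω =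
      ∑ k ∈ Finset.range (n + 1), (∑ i ∈ I, c i * (a i * min (expo W lam (a i) t
        (cgrid t T s n k) ω) (n + 1))) *
          gain W lam (cgrid t T s n k) (cgrid t T s n (k + 1)) ω := by
    refine Finset.sum_congr rfl fun k _ => ?_
    rw [gain_eq, Finset.mul_sum]
    refine Finset.sum_congr rfl fun j _ => ?_
    change (∑ i ∈ I, c i * (a i * min (expo W lam (a i) t (grid t T n k) ω) (n + 1))) * lam j *
      (increment W (cgrid t T s n k) (cgrid t T s n (k + 1)) ω j +
      lam j * ((cgrid t T s n (k + 1) : ℝ) - cgrid t T s n k)) = _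
    -- A cell starting at or after `s` has zero clamped increment; for every other cell the clamped
    -- left endpoint is the grid point itself, so the coefficients agree.
    rcases le_total s (grid t T n k) with h | h
    · have e1 : cgrid t T s n k = s := clamp_of_le hts h
      have e2 : cgrid t T s n (k + 1) = s :=
        clamp_of_le hts (h.trans (grid_mono t T n (Nat.le_succ k)))
      simp [e1, e2, increment]
    · have e1 : cgrid t T s n k = grid t T n k := by
        rw [cgrid, clamp, min_eq_left h, max_eq_right (le_grid t T n k)]
      rw [e1]
      ring
  rw [h1]
  simp only [riemannError, mul_sub, Finset.sum_sub_distrib, mul_one]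
  congr 1
  simp only [Finset.sum_mul, Finset.mul_sum]
  rw [Finset.sum_comm]
  refine Finset.sum_congr rfl fun i _ => Finset.sum_congr rfl fun k _ => by ring

variable [IsProbabilityMeasure P]

lemma moment2_const_mul (r : ℝ) (f : Ω → ℝ) :
    moment2 P (fun ω => r * f ω) = ENNReal.ofReal (r ^ 2) * moment2 P f := by
  unfold moment2
  rw [← lintegral_const_mul' _ _ ENNReal.ofReal_ne_top]
  refine lintegral_congr fun ω => ?_
  rw [mul_pow, ENNReal.ofReal_mul (sq_nonneg r)]

lemma tendsto_riemannProcess_total (hW : IsStandardBrownianMotion W P) (lam : Fin N → ℝ)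
    {t T s : ℝ≥0} (hts : t ≤ s) (hsT : s ≤ T) :
    Tendsto (fun n => moment2 P (fun ω =>
      (riemannProcess I c a hW.measurable lam t T n).total W lam t s ω -
      (∑ i ∈ I, c i * expo W lam (a i) t s ω - ∑ i ∈ I, c i))) atTop (𝓝 0) := by
  simp only [riemannProcess_total_sub I c a hW.measurable lam hts]
  have hmeas : ∀ i n, Measurable (riemannError W lam (a i) t T s n) := fun i n => by
    refine (Finset.measurable_fun_sum _ fun k _ => ?_).sub
      ((measurable_expo hW.measurable lam _ _ _).sub_const _)
    exact (((measurable_expo hW.measurable lam _ _ _).min measurable_const).const_mul _).mul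
      ((measurable_noise hW.measurable lam _ _).add_const _)
  have h1 : ∀ i, Tendsto (fun n => moment2 P (riemannError W lam (a i) t T s n)) atTop (𝓝 0) :=
    fun i => by
      obtain ⟨h2, h3⟩ := tendsto_riemannError hW lam (a i) hts hsT
      have h4 := (ENNReal.continuous_ofReal.tendsto 0).comp h3
      rw [ENNReal.ofReal_zero] at h4
      exact h4.congr' (h2.mono fun n hn => (moment2_eq_ofReal hn).symm)
  refine tendsto_of_tendsto_of_tendsto_of_le_of_le tendsto_const_nhds ?_ (fun _ => zero_le)
    (fun n => moment2_sum_le I fun i _ => ((hmeas i n).const_mul (c i)).aemeasurable)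
  simp only [moment2_const_mul]
  have h5 := tendsto_finsetSum I fun i _ => ENNReal.Tendsto.const_mul
    (a := ENNReal.ofReal (c i ^ 2)) (h1 i) (Or.inr ENNReal.ofReal_ne_top)
  have h6 := ENNReal.Tendsto.const_mul (a := (I.card : ℝ≥0∞)) h5 (Or.inr (by simp))
  simpa using h6

/-- The scalar factor of the replicating strategy. -/
def exposure (W : Fin N → ℝ≥0 → Ω → ℝ) (lam : Fin N → ℝ) (t v : ℝ≥0) (ω : Ω) : ℝ :=
  ∑ i ∈ I, c i * (a i * progExpo W lam (a i) t v ω)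

lemma isProgressive_exposure (hW : ∀ i s, Measurable (W i s)) (lam w : Fin N → ℝ) (t : ℝ≥0) :
    IsProgressive (brownianFiltration W hW) fun v ω j => exposure I c a W lam t v ω * w j := by
  intro u
  let mu : MeasurableSpace (Iic u × Ω) :=
    @Prod.instMeasurableSpace _ _ Subtype.instMeasurableSpace (brownianFiltration W hW u)
  exact measurable_pi_lambda _ fun j => (Finset.measurable_fun_sum _ fun i _ =>
    ((isProgressive_progExpo hW lam (a i) t u).const_mul _).const_mul _).mul_const _

lemma lintegral_sum_sq_mul_le (f : Ω → ℝ) (w : Fin N → ℝ) :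
    ∫⁻ ω, ENNReal.ofReal (∑ j, (f ω * w j) ^ 2) ∂P = normSq w * moment2 P f := by
  unfold moment2
  rw [← lintegral_const_mul' _ _ ENNReal.coe_ne_top]
  refine lintegral_congr fun ω => ?_
  rw [← ENNReal.ofReal_coe_nnreal, ← ENNReal.ofReal_mul (by positivity), coe_normSq,
    Finset.sum_mul]
  congr 1
  refine Finset.sum_congr rfl fun j _ => by ring

lemma sqIntegral_exposure_lt_top (hW : IsStandardBrownianMotion W P) (lam w : Fin N → ℝ)
    (t T : ℝ≥0) :
    sqIntegral P (fun v ω j => exposure I c a W lam t v ω * w j) t T < ∞ := by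
  choose C hC0 hC using fun i => exists_bound_integral_expo_pow hW lam (a i) t T 2
  refine (sqIntegral_le (measurable_stopped_of_isProgressive
    (isProgressive_exposure I c a hW.measurable lam w t) T)
    (B := normSq w * (I.card * ∑ i ∈ I, ENNReal.ofReal ((c i * a i) ^ 2) * ENNReal.ofReal (C i)))
    fun v hv hvT => ?_).trans_lt ?_
  · rw [lintegral_sum_sq_mul_le]
    have e : exposure I c a W lam t v =ᵐ[P]
        fun ω => ∑ i ∈ I, (c i * a i) * expo W lam (a i) t v ω := by
      filter_upwards [ae_progExpo_eq hW lam t] with ω hω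
      simp only [exposure, hω _ v hv.le, mul_assoc]
    rw [moment2_congr e]
    refine mul_le_mul_right ((moment2_sum_le I fun i _ =>
      ((measurable_expo hW.measurable lam _ _ _).const_mul _).aemeasurable).trans ?_) _
    refine mul_le_mul_right (Finset.sum_le_sum fun i _ => ?_) _
    rw [moment2_const_mul, moment2_eq_ofReal (memLp_expo hW lam (a i) hv.le)]
    exact mul_le_mul_right (ENNReal.ofReal_le_ofReal (hC i v ⟨hv.le, hvT⟩)) _
  · refine ENNReal.mul_lt_top (ENNReal.mul_lt_top ENNReal.coe_lt_top (ENNReal.mul_lt_top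
      (by simp) ?_)) ENNReal.ofReal_lt_top
    exact ENNReal.sum_lt_top.2 fun i _ => ENNReal.mul_lt_top ENNReal.ofReal_lt_top
      ENNReal.ofReal_lt_top

/-- At time `v` in a grid cell, the error compares the exponential at `v` with its truncation at the
left endpoint. `exists_bound_truncation` bounds this uniformly in `v`, and `sqIntegral_le`
integrates the bound. -/
lemma tendsto_sqIntegral_riemannProcess (hW : IsStandardBrownianMotion W P) (lam : Fin N → ℝ)
    {t T : ℝ≥0} (htT : t ≤ T) :
    Tendsto (fun n => sqIntegral P (fun v ω =>
      (riemannProcess I c a hW.measurable lam t T n).eval v ω -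
        fun j => exposure I c a W lam t v ω * lam j) t T) atTop (𝓝 0) := by
  choose C δ hC hδ hE using fun i => exists_bound_truncation hW lam (a i) t T
  set L : ℝ := ((T - t : ℝ≥0) : ℝ) with hL
  set B : ℕ → ℝ≥0∞ := fun n => normSq lam * (I.card * ∑ i ∈ I, ENNReal.ofReal ((c i * a i) ^ 2) *
    ENNReal.ofReal (C i * (1 / ((n : ℝ) + 1) ^ 2 + L / ((n : ℝ) + 1)))) with hB
  have hh : Tendsto (fun n : ℕ => 1 / ((n : ℝ) + 1)) atTop (𝓝 0) :=
    tendsto_one_div_add_atTop_nhds_zero_nat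
  have hLn : Tendsto (fun n : ℕ => L / ((n : ℝ) + 1)) atTop (𝓝 0) := by
    have := hh.const_mul L
    simpa only [mul_zero, mul_one_div] using this
  have hev : ∀ᶠ n : ℕ in atTop, ∀ i ∈ I, L / ((n : ℝ) + 1) ≤ δ i :=
    (Finset.eventually_all I).2 fun i _ =>
      (hLn.eventually (gt_mem_nhds (hδ i))).mono fun n hn => le_of_lt hn
  have hbound : ∀ᶠ n : ℕ in atTop, sqIntegral P (fun v ω =>
      (riemannProcess I c a hW.measurable lam t T n).eval v ω -
        fun j => exposure I c a W lam t v ω * lam j) t T ≤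
      B n * ENNReal.ofReal ((T : ℝ) - t) := by
    filter_upwards [hev] with n hn
    set S := riemannProcess I c a hW.measurable lam t T n with hS
    refine sqIntegral_le ((S.measurable_stopped_eval T).sub (measurable_stopped_of_isProgressive
      (isProgressive_exposure I c a hW.measurable lam lam t) T)) fun v hv hvT => ?_
    obtain ⟨k, hk, hk1, hk2⟩ := exists_lt_le_of_monotone (τ := grid t T n)
      (by rwa [grid_zero]) (n + 1) (by rwa [grid_last htT])
    have hkT : grid t T n k ∈ Icc t T := ⟨le_grid t T n k, hk1.le.trans hvT⟩
    have hstep : (v : ℝ) - grid t T n k ≤ L / ((n : ℝ) + 1) := by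
      rw [grid_succ] at hk2
      have h' : (v : ℝ) ≤ ((grid t T n k + (T - t) / (n + 1) : ℝ≥0) : ℝ) := by exact_mod_cast hk2
      push_cast at h'
      rw [hL]
      linarith
    have e1 : ∀ᵐ ω ∂P, ENNReal.ofReal (∑ j, ((S.eval v ω -
        fun j => exposure I c a W lam t v ω * lam j) j) ^ 2) =
        ENNReal.ofReal (∑ j, ((∑ i ∈ I, (c i * a i) * (min (expo W lam (a i) t (grid t T n k) ω)
          (n + 1) - expo W lam (a i) t v ω)) * lam j) ^ 2) := by
      filter_upwards [ae_progExpo_eq hW lam t] with ω hω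
      rw [S.eval_eq_coef (k := k) hk hk1 hk2]
      congr 1
      refine Finset.sum_congr rfl fun j _ => ?_
      congr 1
      change (∑ i ∈ I, c i * (a i * min (expo W lam (a i) t (grid t T n k) ω) (n + 1))) * lam j -
        exposure I c a W lam t v ω * lam j = _
      rw [exposure, ← sub_mul, ← Finset.sum_sub_distrib]
      congr 1
      refine Finset.sum_congr rfl fun i _ => ?_
      rw [hω _ v hv.le]
      ring
    rw [lintegral_congr_ae e1, lintegral_sum_sq_mul_le]
    have hmm : ∀ i, MemLp (fun ω => min (expo W lam (a i) t (grid t T n k) ω) (n + 1) -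
        expo W lam (a i) t v ω) 2 P := fun i =>
      (memLp_min_expo hW lam (a i) hkT.1 (by positivity)).sub (memLp_expo hW lam (a i) hv.le)
    refine mul_le_mul_right ((moment2_sum_le I fun i _ =>
      (hmm i).1.aemeasurable.const_mul _).trans ?_) _
    refine mul_le_mul_right (Finset.sum_le_sum fun i hi => ?_) _
    rw [moment2_const_mul, moment2_eq_ofReal (hmm i)]
    refine mul_le_mul_right (ENNReal.ofReal_le_ofReal ?_) _
    refine (hE i _ hkT v hk1.le (hstep.trans (hn i hi)) (n + 1) (by positivity)).trans ?_
    exact mul_le_mul_of_nonneg_left (add_le_add le_rfl hstep) (hC i)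
  refine tendsto_of_tendsto_of_tendsto_of_le_of_le' tendsto_const_nhds ?_
    (Eventually.of_forall fun _ => zero_le) hbound
  have h1 : ∀ i, Tendsto (fun n : ℕ => ENNReal.ofReal
      (C i * (1 / ((n : ℝ) + 1) ^ 2 + L / ((n : ℝ) + 1)))) atTop (𝓝 0) := fun i => by
    have h2 := ((hh.pow 2).add hLn).const_mul (C i)
    have h3 := (ENNReal.continuous_ofReal.tendsto _).comp h2
    simp only [Function.comp_def, one_div, inv_pow] at h3 ⊢
    simpa using h3
  have h5 := tendsto_finsetSum I fun i _ => ENNReal.Tendsto.const_mul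
    (a := ENNReal.ofReal ((c i * a i) ^ 2)) (h1 i) (Or.inr ENNReal.ofReal_ne_top)
  have h6 := ENNReal.Tendsto.const_mul (a := (I.card : ℝ≥0∞)) h5 (Or.inr (by simp))
  have h7 := ENNReal.Tendsto.const_mul (a := (normSq lam : ℝ≥0∞)) h6
    (Or.inr ENNReal.coe_ne_top)
  have h8 := ENNReal.Tendsto.mul_const (b := ENNReal.ofReal ((T : ℝ) - t)) h7
    (Or.inr ENNReal.ofReal_ne_top)
  simp only [mul_zero, zero_mul, Finset.sum_const_zero] at h8
  exact h8

/-- The converse direction to `tendsto_total_sub`: the total gain `G` is known explicitly, and the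
stochastic integral is recovered as `G` minus the drift. -/
lemma tendsto_integral_sub (hW : IsStandardBrownianMotion W P) {t s T : ℝ≥0} (hts : t ≤ s)
    (hsT : s ≤ T) {φ : ℝ≥0 → Ω → Fin N → ℝ} {lam : Fin N → ℝ}
    (hφ : ∀ᵐ ω ∂P, IntervalIntegrable (fun v : ℝ => φ v.toNNReal ω ⬝ᵥ lam) volume t s)
    {G : Ω → ℝ} (hG : Measurable G) {S : ℕ → SimpleProcess ℱ N}
    (hS1 : Tendsto (fun n => sqIntegral P (fun v ω => (S n).eval v ω - φ v ω) t T) atTop (𝓝 0))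
    (hS2 : Tendsto (fun n => moment2 P (fun ω => (S n).total W lam t s ω - G ω)) atTop (𝓝 0)) :
    Tendsto (fun n => moment2 P (fun ω => (S n).integral W t s ω -
      (G ω - ∫ v in (t : ℝ)..s, φ v.toNNReal ω ⬝ᵥ lam))) atTop (𝓝 0) := by
  have key : ∀ n, moment2 P (fun ω => (S n).integral W t s ω -
      (G ω - ∫ v in (t : ℝ)..s, φ v.toNNReal ω ⬝ᵥ lam)) ≤
      2 * moment2 P (fun ω => (S n).total W lam t s ω - G ω) +
      2 * (((T - t : ℝ≥0) * normSq lam : ℝ≥0) *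
        sqIntegral P (fun v ω => (S n).eval v ω - φ v ω) t T) := fun n => by
    have e : (fun ω => (S n).integral W t s ω -
        (G ω - ∫ v in (t : ℝ)..s, φ v.toNNReal ω ⬝ᵥ lam)) = fun ω =>
        ((S n).total W lam t s ω - G ω) +
        -((∫ v in (t : ℝ)..s, (S n).eval v.toNNReal ω ⬝ᵥ lam) -
          ∫ v in (t : ℝ)..s, φ v.toNNReal ω ⬝ᵥ lam) := by
      ext ω
      rw [(S n).total_eq lam hts]
      ring
    rw [e]
    refine (moment2_add_le ((memLp_total hW (S n) lam t s).1.aemeasurable.sub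
      hG.aemeasurable)).trans ?_
    rw [moment2_neg]
    exact add_le_add le_rfl (mul_le_mul_right (moment2_drift_le hts hsT hφ (S n)) 2)
  refine tendsto_of_tendsto_of_tendsto_of_le_of_le tendsto_const_nhds ?_
    (fun n => zero_le) key
  have l1 := ENNReal.Tendsto.const_mul (a := 2) hS2 (Or.inr (by simp))
  have l2 := ENNReal.Tendsto.const_mul (a := 2) (ENNReal.Tendsto.const_mul
    (a := (((T - t : ℝ≥0) * normSq lam : ℝ≥0) : ℝ≥0∞)) hS1 (Or.inr ENNReal.coe_ne_top))
    (Or.inr (by simp))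
  have l3 := l1.add l2
  rw [mul_zero, mul_zero, mul_zero, add_zero] at l3
  exact l3

/-- The conditional expectation of a payoff under the pricing measure. -/
lemma expo_sum_eq_integral (lam : Fin N → ℝ) (K : ℝ) {t s T : ℝ≥0} (hsT : s ≤ T) (ω : Ω) :
    K + ∑ i ∈ I, c i * expo W lam (a i) t s ω =
      ∫ y, (K + ∑ i ∈ I, c i * Real.exp (a i * (noise W lam t s ω - normSq lam * (T - s : ℝ≥0) + y)
        + growthRate lam (a i) * ((T : ℝ) - t))) ∂gaussianReal 0 (normSq lam * (T - s)) := by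
  have e : ∀ i y, c i * Real.exp (a i * (noise W lam t s ω - normSq lam * (T - s : ℝ≥0) + y)
        + growthRate lam (a i) * ((T : ℝ) - t)) =
      (c i * Real.exp (a i * (noise W lam t s ω - normSq lam * (T - s : ℝ≥0))
        + growthRate lam (a i) * ((T : ℝ) - t))) * Real.exp (a i * y) := fun i y => by
    rw [mul_assoc, ← Real.exp_add]
    ring_nf
  simp only [e]
  have hi : ∀ i, Integrable (fun y => (c i * Real.exp (a i * (noise W lam t s ω -
      normSq lam * (T - s : ℝ≥0)) + growthRate lam (a i) * ((T : ℝ) - t))) * Real.exp (a i * y))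
      (gaussianReal 0 (normSq lam * (T - s))) := fun i =>
    (integrable_exp_mul_gaussianReal (a i)).const_mul _
  rw [integral_add (integrable_const _) (integrable_finsetSum _ fun i _ => hi i),
    integral_finsetSum _ fun i _ => hi i]
  simp only [integral_const_mul, integral_exp_mul_gaussianReal, integral_const, probReal_univ,
    one_smul]
  simp only [mul_assoc, ← Real.exp_add]
  congr 1
  refine Finset.sum_congr rfl fun i _ => ?_
  rw [expo]
  congr 2
  rw [growthRate]
  push_cast [NNReal.coe_sub hsT]
  ring

/-- Nonnegative exponential payoffs are replicated by admissible strategies. -/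
theorem exists_isAdmissible_expo (hW : IsStandardBrownianMotion W P)
    {σ : Matrix (Fin N) (Fin N) ℝ} (hσ : IsUnit σ) (lam : Fin N → ℝ) {t T : ℝ≥0} (htT : t ≤ T)
    (K : ℝ) (hpos : ∀ b, 0 ≤ K + ∑ i ∈ I, c i * Real.exp (a i * b +
      growthRate lam (a i) * ((T : ℝ) - t))) :
    ∃ (π : ℝ≥0 → Ω → Fin N → ℝ) (X : ℝ≥0 → Ω → ℝ),
      IsAdmissible P (brownianFiltration W hW.measurable) W σ lam t T (K + ∑ i ∈ I, c i) π X ∧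
      ∀ ω, X T ω = K + ∑ i ∈ I, c i * Real.exp (a i * noise W lam t T ω +
        growthRate lam (a i) * ((T : ℝ) - t)) := by
  set x : ℝ := K + ∑ i ∈ I, c i with hx
  set X : ℝ≥0 → Ω → ℝ := fun s ω => K + ∑ i ∈ I, c i * expo W lam (a i) t s ω with hX
  set φ : ℝ≥0 → Ω → Fin N → ℝ := fun v ω j => exposure I c a W lam t v ω * lam j with hφ
  have hφp := isProgressive_exposure I c a hW.measurable lam lam t
  have hφm := measurable_stopped_of_isProgressive hφp T
  have hφsq := sqIntegral_exposure_lt_top I c a hW lam lam t T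
  -- Formally `d expo = a · expo · λ·(dW + λ dv)`, so the required `σπ` is a scalar multiple of `λ`,
  -- and `π` the same multiple of `σ⁻¹λ`.
  have hσπ : (fun v ω => σ *ᵥ fun j => exposure I c a W lam t v ω * (σ⁻¹ *ᵥ lam) j) = φ := by
    ext v ω j
    have h1 : (fun j => exposure I c a W lam t v ω * (σ⁻¹ *ᵥ lam) j) =
        exposure I c a W lam t v ω • (σ⁻¹ *ᵥ lam) := rfl
    rw [h1, mulVec_smul, mulVec_mulVec, Matrix.mul_nonsing_inv _ ((isUnit_iff_isUnit_det σ).1 hσ),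
      one_mulVec]
    rfl
  have hG : ∀ s, Measurable fun ω => ∑ i ∈ I, c i * expo W lam (a i) t s ω - ∑ i ∈ I, c i :=
    fun s => (Finset.measurable_fun_sum _ fun i _ =>
      (measurable_expo hW.measurable lam (a i) t s).const_mul _).sub_const _
  -- The Itô integral is defined as explicit gain minus drift; the truncated Riemann processes
  -- witness both convergences.
  have hito : IsItoIntegral P (brownianFiltration W hW.measurable) W t T φ
      (fun s ω => (∑ i ∈ I, c i * expo W lam (a i) t s ω - ∑ i ∈ I, c i) -
        ∫ v in (t : ℝ)..s, φ v.toNNReal ω ⬝ᵥ lam) :=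
    ⟨fun s hs => ((hG s).sub
      (measurable_intervalIntegral_dotProduct (P := P) hs.1 hs.2 hφm lam)).aemeasurable,
      riemannProcess I c a hW.measurable lam t T,
      tendsto_sqIntegral_riemannProcess I c a hW lam htT, fun s hs =>
      tendsto_integral_sub (φ := φ) hW hs.1 hs.2
        (ae_intervalIntegrable_dotProduct (P := P) hs.1 hs.2 hφm hφsq lam) (hG s)
        (tendsto_sqIntegral_riemannProcess I c a hW lam htT)
        (tendsto_riemannProcess_total I c a hW lam hs.1 hs.2)⟩
  refine ⟨fun v ω j => exposure I c a W lam t v ω * (σ⁻¹ *ᵥ lam) j, X, ?_, fun ω => rfl⟩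
  refine ⟨isProgressive_exposure I c a hW.measurable lam _ t,
    sqIntegral_exposure_lt_top I c a hW lam _ t T, ?_, ?_, ?_⟩
  · filter_upwards [ae_continuous hW] with ω hω
    refine Continuous.continuousOn ?_
    simp only [hX, expo, noise, increment]
    fun_prop
  · refine ⟨_, by rw [hσπ]; exact hito, fun s hs => Eventually.of_forall fun ω => ?_⟩
    have h2 : ∀ v, σ *ᵥ (fun j => exposure I c a W lam t v ω * (σ⁻¹ *ᵥ lam) j) = φ v ω :=
      fun v => congrFun (congrFun hσπ v) ω
    simp only [h2, hX, hx]
    ring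
  · refine Eventually.of_forall fun ω s hs => ?_
    simp only [hX]
    -- Intermediate wealth is a Gaussian average of the nonnegative terminal payoff, hence
    -- nonnegative.
    rw [expo_sum_eq_integral I c a lam K hs.2]
    exact integral_nonneg fun y => hpos _

end Replication

/-! ### Density of exponential sums -/

section Density

/-- Finite exponential moments make the complex moment generating function analytic, so its real
restriction determines it, and it determines the measure. -/
lemma ext_of_integral_exp {μ ν : Measure ℝ} [IsFiniteMeasure μ] [IsFiniteMeasure ν]
    (hμ : ∀ a : ℝ, Integrable (fun x => Real.exp (a * x)) μ)
    (h : ∀ a : ℝ, ∫ x, Real.exp (a * x) ∂μ = ∫ x, Real.exp (a * x) ∂ν) : μ = ν := by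
  have hmgf : mgf id μ = mgf id ν := funext fun a => h a
  have h0 : μ = 0 ↔ ν = 0 := by
    have h1 := h 0
    simp only [zero_mul, Real.exp_zero, integral_const, smul_eq_mul, mul_one] at h1
    rw [← Measure.measure_univ_eq_zero, ← Measure.measure_univ_eq_zero (μ := ν),
      ← measureReal_eq_zero_iff, ← measureReal_eq_zero_iff, h1]
  have hset : integrableExpSet id μ = univ := eq_univ_of_forall fun a => hμ a
  refine Measure.ext_of_complexMGF_id_eq (funext fun z => ?_)
  exact eqOn_complexMGF_of_mgf' hmgf h0 (by simp [hset])

/-- A square integrable function orthogonal to all exponentials vanishes. -/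
lemma ae_eq_zero_of_integral_mul_exp {ρ : Measure ℝ} [IsFiniteMeasure ρ]
    (hρ : ∀ a : ℝ, Integrable (fun x => Real.exp (a * x)) ρ) {g : ℝ → ℝ} (hg : MemLp g 2 ρ)
    (h : ∀ a : ℝ, ∫ x, g x * Real.exp (a * x) ∂ρ = 0) : g =ᵐ[ρ] 0 := by
  have hgi : Integrable g ρ := hg.integrable (by norm_num)
  have hexp : ∀ a : ℝ, MemLp (fun x => Real.exp (a * x)) 2 ρ := fun a => by
    rw [memLp_two_iff_integrable_sq (by fun_prop)]
    refine (hρ (2 * a)).congr (Eventually.of_forall fun x => ?_)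
    simp only [← Real.exp_nat_mul]
    congr 1
    push_cast
    ring
  have hm1 : AEMeasurable (fun x => (g x).toNNReal) ρ := hgi.1.aemeasurable.real_toNNReal
  have hm2 : AEMeasurable (fun x => (-g x).toNNReal) ρ := hgi.1.aemeasurable.neg.real_toNNReal
  have f1 : IsFiniteMeasure (ρ.withDensity fun x => ((g x).toNNReal : ℝ≥0∞)) :=
    isFiniteMeasure_withDensity_ofReal hgi.2
  have f2 : IsFiniteMeasure (ρ.withDensity fun x => ((-g x).toNNReal : ℝ≥0∞)) :=
    isFiniteMeasure_withDensity_ofReal hgi.neg.2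
  have i0 : ∀ a : ℝ, Integrable (fun x => g x * Real.exp (a * x)) ρ := fun a =>
    hg.integrable_mul (hexp a)
  have habs : ∀ (a : ℝ) (u : ℝ → ℝ≥0), AEMeasurable u ρ → (∀ x, (u x : ℝ) ≤ |g x|) →
      Integrable (fun x => (u x : ℝ) * Real.exp (a * x)) ρ := fun a u hu hle => by
    refine (i0 a).norm.mono' (by fun_prop) (Eventually.of_forall fun x => ?_)
    rw [norm_mul, norm_mul, Real.norm_of_nonneg (NNReal.coe_nonneg _)]
    exact mul_le_mul_of_nonneg_right (hle x) (norm_nonneg _)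
  have b1 : ∀ x, ((g x).toNNReal : ℝ) ≤ |g x| := fun x => by
    rw [Real.coe_toNNReal']; exact max_le (le_abs_self _) (abs_nonneg _)
  have b2 : ∀ x, ((-g x).toNNReal : ℝ) ≤ |g x| := fun x => by
    rw [Real.coe_toNNReal']; exact max_le (neg_le_abs _) (abs_nonneg _)
  -- The positive and negative parts of `g` define finite measures with equal exponential moments,
  -- so these measures coincide.
  have key : (ρ.withDensity fun x => ((g x).toNNReal : ℝ≥0∞)) =
      ρ.withDensity fun x => ((-g x).toNNReal : ℝ≥0∞) := by
    refine ext_of_integral_exp (fun a => ?_) fun a => ?_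
    · rw [integrable_withDensity_iff_integrable_smul₀ hm1]
      exact habs a _ hm1 b1
    · rw [integral_withDensity_eq_integral_smul₀ hm1, integral_withDensity_eq_integral_smul₀ hm2]
      simp only [NNReal.smul_def, smul_eq_mul]
      rw [← sub_eq_zero, ← integral_sub (habs a _ hm1 b1) (habs a _ hm2 b2), ← h a]
      refine integral_congr_ae (Eventually.of_forall fun x => ?_)
      simp only [Real.coe_toNNReal']
      rw [← sub_mul]
      congr 1
      rcases le_total 0 (g x) with hx | hx
      · rw [max_eq_left hx, max_eq_right (by linarith), sub_zero]
      · rw [max_eq_right hx, max_eq_left (by linarith)]; ring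
  have hne : ∫⁻ x, ((g x).toNNReal : ℝ≥0∞) ∂ρ ≠ ∞ := by
    have := f1.measure_univ_lt_top
    rw [withDensity_apply _ MeasurableSet.univ, Measure.restrict_univ] at this
    exact this.ne
  have h3 := (withDensity_eq_iff hm1.coe_nnreal_ennreal hm2.coe_nnreal_ennreal hne).1 key
  filter_upwards [h3] with x hx
  have hx' : (g x).toNNReal = (-g x).toNNReal := by exact_mod_cast hx
  rcases le_total 0 (g x) with h5 | h5
  · rw [Real.toNNReal_of_nonpos (by linarith : -g x ≤ 0), Real.toNNReal_eq_zero] at hx'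
    exact le_antisymm hx' h5
  · rw [Real.toNNReal_of_nonpos h5, eq_comm, Real.toNNReal_eq_zero] at hx'
    exact le_antisymm h5 (neg_nonpos.1 hx')

/-- Nonnegative integrable functions are approximated by squares of exponential sums. -/
lemma exists_sq_exp_sum {ρ : Measure ℝ} [IsFiniteMeasure ρ]
    (hρ : ∀ a : ℝ, Integrable (fun x => Real.exp (a * x)) ρ) {G : ℝ → ℝ} (hG : Integrable G ρ)
    (h0 : ∀ x, 0 ≤ G x) {η : ℝ} (hη : 0 < η) :
    ∃ d : ℝ →₀ ℝ, MemLp (fun x => ∑ a ∈ d.support, d a * Real.exp (a * x)) 2 ρ ∧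
      ∫ x, |(∑ a ∈ d.support, d a * Real.exp (a * x)) ^ 2 - G x| ∂ρ < η := by
  have hexp : ∀ a : ℝ, MemLp (fun x => Real.exp (a * x)) 2 ρ := fun a => by
    rw [memLp_two_iff_integrable_sq (by fun_prop)]
    refine (hρ (2 * a)).congr (Eventually.of_forall fun x => ?_)
    simp only [← Real.exp_nat_mul]
    congr 1
    push_cast
    ring
  let e : ℝ → Lp ℝ 2 ρ := fun a => (hexp a).toLp
  -- Density in `L²` by duality: the orthogonal complement of the exponentials is trivial.
  have hdense : (Submodule.span ℝ (range e)).topologicalClosure = ⊤ := by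
    rw [Submodule.topologicalClosure_eq_top_iff, Submodule.eq_bot_iff]
    intro g hg
    rw [Submodule.mem_orthogonal] at hg
    rw [Lp.eq_zero_iff_ae_eq_zero]
    refine ae_eq_zero_of_integral_mul_exp hρ (Lp.memLp g) fun a => ?_
    have h1 := hg (e a) (Submodule.subset_span (mem_range_self a))
    rw [L2.inner_def] at h1
    rw [← h1]
    refine integral_congr_ae ?_
    filter_upwards [(hexp a).coeFn_toLp] with x hx
    simp only [e, hx]
    simp
  -- Approximating `√G` in `L²` and then squaring gives approximants of `G` in `L¹` that are
  -- automatically nonnegative.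
  have hf : MemLp (fun x => √(G x)) 2 ρ := by
    rw [memLp_two_iff_integrable_sq (hG.1.aemeasurable.sqrt).aestronglyMeasurable]
    exact hG.congr (Eventually.of_forall fun x => (Real.sq_sqrt (h0 x)).symm)
  set A := ∫ x, √(G x) ^ 2 ∂ρ with hA
  have hA0 : 0 ≤ A := integral_nonneg fun _ => sq_nonneg _
  -- From `|q² - G| ≤ (q - √G)² + 2√G |q - √G|`: an `L²` error `δ` costs at most `δ² + 2√A δ` in
  -- `L¹`, by Cauchy–Schwarz.
  obtain ⟨δ, hδ, hδη⟩ : ∃ δ : ℝ, 0 < δ ∧ δ ^ 2 + 2 * (√A * δ) < η := by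
    have h1 : Tendsto (fun δ : ℝ => δ ^ 2 + 2 * (√A * δ)) (𝓝[>] 0) (𝓝 0) := by
      refine tendsto_nhdsWithin_of_tendsto_nhds ?_
      exact Continuous.tendsto' (by fun_prop) _ _ (by simp)
    obtain ⟨δ, h2, h3⟩ := ((h1.eventually (gt_mem_nhds hη)).and self_mem_nhdsWithin).exists
    exact ⟨δ, h3, h2⟩
  have hmem : hf.toLp ∈ closure (Submodule.span ℝ (range e) : Set (Lp ℝ 2 ρ)) := by
    rw [← Submodule.topologicalClosure_coe, hdense]
    trivial
  obtain ⟨q, hq, hdist⟩ := Metric.mem_closure_iff.1 hmem δ hδ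
  obtain ⟨d, rfl⟩ := Finsupp.mem_span_range_iff_exists_finsupp.1 hq
  have hqL : MemLp (fun x => ∑ a ∈ d.support, d a * Real.exp (a * x)) 2 ρ :=
    memLp_finsetSum _ fun a _ => (hexp a).const_mul _
  have hqe : d.sum (fun a r => r • e a) = hqL.toLp := by
    ext1
    refine EventuallyEq.trans ?_ hqL.coeFn_toLp.symm
    rw [Finsupp.sum]
    refine (Lp.coeFn_finsetSum _ _).trans ?_
    have h1 : ∀ᵐ x ∂ρ, ∀ a ∈ d.support, (d a • e a : Lp ℝ 2 ρ) x = d a * Real.exp (a * x) := by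
      refine (Finset.eventually_all _).2 fun a _ => ?_
      filter_upwards [Lp.coeFn_smul (d a) (e a), (hexp a).coeFn_toLp] with x h2 h3
      rw [h2, Pi.smul_apply, smul_eq_mul]
      simp only [e, h3]
    filter_upwards [h1] with x hx
    rw [Finset.sum_apply]
    exact Finset.sum_congr rfl fun a ha => hx a ha
  rw [hqe, dist_comm, dist_eq_norm, ← MemLp.toLp_sub] at hdist
  set q : ℝ → ℝ := fun x => ∑ a ∈ d.support, d a * Real.exp (a * x) with hqdef
  have hD : MemLp (fun x => q x - √(G x)) 2 ρ := hqL.sub hf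
  have hB : ∫ x, (q x - √(G x)) ^ 2 ∂ρ < δ ^ 2 := by
    have h1 : ‖hD.toLp‖ ^ 2 = ∫ x, (q x - √(G x)) ^ 2 ∂ρ := by
      rw [← real_inner_self_eq_norm_sq, L2.inner_def]
      refine integral_congr_ae ?_
      filter_upwards [hD.coeFn_toLp] with x hx
      rw [hx, real_inner_self_eq_norm_sq, Real.norm_eq_abs, sq_abs]
    rw [← h1]
    exact pow_lt_pow_left₀ hdist (norm_nonneg _) two_ne_zero
  refine ⟨d, hqL, ?_⟩
  have hfD : Integrable (fun x => √(G x) * |q x - √(G x)|) ρ := hf.integrable_mul hD.abs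
  have h2 : ∫ x, √(G x) * |q x - √(G x)| ∂ρ ≤ √A * δ := by
    refine abs_le_of_sq_le_sq ?_ (by positivity) |> fun h => (le_abs_self _).trans h
    have h3 := sq_integral_mul_le hf hD.abs
    have h4 : ∫ x, |q x - √(G x)| ^ 2 ∂ρ = ∫ x, (q x - √(G x)) ^ 2 ∂ρ := by simp only [sq_abs]
    rw [mul_pow, Real.sq_sqrt hA0]
    exact h3.trans (mul_le_mul_of_nonneg_left (h4.le.trans hB.le) hA0)
  calc ∫ x, |q x ^ 2 - G x| ∂ρ
      ≤ ∫ x, ((q x - √(G x)) ^ 2 + 2 * (√(G x) * |q x - √(G x)|)) ∂ρ := by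
        refine integral_mono (hqL.integrable_sq.sub hG).abs
          (hD.integrable_sq.fun_add (hfD.const_mul 2)) fun x => ?_
        have h3 : q x ^ 2 - G x = (q x - √(G x)) ^ 2 + 2 * (√(G x) * (q x - √(G x))) := by
          nth_rewrite 1 [← Real.sq_sqrt (h0 x)]
          ring
        simp only [h3]
        refine (abs_add_le _ _).trans_eq ?_
        rw [abs_of_nonneg (sq_nonneg _), abs_mul, abs_mul, abs_two,
          abs_of_nonneg (Real.sqrt_nonneg _)]
    _ = ∫ x, (q x - √(G x)) ^ 2 ∂ρ + 2 * ∫ x, √(G x) * |q x - √(G x)| ∂ρ := by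
        rw [integral_add hD.integrable_sq (hfD.const_mul 2), integral_const_mul]
    _ < η := by linarith

end Density

/-! ### Bounds for the value function -/

section Value

variable {Ω : Type*} [mΩ : MeasurableSpace Ω] {N : ℕ} {P : Measure Ω}
  {W : Fin N → ℝ≥0 → Ω → ℝ} {U : ℝ → ℝ}

lemma extUtility_le {U : ℝ → ℝ} {x B C : ℝ} (hx : 0 ≤ x)
    (h : ∀ w, 0 < w → U w ≤ B + C * w) : extUtility U x ≤ ((B + C * x : ℝ) : EReal) := by
  rcases hx.eq_or_lt with rfl | hx
  · rw [extUtility, if_neg (lt_irrefl _)]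
    have hlim : Tendsto (fun w : ℝ => ((B + C * w : ℝ) : EReal)) (𝓝[>] 0)
        (𝓝 ((B + C * 0 : ℝ) : EReal)) :=
      (continuous_coe_real_ereal.tendsto _).comp
        (tendsto_nhdsWithin_of_tendsto_nhds (Continuous.tendsto (by fun_prop) 0))
    refine ge_of_tendsto hlim ?_
    filter_upwards [self_mem_nhdsWithin] with w hw
    exact (iInf_le _ (⟨w, hw⟩ : Ioi (0 : ℝ))).trans (EReal.coe_le_coe_iff.2 (h w hw))
  · rw [extUtility, if_pos hx]
    exact EReal.coe_le_coe_iff.2 (h x hx)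

lemma coe_lintegral_sub_eq_integral {B : Ω → ℝ} (hB : Integrable B P) :
    ((∫⁻ ω, ENNReal.ofReal (B ω) ∂P : ℝ≥0∞) : EReal) -
      ((∫⁻ ω, ENNReal.ofReal (-B ω) ∂P : ℝ≥0∞) : EReal) = ((∫ ω, B ω ∂P : ℝ) : EReal) := by
  have h1 : ∫⁻ ω, ENNReal.ofReal (B ω) ∂P ≠ ∞ := hB.lintegral_lt_top.ne
  have h2 : ∫⁻ ω, ENNReal.ofReal (-B ω) ∂P ≠ ∞ := hB.neg.lintegral_lt_top.ne
  rw [integral_eq_lintegral_pos_part_sub_lintegral_neg_part hB, EReal.coe_sub,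
    EReal.coe_ennreal_toReal h1, EReal.coe_ennreal_toReal h2]

lemma expectedUtility_le_integral {X B : Ω → ℝ} (hB : Integrable B P)
    (h : ∀ᵐ ω ∂P, extUtility U (X ω) ≤ (B ω : EReal)) :
    expectedUtility P U X ≤ ((∫ ω, B ω ∂P : ℝ) : EReal) := by
  rw [← coe_lintegral_sub_eq_integral hB]
  refine EReal.sub_le_sub (EReal.coe_ennreal_le_coe_ennreal_iff.2 (lintegral_mono_ae ?_))
    (EReal.coe_ennreal_le_coe_ennreal_iff.2 (lintegral_mono_ae ?_))
  · filter_upwards [h] with ω hω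
    refine (EReal.toENNReal_le_toENNReal hω).trans_eq ?_
    simp
  · filter_upwards [h] with ω hω
    refine le_trans (le_of_eq ?_) (EReal.toENNReal_le_toENNReal (EReal.neg_le_neg_iff.2 hω))
    rw [← EReal.coe_neg]
    simp

lemma expectedUtility_eq_integral {X : Ω → ℝ} (hX : ∀ ω, 0 < X ω)
    (hB : Integrable (fun ω => U (X ω)) P) :
    expectedUtility P U X = ((∫ ω, U (X ω) ∂P : ℝ) : EReal) := by
  rw [← coe_lintegral_sub_eq_integral hB, expectedUtility]
  have e : ∀ ω, extUtility U (X ω) = (U (X ω) : EReal) := fun ω => by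
    rw [extUtility, if_pos (hX ω)]
  simp only [e, ← EReal.coe_neg]
  simp

lemma IsUtility.continuousOn (hU : IsUtility U) : ContinuousOn U (Ioi 0) := hU.contDiffOn.continuousOn

lemma continuous_utility_terminalH (hU : IsUtility U) : Continuous fun s => U (terminalH U s) :=
  hU.continuousOn.comp_continuous (terminalH_continuous hU) fun s => terminalH_pos hU s

variable (hU : IsUtility U) (hH : IsTerminalProfile (terminalH U) (fun z => riskTol U (terminalH U z)))
include hU hH

/-- Two tangent inequalities, at `1` and at `H`, bound `U(H)` above by a multiple of `H` and below
by `-U'(H) = -e^{-(c+y)}`, up to constants; both are Gaussian integrable. -/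
lemma integrable_utility_terminalH (v : ℝ≥0) (c : ℝ) :
    Integrable (fun y => U (terminalH U (c + y))) (gaussianReal 0 v) := by
  have i1 := hH.integrable 0 v c
  have i2 : Integrable (fun y => Real.exp (-c) * Real.exp (-1 * y)) (gaussianReal 0 v) :=
    (integrable_exp_mul_gaussianReal (-1)).const_mul _
  refine (((integrable_const |U 1|).fun_add
    ((i1.add (integrable_const 1)).const_mul (deriv U 1))).fun_add i2).mono'
    ((continuous_utility_terminalH hU).comp (continuous_const_add c)).aestronglyMeasurable
    (Eventually.of_forall fun y => ?_)
  have hp := terminalH_pos hU (c + y)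
  have h1 := hU.le_tangent one_pos hp
  have h2 := hU.le_tangent hp one_pos
  rw [deriv_terminalH hU] at h2
  have h3 := hU.deriv_pos one_pos
  have h4 : Real.exp (-c) * Real.exp (-1 * y) = Real.exp (-(c + y)) := by
    rw [← Real.exp_add]; ring_nf
  have h5 := Real.exp_pos (-(c + y))
  have h6 : 0 ≤ Real.exp (-(c + y)) * terminalH U (c + y) := by positivity
  have h7 : 0 ≤ deriv U 1 * terminalH U (c + y) := by positivity
  simp only [Pi.add_apply]
  rw [h4, Real.norm_eq_abs, abs_le]
  constructor
  · linarith [neg_abs_le (U 1)]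
  · linarith [le_abs_self (U 1)]

/-- The optimal expected utility as a function of the dual variable. -/
def dualValue (U : ℝ → ℝ) (v : ℝ≥0) (z : ℝ) : ℝ :=
  ∫ b, U (terminalH U (z + v + b)) ∂gaussianReal 0 v

/-- The marginal utility of initial wealth as a function of the dual variable. -/
def dualMarginal (v : ℝ≥0) (z : ℝ) : ℝ := Real.exp (-z - v / 2)

omit hU in
lemma integrable_kernel_mul (v : ℝ≥0) (z : ℝ) :
    Integrable (fun b => Real.exp (-b - v / 2) * terminalH U (z + v + b)) (gaussianReal 0 v) := by
  obtain ⟨C, δ, h⟩ := hH.exists_bound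
  have h1 : Integrable (fun y => C * (Real.exp (-v / 2) * Real.exp (-1 * y) +
      Real.exp (-v / 2 + δ * (z + v)) * Real.exp ((δ - 1) * y))) (gaussianReal 0 v) :=
    (((integrable_exp_mul_gaussianReal _).const_mul _).add
      ((integrable_exp_mul_gaussianReal _).const_mul _)).const_mul _
  have := hH.continuous
  refine h1.mono' (by fun_prop) (Eventually.of_forall fun y => ?_)
  rw [norm_mul, Real.norm_of_nonneg (Real.exp_pos _).le]
  refine (mul_le_mul_of_nonneg_left (h _) (Real.exp_pos _).le).trans_eq ?_
  rw [mul_left_comm, mul_add, mul_one, ← Real.exp_add, ← Real.exp_add, ← Real.exp_add]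
  ring_nf

omit hH in
-- The tangent at the candidate optimum has slope `e^{-(z+v+b)}`, which factors into the multiplier
-- `dualMarginal v z` and the state price `e^{-b-v/2}`.
lemma utility_le_dual (v : ℝ≥0) (z b : ℝ) {w : ℝ} (hw : 0 < w) :
    U w ≤ U (terminalH U (z + v + b)) +
      dualMarginal v z * Real.exp (-b - v / 2) * (w - terminalH U (z + v + b)) := by
  have h := hU.le_tangent (terminalH_pos hU (z + v + b)) hw
  rw [deriv_terminalH hU] at h
  refine h.trans_eq ?_
  rw [dualMarginal, ← Real.exp_add]
  ring_nf

omit hU in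
-- By Cameron–Martin, pricing undoes the shift by `v`; so the candidate terminal wealth costs
-- exactly `heat H v z`.
lemma integral_kernel_mul (v : ℝ≥0) (z : ℝ) :
    ∫ b, Real.exp (-b - v / 2) * terminalH U (z + v + b) ∂gaussianReal 0 v =
      heat (terminalH U) v z := by
  rw [heat, ← integral_exp_mul_comp_add (fun b => terminalH U (z + b)) v]
  simp only [add_assoc]

/-- The supergradient inequality for the dual value. -/
lemma dualValue_le (v : ℝ≥0) (z1 z2 : ℝ) :
    dualValue U v z2 ≤ dualValue U v z1 +
      dualMarginal v z1 * (heat (terminalH U) v z2 - heat (terminalH U) v z1) := by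
  have i1 := integrable_kernel_mul hH v z1
  have i2 := integrable_kernel_mul hH v z2
  have h := integral_mono (integrable_utility_terminalH hU hH v (z2 + v))
    ((integrable_utility_terminalH hU hH v (z1 + v)).fun_add
      ((i2.sub i1).const_mul (dualMarginal v z1))) fun b => by
        refine (utility_le_dual hU v z1 b (terminalH_pos hU (z2 + v + b))).trans_eq ?_
        simp only [Pi.sub_apply]
        ring
  rw [integral_add (integrable_utility_terminalH hU hH v (z1 + v))
    ((i2.sub i1).const_mul (dualMarginal v z1)), integral_const_mul] at h
  simp only [Pi.sub_apply] at h
  rw [integral_sub i2 i1, integral_kernel_mul hH, integral_kernel_mul hH] at h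
  exact h

variable [IsProbabilityMeasure P] {σ : Matrix (Fin N) (Fin N) ℝ} {lam : Fin N → ℝ} {t T : ℝ≥0}

/-- Duality bound for the value function. -/
lemma valueE_le (hW : IsStandardBrownianMotion W P) (htT : t ≤ T) (x z : ℝ) :
    valueE P (brownianFiltration W hW.measurable) W σ lam T U x t ≤
      ((dualValue U (normSq lam * (T - t)) z + dualMarginal (normSq lam * (T - t)) z *
        (x - heat (terminalH U) (normSq lam * (T - t)) z) : ℝ) : EReal) := by
  set v := normSq lam * (T - t) with hv
  refine iSup_le fun π => iSup_le fun X => iSup_le fun h => ?_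
  have hnm := measurable_noise hW.measurable lam t T
  have hHm := hH.continuous.measurable
  have hUm := (continuous_utility_terminalH hU).measurable
  have i1 : Integrable (fun ω => U (terminalH U (z + v + noise W lam t T ω))) P :=
    integrable_comp_noise hW lam htT (f := fun b => U (terminalH U (z + v + b)))
      (hUm.comp (measurable_const_add _)) (integrable_utility_terminalH hU hH v _)
  have e1 : ∫ ω, U (terminalH U (z + v + noise W lam t T ω)) ∂P = dualValue U v z :=
    integral_comp_noise hW lam htT (f := fun b => U (terminalH U (z + v + b)))
      (hUm.comp (measurable_const_add _))
  have hkm : Measurable fun b : ℝ => Real.exp (-b - v / 2) * terminalH U (z + v + b) := by fun_prop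
  have i2 : Integrable (fun ω => pricing W lam t T ω *
      terminalH U (z + v + noise W lam t T ω)) P :=
    integrable_comp_noise hW lam htT
      (f := fun b => Real.exp (-b - v / 2) * terminalH U (z + v + b)) hkm
      (integrable_kernel_mul hH v z)
  have e2 : ∫ ω, pricing W lam t T ω * terminalH U (z + v + noise W lam t T ω) ∂P =
      heat (terminalH U) v z :=
    (integral_comp_noise hW lam htT
      (f := fun b => Real.exp (-b - v / 2) * terminalH U (z + v + b)) hkm).trans
      (integral_kernel_mul hH v z)
  have i3 : Integrable (fun ω => pricing W lam t T ω * X T ω) P :=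
    (memLp_pricing hW lam htT).integrable_mul (h.memLp hW htT)
  have e3 := h.integral_pricing_mul hW htT
  have i4 : Integrable (fun ω => U (terminalH U (z + v + noise W lam t T ω)) +
      dualMarginal v z * (pricing W lam t T ω * X T ω - pricing W lam t T ω *
        terminalH U (z + v + noise W lam t T ω))) P :=
    i1.fun_add ((i3.sub i2).const_mul _)
  have i5 : Integrable (fun ω => pricing W lam t T ω * X T ω - pricing W lam t T ω *
      terminalH U (z + v + noise W lam t T ω)) P := i3.sub i2
  refine (expectedUtility_le_integral i4 ?_).trans_eq ?_
  · filter_upwards [h.nonneg] with ω hω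
    refine (extUtility_le (B := U (terminalH U (z + v + noise W lam t T ω)) -
      dualMarginal v z * pricing W lam t T ω * terminalH U (z + v + noise W lam t T ω))
      (C := dualMarginal v z * pricing W lam t T ω) (hω T ⟨htT, le_rfl⟩) fun w hw => ?_).trans_eq ?_
    · refine (utility_le_dual hU v z (noise W lam t T ω) hw).trans_eq ?_
      rw [pricing, ← NNReal.coe_mul, ← hv]
      ring
    · congr 1
      ring
  · rw [integral_add i1 (i5.const_mul _), integral_const_mul, integral_sub i3 i2, e1, e2, e3]

end Value

/-! ### Attaining the dual value with replicable payoffs. -/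

section LowerBound

variable {Ω : Type*} [mΩ : MeasurableSpace Ω] {N : ℕ} {P : Measure Ω}
  {W : Fin N → ℝ≥0 → Ω → ℝ} {U : ℝ → ℝ}

/-- On `[ε, ∞)` the utility is Lipschitz with constant `U'(ε)`, even if it tends to `-∞` at `0`. The
cash `K ≥ ε` keeps wealth in that region. -/
lemma IsUtility.sub_abs_le (hU : IsUtility U) {ε K w g : ℝ} (hε : 0 < ε) (hK : ε ≤ K)
    (hw : 0 ≤ w) (hg : 0 < g) : U g - deriv U ε * |w - g| ≤ U (K + w) := by
  have h1 : U g ≤ U (ε + g) :=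
    hU.strictMonoOn.monotoneOn (mem_Ioi.2 hg) (mem_Ioi.2 (by linarith)) (by linarith)
  have h2 : U (ε + g) ≤ U (ε + w) + deriv U (ε + w) * (ε + g - (ε + w)) :=
    hU.le_tangent (by linarith) (by linarith)
  have h3 : U (ε + w) ≤ U (K + w) :=
    hU.strictMonoOn.monotoneOn (mem_Ioi.2 (by linarith)) (mem_Ioi.2 (by linarith)) (by linarith)
  have h4 : deriv U (ε + w) ≤ deriv U ε :=
    hU.strictAntiOn_deriv.antitoneOn (mem_Ioi.2 hε) (mem_Ioi.2 (by linarith)) (by linarith)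
  have h5 : 0 < deriv U (ε + w) := hU.deriv_pos (by linarith)
  have h6 : deriv U (ε + w) * (ε + g - (ε + w)) ≤ deriv U ε * |w - g| := by
    refine (mul_le_mul_of_nonneg_left (?_ : _ ≤ |w - g|) h5.le).trans
      (mul_le_mul_of_nonneg_right h4 (abs_nonneg _))
    rw [abs_sub_comm]
    exact (by ring : ε + g - (ε + w) = g - w).le.trans (le_abs_self _)
  linarith

lemma integral_exp_mul_gaussianReal' (a m : ℝ) (v : ℝ≥0) :
    ∫ x, Real.exp (a * x) ∂gaussianReal m v = Real.exp (m * a + v * a ^ 2 / 2) := by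
  have h := congrFun (mgf_id_gaussianReal (μ := m) (v := v)) a
  simpa only [mgf, id] using h

/-- A square of an exponential sum is again an exponential sum, indexed by pairs. The factor
`e^{-f}` matches the normalisation of payoffs in `exists_isAdmissible_expo`. -/
lemma sq_exp_sum_eq (d : ℝ →₀ ℝ) (f : ℝ → ℝ) (b : ℝ) :
    ∑ p ∈ d.support ×ˢ d.support, d p.1 * d p.2 * Real.exp (-f (p.1 + p.2)) *
      Real.exp ((p.1 + p.2) * b + f (p.1 + p.2)) =
      (∑ a ∈ d.support, d a * Real.exp (a * b)) ^ 2 := by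
  rw [sq, Finset.sum_mul_sum, Finset.sum_product]
  refine Finset.sum_congr rfl fun i _ => Finset.sum_congr rfl fun j _ => ?_
  rw [mul_assoc, ← Real.exp_add, mul_mul_mul_comm, ← Real.exp_add]
  ring_nf

variable (hU : IsUtility U) (hH : IsTerminalProfile (terminalH U) (fun z => riskTol U (terminalH U z)))
include hU hH

/-- Initial wealth strictly above the cost of the ideal payoff pays for an approximating square and
leaves cash; letting the approximation error `η` tend to zero gives the bound. -/
lemma dualValue_le_valueE [IsProbabilityMeasure P] (hW : IsStandardBrownianMotion W P)
    {σ : Matrix (Fin N) (Fin N) ℝ} (hσ : IsUnit σ) {lam : Fin N → ℝ} {t T : ℝ≥0} (htT : t ≤ T)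
    {x z : ℝ} (hx : heat (terminalH U) (normSq lam * (T - t)) z < x) :
    (dualValue U (normSq lam * (T - t)) z : EReal) ≤
      valueE P (brownianFiltration W hW.measurable) W σ lam T U x t := by
  set v := normSq lam * (T - t) with hv
  have hvr : (v : ℝ) = normSq lam * ((T : ℝ) - t) := by
    rw [hv, NNReal.coe_mul, NNReal.coe_sub htT]
  -- Half of the surplus absorbs the pricing error, so at least the other half remains as cash.
  set ε := (x - heat (terminalH U) v z) / 2 with hε
  have hε0 : 0 < ε := by rw [hε]; linarith
  suffices key : ∀ η : ℝ, 0 < η → η ≤ ε → ((dualValue U v z - deriv U ε * η : ℝ) : EReal) ≤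
      valueE P (brownianFiltration W hW.measurable) W σ lam T U x t by
    have hlim : Tendsto (fun η : ℝ => ((dualValue U v z - deriv U ε * η : ℝ) : EReal)) (𝓝[>] 0)
        (𝓝 ((dualValue U v z - deriv U ε * 0 : ℝ) : EReal)) :=
      (continuous_coe_real_ereal.tendsto _).comp
        (tendsto_nhdsWithin_of_tendsto_nhds (Continuous.tendsto (by fun_prop) 0))
    rw [mul_zero, sub_zero] at hlim
    refine le_of_tendsto hlim ?_
    filter_upwards [self_mem_nhdsWithin, Ioc_mem_nhdsGT hε0] with η h1 h2 using key η h1 h2.2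
  intro η hη hηε
  set G : ℝ → ℝ := fun b => terminalH U (z + v + b) with hG
  have hGp : ∀ b, 0 < G b := fun b => terminalH_pos hU _
  have g0 : Integrable G (gaussianReal 0 v) := hH.integrable 0 v _
  have g1 : Integrable G (gaussianReal (-v) v) := hH.integrable (-v) v _
  -- `λ·(W_T - W_t)` has law `N(0,v)` under `P` and `N(-v,v)` under pricing. Approximating in `L¹`
  -- of the sum controls utility and cost at once.
  obtain ⟨d, hq, hqG⟩ := exists_sq_exp_sum (ρ := gaussianReal 0 v + gaussianReal (-v) v)
    (fun a => (integrable_exp_mul_gaussianReal a).add_measure (integrable_exp_mul_gaussianReal a))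
    (g0.add_measure g1) (fun b => (hGp b).le) hη
  set q : ℝ → ℝ := fun b => ∑ a ∈ d.support, d a * Real.exp (a * b) with hqdef
  have hqc : Continuous q := by rw [hqdef]; fun_prop
  have q0 : Integrable (fun b => q b ^ 2) (gaussianReal 0 v) := hq.integrable_sq.left_of_add_measure
  have q1 : Integrable (fun b => q b ^ 2) (gaussianReal (-v) v) :=
    hq.integrable_sq.right_of_add_measure
  have a0 : Integrable (fun b => |q b ^ 2 - G b|) (gaussianReal 0 v) := (q0.sub g0).abs
  have a1 : Integrable (fun b => |q b ^ 2 - G b|) (gaussianReal (-v) v) := (q1.sub g1).abs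
  rw [integral_add_measure a0 a1] at hqG
  have n0 : 0 ≤ ∫ b, |q b ^ 2 - G b| ∂gaussianReal 0 v := integral_nonneg fun _ => abs_nonneg _
  have n1 : 0 ≤ ∫ b, |q b ^ 2 - G b| ∂gaussianReal (-v) v := integral_nonneg fun _ => abs_nonneg _
  have hGint : ∫ b, G b ∂gaussianReal (-v) v = heat (terminalH U) v z := by
    have hmap : (gaussianReal 0 v).map (fun y => -(v : ℝ) + y) = gaussianReal (-v) v := by
      rw [gaussianReal_map_const_add, zero_add]
    have hGc : Continuous G := hH.continuous.comp (continuous_const_add _)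
    rw [← hmap, integral_map (measurable_const_add _).aemeasurable hGc.aestronglyMeasurable, heat]
    simp only [hG]
    congr 1
    ext y
    congr 1
    ring
  set f : ℝ → ℝ := fun a => growthRate lam a * ((T : ℝ) - t) with hf
  set I := d.support ×ˢ d.support
  set c : ℝ × ℝ → ℝ := fun p => d p.1 * d p.2 * Real.exp (-f (p.1 + p.2)) with hc
  have hsq : ∀ b, ∑ p ∈ I, c p * Real.exp ((p.1 + p.2) * b + growthRate lam (p.1 + p.2) *
      ((T : ℝ) - t)) = q b ^ 2 := fun b => sq_exp_sum_eq d f b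
  -- `growthRate` makes each normalised exponential have price one.
  have hprice : ∑ p ∈ I, c p = ∫ b, q b ^ 2 ∂gaussianReal (-v) v := by
    simp only [← hsq, Real.exp_add]
    rw [integral_finsetSum _ fun p _ =>
      ((integrable_exp_mul_gaussianReal _).mul_const _).const_mul _]
    refine Finset.sum_congr rfl fun p _ => ?_
    rw [integral_const_mul, integral_mul_const, integral_exp_mul_gaussianReal', ← Real.exp_add,
      growthRate, hvr]
    rw [show -(normSq lam * ((T : ℝ) - t)) * (p.1 + p.2) +
      normSq lam * ((T : ℝ) - t) * (p.1 + p.2) ^ 2 / 2 + ((p.1 + p.2) * normSq lam -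
      (p.1 + p.2) ^ 2 * normSq lam / 2) * ((T : ℝ) - t) = 0 by ring, Real.exp_zero, mul_one]
  have hcost : ∑ p ∈ I, c p ≤ heat (terminalH U) v z + η := by
    rw [hprice, ← hGint]
    have h1 : ∫ b, q b ^ 2 ∂gaussianReal (-v) v - ∫ b, G b ∂gaussianReal (-v) v ≤
        ∫ b, |q b ^ 2 - G b| ∂gaussianReal (-v) v := by
      rw [← integral_sub q1 g1]
      exact integral_mono (q1.sub g1) a1 fun b => le_abs_self _
    linarith
  set K := x - ∑ p ∈ I, c p with hK
  have hKε : ε ≤ K := by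
    have : x = heat (terminalH U) v z + 2 * ε := by rw [hε]; ring
    rw [hK]; linarith
  obtain ⟨π, X, hadm, hX⟩ := exists_isAdmissible_expo I c (fun p => p.1 + p.2) hW hσ lam htT K
    fun b => by rw [hsq]; nlinarith [sq_nonneg (q b)]
  rw [hK, sub_add_cancel] at hadm
  have hXT : ∀ ω, X T ω = K + q (noise W lam t T ω) ^ 2 := fun ω => by rw [hX, hsq]
  have hFm : Continuous fun b => U (K + q b ^ 2) :=
    hU.continuousOn.comp_continuous (by fun_prop) fun b =>
      mem_Ioi.2 (by nlinarith [sq_nonneg (q b)])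
  have hUG : Integrable (fun b => U (G b)) (gaussianReal 0 v) :=
    integrable_utility_terminalH hU hH v _
  have hlow : ∀ b, U (G b) - deriv U ε * |q b ^ 2 - G b| ≤ U (K + q b ^ 2) := fun b =>
    hU.sub_abs_le hε0 hKε (sq_nonneg _) (hGp b)
  have hupp : ∀ b, U (K + q b ^ 2) ≤ U 1 + deriv U 1 * ((K + q b ^ 2) - 1) := fun b =>
    hU.le_tangent one_pos (by nlinarith [sq_nonneg (q b)])
  have hlowi : Integrable (fun b => U (G b) - deriv U ε * |q b ^ 2 - G b|) (gaussianReal 0 v) :=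
    hUG.sub (a0.const_mul _)
  have hF : Integrable (fun b => U (K + q b ^ 2)) (gaussianReal 0 v) :=
    integrable_of_le_of_le hFm.aestronglyMeasurable (Eventually.of_forall hlow)
      (Eventually.of_forall hupp) hlowi
      ((integrable_const _).add ((((integrable_const K).fun_add q0).sub
        (integrable_const 1)).const_mul _))
  have hEU : expectedUtility P U (X T) =
      ((∫ b, U (K + q b ^ 2) ∂gaussianReal 0 v : ℝ) : EReal) := by
    rw [expectedUtility_eq_integral (fun ω => by rw [hXT]; nlinarith [sq_nonneg (q (noise W lam t T ω))])]
    · simp only [hXT]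
      rw [integral_comp_noise hW lam htT (f := fun b => U (K + q b ^ 2)) hFm.measurable]
    · simp only [hXT]
      exact integrable_comp_noise hW lam htT (f := fun b => U (K + q b ^ 2)) hFm.measurable hF
  have hval : dualValue U v z - deriv U ε * η ≤ ∫ b, U (K + q b ^ 2) ∂gaussianReal 0 v := by
    have h1 := integral_mono hlowi hF hlow
    rw [integral_sub hUG (a0.const_mul _), integral_const_mul] at h1
    have h2 : deriv U ε * ∫ b, |q b ^ 2 - G b| ∂gaussianReal 0 v ≤ deriv U ε * η :=
      mul_le_mul_of_nonneg_left (by linarith) (hU.deriv_pos hε0).le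
    have h3 : ∫ b, U (G b) ∂gaussianReal 0 v = dualValue U v z := rfl
    linarith
  refine (EReal.coe_le_coe_iff.2 hval).trans (hEU.symm.le.trans ?_)
  exact le_iSup_of_le π (le_iSup_of_le X (le_iSup_of_le hadm le_rfl))

end LowerBound

/-! ### Regularity of the value function -/

section Regularity

/-- A function with a continuous supergradient is differentiable. -/
lemma hasDerivAt_of_supergradient {f g : ℝ → ℝ}
    (h : ∀ x y, 0 < x → 0 < y → f y ≤ f x + g x * (y - x)) {x : ℝ} (hx : 0 < x)
    (hg : ContinuousAt g x) : HasDerivAt f (g x) x := by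
  rw [hasDerivAt_iff_isLittleO, Asymptotics.isLittleO_iff]
  intro ε hε
  filter_upwards [Ioi_mem_nhds hx, Metric.continuousAt_iff'.1 hg ε hε] with y hy hd
  have h1 := h x y hx hy
  have h2 := h y x hy hx
  rw [Real.dist_eq] at hd
  rw [smul_eq_mul, Real.norm_eq_abs, Real.norm_eq_abs]
  have h3 : |f y - f x - (y - x) * g x| ≤ |(g y - g x) * (y - x)| := by
    rw [abs_of_nonpos (by linarith), ← abs_neg]
    refine le_trans ?_ (le_abs_self _)
    linarith
  rw [abs_mul] at h3
  exact h3.trans (mul_le_mul_of_nonneg_right hd.le (abs_nonneg _))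

/-- The inverse of the strictly increasing function `heat H v`. -/
def heatInv (H : ℝ → ℝ) (v : ℝ≥0) : ℝ → ℝ := Function.invFun (heat H v)

variable {H H' : ℝ → ℝ}

lemma heat_heatInv (hH : IsTerminalProfile H H') (v : ℝ≥0) {x : ℝ} (hx : 0 < x) :
    heat H v (heatInv H v x) = x :=
  Function.invFun_eq (hH.heat_surj v hx)

lemma heatInv_heat (hH : IsTerminalProfile H H') (v : ℝ≥0) (z : ℝ) :
    heatInv H v (heat H v z) = z :=
  Function.leftInverse_invFun (hH.heat_strictMono v).injective z

lemma heatInv_monotoneOn (hH : IsTerminalProfile H H') (v : ℝ≥0) :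
    MonotoneOn (heatInv H v) (Ioi 0) := by
  intro x hx y hy hxy
  rw [← (hH.heat_strictMono v).le_iff_le, heat_heatInv hH v hx, heat_heatInv hH v hy]
  exact hxy

lemma hasDerivAt_heatInv (hH : IsTerminalProfile H H') (v : ℝ≥0) {x : ℝ} (hx : 0 < x) :
    HasDerivAt (heatInv H v) (heat H' v (heatInv H v x))⁻¹ x := by
  have hc : ContinuousAt (heatInv H v) x := by
    refine continuousAt_of_monotoneOn_of_image_mem_nhds (heatInv_monotoneOn hH v)
      (Ioi_mem_nhds hx) ?_
    rw [show heatInv H v '' Ioi 0 = univ from eq_univ_of_forall fun z =>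
      ⟨heat H v z, hH.heat_pos v z, heatInv_heat hH v z⟩]
    exact univ_mem
  refine HasDerivAt.of_local_left_inverse hc (hH.hasDerivAt_heat v _)
    (hH.heat_deriv_pos v _).ne' ?_
  filter_upwards [Ioi_mem_nhds hx] with y hy using heat_heatInv hH v hy

variable {Ω : Type*} [mΩ : MeasurableSpace Ω] {N : ℕ} {P : Measure Ω}
  {W : Fin N → ℝ≥0 → Ω → ℝ} {U : ℝ → ℝ}
  (hU : IsUtility U) (hH : IsTerminalProfile (terminalH U) (fun z => riskTol U (terminalH U z)))

/-- The value function expressed through the dual variable. -/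
def primalValue (U : ℝ → ℝ) (v : ℝ≥0) (x : ℝ) : ℝ := dualValue U v (heatInv (terminalH U) v x)

/-- The marginal value of wealth. -/
def primalMarginal (U : ℝ → ℝ) (v : ℝ≥0) (x : ℝ) : ℝ :=
  dualMarginal v (heatInv (terminalH U) v x)

include hH

lemma hasDerivAt_primalMarginal (v : ℝ≥0) {x : ℝ} (hx : 0 < x) :
    HasDerivAt (primalMarginal U v) (-primalMarginal U v x /
      heat (fun z => riskTol U (terminalH U z)) v (heatInv (terminalH U) v x)) x := by
  have h := (((hasDerivAt_heatInv hH v hx).neg).sub_const ((v : ℝ) / 2)).exp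
  refine h.congr_deriv ?_
  rw [primalMarginal, dualMarginal, div_eq_mul_inv]
  simp only [Pi.neg_apply]
  ring

include hU

lemma primalValue_le (v : ℝ≥0) (x y : ℝ) (hx : 0 < x) (hy : 0 < y) :
    primalValue U v y ≤ primalValue U v x + primalMarginal U v x * (y - x) := by
  have h := dualValue_le hU hH v (heatInv (terminalH U) v x) (heatInv (terminalH U) v y)
  rwa [heat_heatInv hH v hx, heat_heatInv hH v hy] at h

lemma hasDerivAt_primalValue (v : ℝ≥0) {x : ℝ} (hx : 0 < x) :
    HasDerivAt (primalValue U v) (primalMarginal U v x) x :=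
  hasDerivAt_of_supergradient (primalValue_le hU hH v) hx
    (hasDerivAt_primalMarginal hH v hx).continuousAt

variable [IsProbabilityMeasure P] {σ : Matrix (Fin N) (Fin N) ℝ} {lam : Fin N → ℝ} {t T : ℝ≥0}

/-- The dual bound is exact at the `z` with `heat H v z = x`. The lower bound needs a strict
surplus, so it is applied to `y < x`, and continuity of `primalValue` as `y ↑ x` finishes. -/
theorem valueE_eq (hW : IsStandardBrownianMotion W P) (hσ : IsUnit σ) (htT : t ≤ T) {x : ℝ}
    (hx : 0 < x) : valueE P (brownianFiltration W hW.measurable) W σ lam T U x t =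
      (primalValue U (normSq lam * (T - t)) x : EReal) := by
  refine le_antisymm ?_ ?_
  · have h := valueE_le (σ := σ) (lam := lam) hU hH hW htT x
      (heatInv (terminalH U) (normSq lam * (T - t)) x)
    rwa [heat_heatInv hH _ hx, sub_self, mul_zero, add_zero] at h
  · set v := normSq lam * (T - t)
    have hlim : Tendsto (fun y => ((primalValue U v y : ℝ) : EReal)) (𝓝[<] x)
        (𝓝 (primalValue U v x : EReal)) :=
      (continuous_coe_real_ereal.tendsto _).comp
        (tendsto_nhdsWithin_of_tendsto_nhds (hasDerivAt_primalValue hU hH v hx).continuousAt)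
    refine le_of_tendsto hlim ?_
    filter_upwards [Ioo_mem_nhdsLT hx] with y hy
    exact dualValue_le_valueE hU hH hW hσ htT (by rw [heat_heatInv hH v hy.1]; exact hy.2)

lemma deriv_valueE (hW : IsStandardBrownianMotion W P) (hσ : IsUnit σ) (htT : t ≤ T) {x : ℝ}
    (hx : 0 < x) :
    HasDerivAt (fun y => (valueE P (brownianFiltration W hW.measurable) W σ lam T U y t).toReal)
      (primalMarginal U (normSq lam * (T - t)) x) x := by
  refine (hasDerivAt_primalValue hU hH _ hx).congr_of_eventuallyEq ?_
  filter_upwards [Ioi_mem_nhds hx] with y hy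
  rw [valueE_eq hU hH hW hσ htT hy, EReal.toReal_coe]

lemma deriv_deriv_valueE (hW : IsStandardBrownianMotion W P) (hσ : IsUnit σ) (htT : t ≤ T) {x : ℝ}
    (hx : 0 < x) :
    HasDerivAt (deriv fun y =>
        (valueE P (brownianFiltration W hW.measurable) W σ lam T U y t).toReal)
      (-primalMarginal U (normSq lam * (T - t)) x / heat (fun z => riskTol U (terminalH U z))
        (normSq lam * (T - t)) (heatInv (terminalH U) (normSq lam * (T - t)) x)) x := by
  refine (hasDerivAt_primalMarginal hH _ hx).congr_of_eventuallyEq ?_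
  filter_upwards [Ioi_mem_nhds hx] with y hy
  exact (deriv_valueE hU hH hW hσ htT hy).deriv

theorem relRiskTolWellDefined_valueE (hW : IsStandardBrownianMotion W P) (hσ : IsUnit σ)
    (htT : t ≤ T) :
    RelRiskTolWellDefined (valueE P (brownianFiltration W hW.measurable) W σ lam T U) t := by
  refine ⟨fun x hx => ?_, ?_, fun x hx => ?_⟩
  · rw [valueE_eq hU hH hW hσ htT hx]
    exact ⟨EReal.coe_ne_top _, EReal.coe_ne_bot _⟩
  · set v := normSq lam * (T - t)
    set w : ℝ → ℝ := fun y =>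
      (valueE P (brownianFiltration W hW.measurable) W σ lam T U y t).toReal with hw
    have h1 : ∀ y, 0 < y → HasDerivAt w _ y := fun y hy => deriv_valueE hU hH hW hσ htT hy
    have h2 : ∀ y, 0 < y → HasDerivAt (deriv w) _ y := fun y hy =>
      deriv_deriv_valueE hU hH hW hσ htT hy
    have hcont : ContinuousOn (deriv (deriv w)) (Ioi 0) := by
      have hc : ContinuousOn (fun y => -primalMarginal U v y /
          heat (fun z => riskTol U (terminalH U z)) v (heatInv (terminalH U) v y)) (Ioi 0) := by
        refine ContinuousOn.div (fun y hy =>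
          (hasDerivAt_primalMarginal hH v hy).continuousAt.neg.continuousWithinAt) ?_
          fun y _ => (hH.heat_deriv_pos v _).ne'
        exact (hH.continuous_heat_deriv v).comp_continuousOn fun y hy =>
          (hasDerivAt_heatInv hH v hy).continuousAt.continuousWithinAt
      exact hc.congr fun y hy => (h2 y hy).deriv
    rw [show (2 : WithTop ℕ∞) = 1 + 1 by norm_num, contDiffOn_succ_iff_deriv_of_isOpen isOpen_Ioi]
    refine ⟨fun y hy => (h1 y hy).differentiableAt.differentiableWithinAt, by simp, ?_⟩
    rw [show (1 : WithTop ℕ∞) = 0 + 1 by norm_num, contDiffOn_succ_iff_deriv_of_isOpen isOpen_Ioi]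
    exact ⟨fun y hy => (h2 y hy).differentiableAt.differentiableWithinAt, by simp,
      contDiffOn_zero.2 hcont⟩
  · rw [(deriv_deriv_valueE hU hH hW hσ htT hx).deriv]
    exact div_neg_of_neg_of_pos (neg_lt_zero.2 (Real.exp_pos _)) (hH.heat_deriv_pos _ _)

/-- Differentiating `u_x(H(z,t),t) = e^{-z-v/2}` gives `-u_x/u_xx = H_z`; dividing by `x = H(z,t)`
leaves the logarithmic slope. -/
theorem relRiskTolFn_valueE (hW : IsStandardBrownianMotion W P) (hσ : IsUnit σ)
    (htT : t ≤ T) {x : ℝ} (hx : 0 < x) :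
    relRiskTolFn (fun y s =>
      (valueE P (brownianFiltration W hW.measurable) W σ lam T U y s).toReal) x t =
      heat (fun z => riskTol U (terminalH U z)) (normSq lam * (T - t))
        (heatInv (terminalH U) (normSq lam * (T - t)) x) /
      heat (terminalH U) (normSq lam * (T - t))
        (heatInv (terminalH U) (normSq lam * (T - t)) x) := by
  have h1 := (deriv_valueE (σ := σ) (lam := lam) hU hH hW hσ htT hx).deriv
  have h2 := (deriv_deriv_valueE (σ := σ) (lam := lam) hU hH hW hσ htT hx).deriv
  rw [relRiskTolFn, h1, h2, heat_heatInv hH _ hx]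
  have h3 := hH.heat_deriv_pos (normSq lam * (T - t))
    (heatInv (terminalH U) (normSq lam * (T - t)) x)
  have h4 : 0 < primalMarginal U (normSq lam * (T - t)) x := Real.exp_pos _
  field_simp

/-- `r̃(·, t)` is convex if the logarithmic slope of the terminal profile is. -/
theorem convexOn_relRiskTolFn (hW : IsStandardBrownianMotion W P) (hσ : IsUnit σ)
    (htT : t ≤ T) (hconv : ConvexOn ℝ univ (logSlope U)) (hanti : Antitone (logSlope U)) :
    ConvexOn ℝ (Ioi 0) (fun x => relRiskTolFn (fun y s =>
      (valueE P (brownianFiltration W hW.measurable) W σ lam T U y s).toReal) x t) := by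
  set v := normSq lam * (T - t)
  have hk := hH.convexOn_heat_slope v hconv
  have ha := hH.antitone_mul_heat_slope v 1 (by simp only [one_mul]; exact hanti)
  simp only [one_mul] at ha
  refine (convexOn_comp_inverse (hH.heat_convexOn v) (hH.heat_strictMono v)
    (fun x hx => heat_heatInv hH v hx) hk ha).congr fun x hx => ?_
  exact (relRiskTolFn_valueE hU hH hW hσ htT hx).symm

/-- `r̃(·, t)` is concave if the logarithmic slope of the terminal profile is. -/
theorem concaveOn_relRiskTolFn (hW : IsStandardBrownianMotion W P) (hσ : IsUnit σ)
    (htT : t ≤ T) (hconc : ConcaveOn ℝ univ (logSlope U)) (hmono : Monotone (logSlope U)) :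
    ConcaveOn ℝ (Ioi 0) (fun x => relRiskTolFn (fun y s =>
      (valueE P (brownianFiltration W hW.measurable) W σ lam T U y s).toReal) x t) := by
  set v := normSq lam * (T - t)
  -- The negated slope is convex and antitone, so the same composition lemma applies.
  have hk := (hH.concaveOn_heat_slope v hconc).neg
  have ha := hH.antitone_mul_heat_slope v (-1)
    (by simp only [neg_one_mul]; exact hmono.neg)
  simp only [neg_one_mul] at ha
  refine neg_convexOn_iff.1 ((convexOn_comp_inverse (hH.heat_convexOn v) (hH.heat_strictMono v)
    (fun x hx => heat_heatInv hH v hx) hk ha).congr fun x hx => ?_)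
  exact congrArg Neg.neg (relRiskTolFn_valueE hU hH hW hσ htT hx).symm

end Regularity

end

end Merton

/-! ### Conclusion from the shape of the terminal profile. -/

theorem proposition11 {Ω : Type*} [MeasurableSpace Ω] (P : Measure Ω) [IsProbabilityMeasure P]
    {N : ℕ} (W : Fin N → ℝ≥0 → Ω → ℝ) (hW : Merton.IsStandardBrownianMotion W P)
    (σ : Matrix (Fin N) (Fin N) ℝ) (hσ : IsUnit σ) (μ : Fin N → ℝ) (r : ℝ) (hr : 0 < r)
    (T : ℝ≥0) (U : ℝ → ℝ) (hU : Merton.IsUtility U)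
    (hI : Merton.InverseMarginalGrowth U) (hR : Merton.RiskTolStanding U)
    (u : ℝ → ℝ≥0 → EReal)
    (hu : u = Merton.valueE P (Merton.brownianFiltration W hW.measurable) W σ
      (Merton.marketPriceOfRisk σ μ r) T U) :
    (((∀ z : ℝ, iteratedDeriv 2 (Merton.logTerminalH U) z < 0) ∧
        (∀ z : ℝ, 0 < iteratedDeriv 3 (Merton.logTerminalH U) z)) →
      (∀ x : ℝ, 0 < x → 0 < iteratedDeriv 2 (Merton.relRiskTolCoeff U) x) ∧
      ∀ t : ℝ≥0, t < T →
        Merton.RelRiskTolWellDefined u t ∧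
        ConvexOn ℝ (Ioi 0)
          (fun x => Merton.relRiskTolFn (fun y s => (u y s).toReal) x t)) ∧
    (((∀ z : ℝ, 0 < iteratedDeriv 2 (Merton.logTerminalH U) z) ∧
        (∀ z : ℝ, iteratedDeriv 3 (Merton.logTerminalH U) z < 0)) →
      (∀ x : ℝ, 0 < x → iteratedDeriv 2 (Merton.relRiskTolCoeff U) x < 0) ∧
      ∀ t : ℝ≥0, t < T →
        Merton.RelRiskTolWellDefined u t ∧
        ConcaveOn ℝ (Ioi 0)
          (fun x => Merton.relRiskTolFn (fun y s => (u y s).toReal) x t)) := by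
  subst hu
  have hH := Merton.isTerminalProfile_terminalH hU hI hR
  rw [Merton.iteratedDeriv_two_logTerminalH hU hR, Merton.iteratedDeriv_three_logTerminalH hU hR]
  refine ⟨fun ⟨h2, h3⟩ => ?_, fun ⟨h2, h3⟩ => ?_⟩
  -- Since `deriv` is `0` where a function is not differentiable, the strict signs themselves
  -- provide differentiability.
  · have hg : Differentiable ℝ (Merton.logSlope U) := fun z =>
      differentiableAt_of_deriv_ne_zero (h2 z).ne
    have hg' : Differentiable ℝ (deriv (Merton.logSlope U)) := fun z =>
      differentiableAt_of_deriv_ne_zero (h3 z).ne'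
    refine ⟨fun x hx => ?_, fun t ht =>
      ⟨Merton.relRiskTolWellDefined_valueE hU hH hW hσ ht.le,
        Merton.convexOn_relRiskTolFn hU hH hW hσ ht.le
          ((monotone_of_deriv_nonneg hg' fun z => (h3 z).le).convexOn_univ_of_deriv hg)
          (antitone_of_deriv_nonpos hg fun z => (h2 z).le)⟩⟩
    rw [Merton.iteratedDeriv_two_relRiskTolCoeff hU hR hg hg' hx]
    -- In `R̃'' = (g'' - g' R')/R²` both terms of the numerator point the same way, because `R' ≥
    -- 0`.
    have h5 := mul_nonpos_of_nonpos_of_nonneg (h2 (-Real.log (deriv U x))).le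
      (Merton.deriv_riskTol_nonneg hR hx)
    exact div_pos (by linarith [h3 (-Real.log (deriv U x))])
      (pow_pos (hU.riskTol_pos hR hx) 2)
  · have hg : Differentiable ℝ (Merton.logSlope U) := fun z =>
      differentiableAt_of_deriv_ne_zero (h2 z).ne'
    have hg' : Differentiable ℝ (deriv (Merton.logSlope U)) := fun z =>
      differentiableAt_of_deriv_ne_zero (h3 z).ne
    refine ⟨fun x hx => ?_, fun t ht =>
      ⟨Merton.relRiskTolWellDefined_valueE hU hH hW hσ ht.le,
        Merton.concaveOn_relRiskTolFn hU hH hW hσ ht.le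
          ((antitone_of_deriv_nonpos hg' fun z => (h3 z).le).concaveOn_univ_of_deriv hg)
          (monotone_of_deriv_nonneg hg fun z => (h2 z).le)⟩⟩
    rw [Merton.iteratedDeriv_two_relRiskTolCoeff hU hR hg hg' hx]
    have h5 := mul_nonneg (h2 (-Real.log (deriv U x))).le (Merton.deriv_riskTol_nonneg hR hx)
    exact div_neg_of_neg_of_pos (by linarith [h3 (-Real.log (deriv U x))])
      (pow_pos (hU.riskTol_pos hR hx) 2)
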